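/- **Definitions.** A *multicategory* consists of objects, sets $\mathbb M_n(a_1,\dots,a_n;b)$ of $n$-ary multimaps for all $n\ge 0$, identities $1_a\in\mathbb M_1(a;a)$ and substitutions $g\circ_i f$ of a multimap into the $i$-th input of another, satisfying the usual associativity, commutativity and identity axioms; multifunctors are maps on objects and multimaps preserving identities and substitutions. Unary multimaps form its underlying category. A *short multicategory* $\mathbb C$ consists of a category $C$ and functors $\mathbb C_n(-;-)\colon (C^n)^{op}\times C\to\mathrm{Set}$ for $0\le n\le 4$, with $\mathbb C_1(-;-)=C(-,-)$, together with substitutions $$\circ_i\colon \mathbb C_n(\overline b;c)\times\mathbb C_m(\overline a;b_i)\to\mathbb C_{n+m-1}(\overline b_{<i},\overline a,\overline b_{>i};c),\qquad 1\le i\le n,$$ for $(n,m)\in\{(2,2),(3,2),(2,3),(2,0),(3,0)\}$, natural in all variables other than $b_i$ and dinatural in $b_i$. For $f$ binary, $g$ of arity $n$ and $h$ of arity $p$, they satisfy (with substitution of or into a unary map given by the functors $\mathbb C_k(-;-)$): $f\circ_i(g\circ_j h)=(f\circ_i g)\circ_{j+i-1}h$ for $(n,p)\in\{(2,2),(2,0)\}$,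 $1\le i,j\le 2$; and $(f\circ_1 g)\circ_{n+1}h=(f\circ_2 h)\circ_1 g$ for $(n,p)\in\{(2,2),(2,0),(0,2),(0,0)\}$. A morphism is a functor $F\colon C\to D$ with natural families $F_n\colon\mathbb C_n(\overline a;b)\to\mathbb D_n(F\overline a;Fb)$, $0\le n\le 4$, with $F_1$ the action of $F$ on morphisms, commuting with all these substitutions. In either setting, a multimap $\theta\colon \overline a\to m$ is a *map classifier* for $\overline a$ if $-\circ_1\theta\colon \mathbb C_1(m;d)\to\mathbb C_{|\overline a|}(\overline a;d)$ is bijective for all $d$, and a *left universal* one if moreover $-\circ_1\theta\colon\mathbb C_{1+r}(m,\overline x;d)\to\mathbb C_{|\overline a|+r}(\overline a,\overline x;d)$ is bijective for all $d$ and all lists $\overline x$ of length $r$; in a short multicategory (where $|\overline a|\in\{0,2\}$) this is required only for $r\le 2$. A multicategory is *left representable* if every finite list of objects has a left universal map classifier; a short multicategory is *left representable* if it has a left universal nullary map classifier $u\colon\diamond\to i$ (where $\diamond$ denotes the empty list) and left universal binary map classifiers $\theta_{a,b}\colon a,b\to ab$ for all $a,b$. Let $\mathbf{Mult}_{lr}$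 and $\mathbf{ShMult}_{lr}$ be the corresponding full subcategories of the categories of multicategories and of short multicategories. A (left) *skew monoidal category* is a category with a functor $(a,b)\mapsto ab$, a unit $i$ and natural maps $\alpha\colon(ab)c\to a(bc)$, $\lambda\colon ia\to a$, $\rho\colon a\to ai$ (not necessarily invertible) satisfying $$(a\alpha_{b,c,d})\,\alpha_{a,bc,d}\,(\alpha_{a,b,c}d)=\alpha_{a,b,cd}\,\alpha_{ab,c,d},\quad \lambda_{ab}\,\alpha_{i,a,b}=\lambda_a b,\quad \alpha_{a,b,i}\,\rho_{ab}=a\rho_b,\quad (a\lambda_b)\,\alpha_{a,i,b}\,(\rho_a b)=1_{ab},\quad \lambda_i\rho_i=1_i;$$ it is *left normal* if $\lambda$ is invertible. Let $\mathbf{SkMon}_{ln}$ be the category of left normal skew monoidal categories and lax monoidal functors $(F,\ f_0\colon i\to Fi,\ f_2\colon FaFb\to F(ab))$. **The functors.** Choose left universal nullary and binary map classifiers $u$, $\theta_{a,b}$ in each left representable short multicategory. The functor $K\colon\mathbf{ShMult}_{lr}\to\mathbf{SkMon}_{ln}$ sends $\mathbb C$ to the category $C$ with tensor product $ab$ and unit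 $i$ the chosen classifying objects, the tensor product $fg$ of maps $f\colon a\to b$ and $g\colon c\to d$ determined by $(fg)\circ\theta_{a,c}=\theta_{b,d}\circ(f,g)$, and structure maps determined by $$\alpha\circ(\theta_{ab,c}\circ_1\theta_{a,b})=\theta_{a,bc}\circ_2\theta_{b,c},\qquad \lambda_a\circ(\theta_{i,a}\circ_1u)=1_a,\qquad \rho_a=\theta_{a,i}\circ_2u;$$ it sends a morphism $F$ to the lax monoidal functor $(F,f_0,f_2)$ with $f_0\circ u=F_0u$ and $f_2\circ\theta_{Fa,Fb}=F_2\theta_{a,b}$. The functor $U_{lr}\colon\mathbf{Mult}_{lr}\to\mathbf{ShMult}_{lr}$ keeps the underlying category and the multimaps of arity at most $4$, with the action of unary maps given by substitution, and those substitutions that are part of the structure of a short multicategory. **Theorem.** For every such choice of classifiers, the functor $K\colon\mathbf{ShMult}_{lr}\to\mathbf{SkMon}_{ln}$ is an equivalence of categories. The forgetful functor $U_{lr}\colon\mathbf{Mult}_{lr}\to\mathbf{ShMult}_{lr}$ is also an equivalence of categories. -/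

import Mathlib

open CategoryTheory

universe v u

set_option linter.checkUnivs false

/-! ### Multicategories -/

/-- Transport of a multimap along an equality of its list of inputs. -/
def castDom {O : Type u} {H : List O → O → Type v} {Γ Δ : List O} {b : O} (e : Γ = Δ)
    (f : H Γ b) : H Δ b :=
  e ▸ f

/-- A multicategory, presented by substitutions into a single input. The set of multimaps
`a₁, …, aₙ → b` is `Hom [a₁, …, aₙ] b`, and `comp l r g f` is the substitution `g ∘ᵢ f`, where the
list of inputs of `g` is `l, b, r` and `i = |l| + 1`. -/
structure Multicategory where
  Obj : Type u
  Hom : List Obj → Obj → Type v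
  id (a : Obj) : Hom [a] a
  comp (l r : List Obj) {Γ : List Obj} {b c : Obj} (g : Hom (l ++ b :: r) c) (f : Hom Γ b) :
    Hom (l ++ Γ ++ r) c
  id_comp {Γ : List Obj} {b : Obj} (g : Hom Γ b) :
    castDom (H := Hom) (by simp) (comp [] [] (id b) g) = g
  comp_id (l r : List Obj) {a b : Obj} (g : Hom (l ++ a :: r) b) :
    castDom (H := Hom) (by simp) (comp l r g (id a)) = g
  /-- `h ∘ᵢ (g ∘ⱼ f) = (h ∘ᵢ g) ∘ᵢ₊ⱼ₋₁ f` -/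
  assoc (l r l' r' : List Obj) {Γ : List Obj} {b c d : Obj}
    (h : Hom (l ++ c :: r) d) (g : Hom (l' ++ b :: r') c) (f : Hom Γ b) :
    castDom (H := Hom) (by simp) (comp l r h (comp l' r' g f)) =
      comp (l ++ l') (r' ++ r) (castDom (H := Hom) (by simp) (comp l r h g)) f
  /-- `(h ∘ᵢ g) ∘ₙ₊ⱼ₋₁ f = (h ∘ⱼ f) ∘ᵢ g` for `i < j`, where `n` is the arity of `g` -/
  comm (l m r : List Obj) {Γ Δ : List Obj} {b c d : Obj}
    (h : Hom (l ++ b :: (m ++ c :: r)) d) (g : Hom Γ b) (f : Hom Δ c) :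
    castDom (H := Hom) (by simp)
        (comp (l ++ Γ ++ m) r (castDom (H := Hom) (by simp) (comp l (m ++ c :: r) h g)) f) =
      comp l (m ++ Δ ++ r)
        (castDom (H := Hom) (by simp)
          (comp (l ++ b :: m) r (castDom (H := Hom) (by simp) h) f)) g

namespace Multicategory

/-- The underlying category of a multicategory: its morphisms are the unary multimaps. -/
instance category (M : Multicategory.{v, u}) : Category.{v} M.Obj where
  Hom a b := M.Hom [a] b
  id a := M.id a
  comp f g := M.comp [] [] g f
  id_comp f := M.comp_id [] [] f
  comp_id f := M.id_comp f
  assoc f g h := M.assoc [] [] [] [] h g f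

/-- `θ : Γ → m` is a map classifier for `Γ`: it represents the functor `Hom Γ -`. -/
def IsMapClassifier (M : Multicategory.{v, u}) {Γ : List M.Obj} {m : M.Obj} (θ : M.Hom Γ m) :
    Prop :=
  ∀ b, Function.Bijective fun g : M.Hom [m] b => M.comp [] [] g θ

/-- A map classifier `θ` is left universal when `- ∘₁ θ` is bijective for any further inputs. -/
def IsLeftUniversal (M : Multicategory.{v, u}) {Γ : List M.Obj} {m : M.Obj} (θ : M.Hom Γ m) :
    Prop :=
  M.IsMapClassifier θ ∧
    ∀ (y : List M.Obj) (d : M.Obj),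
      Function.Bijective fun g : M.Hom (m :: y) d => M.comp [] y g θ

/-- A multicategory is left representable when it has left universal map classifiers for all
lists of objects. -/
def IsLeftRepresentable (M : Multicategory.{v, u}) : Prop :=
  ∀ Γ : List M.Obj, ∃ (m : M.Obj) (θ : M.Hom Γ m), M.IsLeftUniversal θ

/-- Multifunctors. Compatibility with unary substitutions says that a multifunctor is a functor
of underlying categories and that its action on multimaps is natural. -/
structure Multifunctor (M N : Multicategory.{v, u}) where
  obj : M.Obj → N.Obj
  map {Γ : List M.Obj} {b : M.Obj} : M.Hom Γ b → N.Hom (Γ.map obj) (obj b)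
  map_id (a : M.Obj) : map (M.id a) = N.id (obj a)
  map_comp (l r : List M.Obj) {Γ : List M.Obj} {b c : M.Obj}
    (g : M.Hom (l ++ b :: r) c) (f : M.Hom Γ b) :
    castDom (H := N.Hom) (by simp) (map (M.comp l r g f)) =
      N.comp (l.map obj) (r.map obj) (castDom (H := N.Hom) (by simp) (map g)) (map f)

section cast

variable {O : Type u} {H : List O → O → Type v}

@[simp]
theorem castDom_rfl {Γ : List O} {b : O} (e : Γ = Γ) (f : H Γ b) : castDom e f = f := rfl

@[simp]
theorem castDom_castDom {Γ Δ Ξ : List O} {b : O} (e : Γ = Δ) (e' : Δ = Ξ) (f : H Γ b) :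
    castDom e' (castDom e f) = castDom (H := H) (e.trans e') f := by
  subst e e'; rfl

theorem castDom_eq_iff {Γ Δ : List O} {b : O} (e : Γ = Δ) (f : H Γ b) (g : H Δ b) :
    castDom e f = g ↔ f = castDom e.symm g := by
  subst e; rfl

theorem comp_castDom (M : Multicategory.{v, u}) {l l' r r' : List M.Obj} {Γ Γ' : List M.Obj}
    {b c : M.Obj} (hl : l = l') (hr : r = r') (hΓ : Γ = Γ')
    (g : M.Hom (l ++ b :: r) c) (f : M.Hom Γ b) :
    M.comp l' r' (castDom (H := M.Hom) (by rw [hl, hr]) g) (castDom (H := M.Hom) hΓ f) =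
      castDom (H := M.Hom) (by rw [hl, hr, hΓ]) (M.comp l r g f) := by
  subst hl hr hΓ; rfl

theorem map_castDom {M N : Multicategory.{v, u}} (F : Multifunctor M N) {Γ Δ : List M.Obj}
    {b : M.Obj} (e : Γ = Δ) (f : M.Hom Γ b) :
    F.map (castDom e f) = castDom (H := N.Hom) (congrArg (List.map F.obj) e) (F.map f) := by
  subst e; rfl

end cast

theorem Multifunctor.ext_of {M N : Multicategory.{v, u}} {F G : Multifunctor M N}
    (h : F.obj = G.obj)
    (h' : ∀ (Γ : List M.Obj) (b : M.Obj) (f : M.Hom Γ b), HEq (F.map f) (G.map f)) : F = G := by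
  obtain ⟨o, m, _, _⟩ := F
  obtain ⟨o', m', _, _⟩ := G
  obtain rfl : o = o' := h
  obtain rfl : @m = @m' := by
    funext Γ b f
    exact eq_of_heq (h' Γ b f)
  rfl

theorem castDom_heq {O : Type u} {H : List O → O → Type v} {Γ Δ : List O} {b : O} (e : Γ = Δ)
    (f : H Γ b) : HEq (castDom e f) f := by
  subst e; rfl

theorem map_castDom_heq {M N : Multicategory.{v, u}} (F : Multifunctor M N) {Γ Δ : List M.Obj}
    {b : M.Obj} (e : Γ = Δ) (f : M.Hom Γ b) : HEq (F.map (castDom e f)) (F.map f) := by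
  subst e; rfl

/-- The identity multifunctor. -/
def Multifunctor.id (M : Multicategory.{v, u}) : Multifunctor M M where
  obj a := a
  map f := castDom (H := M.Hom) (by simp) f
  map_id a := rfl
  map_comp l r Γ b c g f := by
    have h := comp_castDom M (List.map_id' l).symm (List.map_id' r).symm (List.map_id' Γ).symm g f
    rw [castDom_castDom, castDom_castDom]
    exact h.symm

/-- Composition of multifunctors. -/
def Multifunctor.comp {M N P : Multicategory.{v, u}} (F : Multifunctor M N)
    (G : Multifunctor N P) : Multifunctor M P where
  obj a := G.obj (F.obj a)
  map f := castDom (H := P.Hom) (by simp) (G.map (F.map f))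
  map_id a := by
    rw [F.map_id, G.map_id]; rfl
  map_comp l r Γ b c g f := by
    have h1 := (castDom_eq_iff _ _ _).1 (F.map_comp l r g f)
    have h2 := (castDom_eq_iff _ _ _).1 (G.map_comp (l.map F.obj) (r.map F.obj)
      (castDom (H := N.Hom) (by simp) (F.map g)) (F.map f))
    rw [h1, map_castDom, h2, map_castDom]
    have h3 := comp_castDom P (List.map_map (f := F.obj) (g := G.obj) (l := l))
      (List.map_map (f := F.obj) (g := G.obj) (l := r))
      (List.map_map (f := F.obj) (g := G.obj) (l := Γ))
      (castDom (H := P.Hom) (by simp) (G.map (F.map g))) (G.map (F.map f))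
    simp only [castDom_castDom] at h3 ⊢
    exact h3.symm

/-- The category of multicategories and multifunctors. -/
instance : Category Multicategory.{v, u} where
  Hom := Multifunctor
  id := Multifunctor.id
  comp := Multifunctor.comp
  id_comp F := by
    refine Multifunctor.ext_of rfl fun Γ b f => ?_
    refine (castDom_heq _ _).trans ?_
    exact map_castDom_heq F _ f
  comp_id F := by
    refine Multifunctor.ext_of rfl fun Γ b f => ?_
    exact (castDom_heq _ _).trans (castDom_heq _ _)
  assoc F G H := by
    refine Multifunctor.ext_of rfl fun Γ b f => ?_
    refine (castDom_heq _ _).trans (HEq.trans ?_ (castDom_heq _ _).symm)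
    exact (map_castDom_heq H _ (G.map (F.map f))).trans (castDom_heq _ _).symm

end Multicategory

/-- The full subcategory of left representable multicategories. -/
abbrev LeftRepMulticategory : Type (max (u + 1) (v + 1)) :=
  ObjectProperty.FullSubcategory (C := Multicategory.{v, u}) Multicategory.IsLeftRepresentable

/-! ### Short multicategories -/

/-- A short multicategory: a category `C` with sets of `n`-ary multimaps for `n = 0, 2, 3, 4` (the
unary multimaps are the morphisms of `C`), functorial via `mapₙ` in the inputs (contravariantly)
and the output (covariantly), and with substitutions `compₙₘᵢ g f = g ∘ᵢ f` of an `m`-ary multimap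
into the `i`-th input of an `n`-ary one. -/
structure ShortMulticategory where
  C : Type u
  [cat : Category.{v} C]
  Hom₀ : C → Type v
  Hom₂ : C → C → C → Type v
  Hom₃ : C → C → C → C → Type v
  Hom₄ : C → C → C → C → C → Type v
  -- functoriality
  map₀ {c c' : C} (r : c ⟶ c') (f : Hom₀ c) : Hom₀ c'
  map₂ {a₁ a₂ c a₁' a₂' c' : C} (p₁ : a₁' ⟶ a₁) (p₂ : a₂' ⟶ a₂) (r : c ⟶ c')
    (f : Hom₂ a₁ a₂ c) : Hom₂ a₁' a₂' c'
  map₃ {a₁ a₂ a₃ c a₁' a₂' a₃' c' : C} (p₁ : a₁' ⟶ a₁) (p₂ : a₂' ⟶ a₂) (p₃ : a₃' ⟶ a₃)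
    (r : c ⟶ c') (f : Hom₃ a₁ a₂ a₃ c) : Hom₃ a₁' a₂' a₃' c'
  map₄ {a₁ a₂ a₃ a₄ c a₁' a₂' a₃' a₄' c' : C} (p₁ : a₁' ⟶ a₁) (p₂ : a₂' ⟶ a₂) (p₃ : a₃' ⟶ a₃)
    (p₄ : a₄' ⟶ a₄) (r : c ⟶ c') (f : Hom₄ a₁ a₂ a₃ a₄ c) : Hom₄ a₁' a₂' a₃' a₄' c'
  map₀_id {c : C} (f : Hom₀ c) : map₀ (𝟙 c) f = f
  map₂_id {a₁ a₂ c : C} (f : Hom₂ a₁ a₂ c) : map₂ (𝟙 a₁) (𝟙 a₂) (𝟙 c) f = f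
  map₃_id {a₁ a₂ a₃ c : C} (f : Hom₃ a₁ a₂ a₃ c) : map₃ (𝟙 a₁) (𝟙 a₂) (𝟙 a₃) (𝟙 c) f = f
  map₄_id {a₁ a₂ a₃ a₄ c : C} (f : Hom₄ a₁ a₂ a₃ a₄ c) :
    map₄ (𝟙 a₁) (𝟙 a₂) (𝟙 a₃) (𝟙 a₄) (𝟙 c) f = f
  map₀_comp {c c' c'' : C} (r : c ⟶ c') (r' : c' ⟶ c'') (f : Hom₀ c) :
    map₀ (r ≫ r') f = map₀ r' (map₀ r f)
  map₂_comp {a₁ a₂ c a₁' a₂' c' a₁'' a₂'' c'' : C} (p₁ : a₁' ⟶ a₁) (p₁' : a₁'' ⟶ a₁')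
    (p₂ : a₂' ⟶ a₂) (p₂' : a₂'' ⟶ a₂') (r : c ⟶ c') (r' : c' ⟶ c'') (f : Hom₂ a₁ a₂ c) :
    map₂ (p₁' ≫ p₁) (p₂' ≫ p₂) (r ≫ r') f = map₂ p₁' p₂' r' (map₂ p₁ p₂ r f)
  map₃_comp {a₁ a₂ a₃ c a₁' a₂' a₃' c' a₁'' a₂'' a₃'' c'' : C} (p₁ : a₁' ⟶ a₁) (p₁' : a₁'' ⟶ a₁')
    (p₂ : a₂' ⟶ a₂) (p₂' : a₂'' ⟶ a₂') (p₃ : a₃' ⟶ a₃) (p₃' : a₃'' ⟶ a₃')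
    (r : c ⟶ c') (r' : c' ⟶ c'') (f : Hom₃ a₁ a₂ a₃ c) :
    map₃ (p₁' ≫ p₁) (p₂' ≫ p₂) (p₃' ≫ p₃) (r ≫ r') f = map₃ p₁' p₂' p₃' r' (map₃ p₁ p₂ p₃ r f)
  map₄_comp {a₁ a₂ a₃ a₄ c a₁' a₂' a₃' a₄' c' a₁'' a₂'' a₃'' a₄'' c'' : C}
    (p₁ : a₁' ⟶ a₁) (p₁' : a₁'' ⟶ a₁') (p₂ : a₂' ⟶ a₂) (p₂' : a₂'' ⟶ a₂')
    (p₃ : a₃' ⟶ a₃) (p₃' : a₃'' ⟶ a₃') (p₄ : a₄' ⟶ a₄) (p₄' : a₄'' ⟶ a₄')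
    (r : c ⟶ c') (r' : c' ⟶ c'') (f : Hom₄ a₁ a₂ a₃ a₄ c) :
    map₄ (p₁' ≫ p₁) (p₂' ≫ p₂) (p₃' ≫ p₃) (p₄' ≫ p₄) (r ≫ r') f =
      map₄ p₁' p₂' p₃' p₄' r' (map₄ p₁ p₂ p₃ p₄ r f)
  -- substitution of binary multimaps into binary ones
  comp₂₂₁ {a₁ a₂ b₁ b₂ c : C} (g : Hom₂ b₁ b₂ c) (f : Hom₂ a₁ a₂ b₁) : Hom₃ a₁ a₂ b₂ c
  comp₂₂₂ {a₁ a₂ b₁ b₂ c : C} (g : Hom₂ b₁ b₂ c) (f : Hom₂ a₁ a₂ b₂) : Hom₃ b₁ a₁ a₂ c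
  -- substitution of binary multimaps into ternary ones
  comp₃₂₁ {a₁ a₂ b₁ b₂ b₃ c : C} (g : Hom₃ b₁ b₂ b₃ c) (f : Hom₂ a₁ a₂ b₁) : Hom₄ a₁ a₂ b₂ b₃ c
  comp₃₂₂ {a₁ a₂ b₁ b₂ b₃ c : C} (g : Hom₃ b₁ b₂ b₃ c) (f : Hom₂ a₁ a₂ b₂) : Hom₄ b₁ a₁ a₂ b₃ c
  comp₃₂₃ {a₁ a₂ b₁ b₂ b₃ c : C} (g : Hom₃ b₁ b₂ b₃ c) (f : Hom₂ a₁ a₂ b₃) : Hom₄ b₁ b₂ a₁ a₂ c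
  -- substitution of ternary multimaps into binary ones
  comp₂₃₁ {a₁ a₂ a₃ b₁ b₂ c : C} (g : Hom₂ b₁ b₂ c) (f : Hom₃ a₁ a₂ a₃ b₁) : Hom₄ a₁ a₂ a₃ b₂ c
  comp₂₃₂ {a₁ a₂ a₃ b₁ b₂ c : C} (g : Hom₂ b₁ b₂ c) (f : Hom₃ a₁ a₂ a₃ b₂) : Hom₄ b₁ a₁ a₂ a₃ c
  -- substitution of nullary multimaps into binary ones
  comp₂₀₁ {b₁ b₂ c : C} (g : Hom₂ b₁ b₂ c) (f : Hom₀ b₁) : b₂ ⟶ c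
  comp₂₀₂ {b₁ b₂ c : C} (g : Hom₂ b₁ b₂ c) (f : Hom₀ b₂) : b₁ ⟶ c
  -- substitution of nullary multimaps into ternary ones
  comp₃₀₁ {b₁ b₂ b₃ c : C} (g : Hom₃ b₁ b₂ b₃ c) (f : Hom₀ b₁) : Hom₂ b₂ b₃ c
  comp₃₀₂ {b₁ b₂ b₃ c : C} (g : Hom₃ b₁ b₂ b₃ c) (f : Hom₀ b₂) : Hom₂ b₁ b₃ c
  comp₃₀₃ {b₁ b₂ b₃ c : C} (g : Hom₃ b₁ b₂ b₃ c) (f : Hom₀ b₃) : Hom₂ b₁ b₂ c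
  -- naturality of the substitutions
  nat₂₂₁ {a₁ a₂ a₁' a₂' b₁ b₂ b₂' c c' : C}
    (p₁ : a₁' ⟶ a₁) (p₂ : a₂' ⟶ a₂) (q₂ : b₂' ⟶ b₂) (r : c ⟶ c')
    (g : Hom₂ b₁ b₂ c) (f : Hom₂ a₁ a₂ b₁) :
    comp₂₂₁ (map₂ (𝟙 _) q₂ r g) (map₂ p₁ p₂ (𝟙 _) f) =
      map₃ p₁ p₂ q₂ r (comp₂₂₁ g f)
  nat₂₂₂ {a₁ a₂ a₁' a₂' b₁ b₂ b₁' c c' : C}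
    (p₁ : a₁' ⟶ a₁) (p₂ : a₂' ⟶ a₂) (q₁ : b₁' ⟶ b₁) (r : c ⟶ c')
    (g : Hom₂ b₁ b₂ c) (f : Hom₂ a₁ a₂ b₂) :
    comp₂₂₂ (map₂ q₁ (𝟙 _) r g) (map₂ p₁ p₂ (𝟙 _) f) =
      map₃ q₁ p₁ p₂ r (comp₂₂₂ g f)
  nat₃₂₁ {a₁ a₂ a₁' a₂' b₁ b₂ b₃ b₂' b₃' c c' : C}
    (p₁ : a₁' ⟶ a₁) (p₂ : a₂' ⟶ a₂) (q₂ : b₂' ⟶ b₂) (q₃ : b₃' ⟶ b₃) (r : c ⟶ c')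
    (g : Hom₃ b₁ b₂ b₃ c) (f : Hom₂ a₁ a₂ b₁) :
    comp₃₂₁ (map₃ (𝟙 _) q₂ q₃ r g) (map₂ p₁ p₂ (𝟙 _) f) =
      map₄ p₁ p₂ q₂ q₃ r (comp₃₂₁ g f)
  nat₃₂₂ {a₁ a₂ a₁' a₂' b₁ b₂ b₃ b₁' b₃' c c' : C}
    (p₁ : a₁' ⟶ a₁) (p₂ : a₂' ⟶ a₂) (q₁ : b₁' ⟶ b₁) (q₃ : b₃' ⟶ b₃) (r : c ⟶ c')
    (g : Hom₃ b₁ b₂ b₃ c) (f : Hom₂ a₁ a₂ b₂) :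
    comp₃₂₂ (map₃ q₁ (𝟙 _) q₃ r g) (map₂ p₁ p₂ (𝟙 _) f) =
      map₄ q₁ p₁ p₂ q₃ r (comp₃₂₂ g f)
  nat₃₂₃ {a₁ a₂ a₁' a₂' b₁ b₂ b₃ b₁' b₂' c c' : C}
    (p₁ : a₁' ⟶ a₁) (p₂ : a₂' ⟶ a₂) (q₁ : b₁' ⟶ b₁) (q₂ : b₂' ⟶ b₂) (r : c ⟶ c')
    (g : Hom₃ b₁ b₂ b₃ c) (f : Hom₂ a₁ a₂ b₃) :
    comp₃₂₃ (map₃ q₁ q₂ (𝟙 _) r g) (map₂ p₁ p₂ (𝟙 _) f) =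
      map₄ q₁ q₂ p₁ p₂ r (comp₃₂₃ g f)
  nat₂₃₁ {a₁ a₂ a₃ a₁' a₂' a₃' b₁ b₂ b₂' c c' : C}
    (p₁ : a₁' ⟶ a₁) (p₂ : a₂' ⟶ a₂) (p₃ : a₃' ⟶ a₃) (q₂ : b₂' ⟶ b₂) (r : c ⟶ c')
    (g : Hom₂ b₁ b₂ c) (f : Hom₃ a₁ a₂ a₃ b₁) :
    comp₂₃₁ (map₂ (𝟙 _) q₂ r g) (map₃ p₁ p₂ p₃ (𝟙 _) f) =
      map₄ p₁ p₂ p₃ q₂ r (comp₂₃₁ g f)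
  nat₂₃₂ {a₁ a₂ a₃ a₁' a₂' a₃' b₁ b₂ b₁' c c' : C}
    (p₁ : a₁' ⟶ a₁) (p₂ : a₂' ⟶ a₂) (p₃ : a₃' ⟶ a₃) (q₁ : b₁' ⟶ b₁) (r : c ⟶ c')
    (g : Hom₂ b₁ b₂ c) (f : Hom₃ a₁ a₂ a₃ b₂) :
    comp₂₃₂ (map₂ q₁ (𝟙 _) r g) (map₃ p₁ p₂ p₃ (𝟙 _) f) =
      map₄ q₁ p₁ p₂ p₃ r (comp₂₃₂ g f)
  nat₂₀₁ {b₁ b₂ b₂' c c' : C}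
    (q₂ : b₂' ⟶ b₂) (r : c ⟶ c')
    (g : Hom₂ b₁ b₂ c) (f : Hom₀ b₁) :
    comp₂₀₁ (map₂ (𝟙 _) q₂ r g) f =
      q₂ ≫ comp₂₀₁ g f ≫ r
  nat₂₀₂ {b₁ b₂ b₁' c c' : C}
    (q₁ : b₁' ⟶ b₁) (r : c ⟶ c')
    (g : Hom₂ b₁ b₂ c) (f : Hom₀ b₂) :
    comp₂₀₂ (map₂ q₁ (𝟙 _) r g) f =
      q₁ ≫ comp₂₀₂ g f ≫ r
  nat₃₀₁ {b₁ b₂ b₃ b₂' b₃' c c' : C}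
    (q₂ : b₂' ⟶ b₂) (q₃ : b₃' ⟶ b₃) (r : c ⟶ c')
    (g : Hom₃ b₁ b₂ b₃ c) (f : Hom₀ b₁) :
    comp₃₀₁ (map₃ (𝟙 _) q₂ q₃ r g) f =
      map₂ q₂ q₃ r (comp₃₀₁ g f)
  nat₃₀₂ {b₁ b₂ b₃ b₁' b₃' c c' : C}
    (q₁ : b₁' ⟶ b₁) (q₃ : b₃' ⟶ b₃) (r : c ⟶ c')
    (g : Hom₃ b₁ b₂ b₃ c) (f : Hom₀ b₂) :
    comp₃₀₂ (map₃ q₁ (𝟙 _) q₃ r g) f =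
      map₂ q₁ q₃ r (comp₃₀₂ g f)
  nat₃₀₃ {b₁ b₂ b₃ b₁' b₂' c c' : C}
    (q₁ : b₁' ⟶ b₁) (q₂ : b₂' ⟶ b₂) (r : c ⟶ c')
    (g : Hom₃ b₁ b₂ b₃ c) (f : Hom₀ b₃) :
    comp₃₀₃ (map₃ q₁ q₂ (𝟙 _) r g) f =
      map₂ q₁ q₂ r (comp₃₀₃ g f)
  -- dinaturality of the substitutions
  dinat₂₂₁ {a₁ a₂ b₁ b₂ b₁' c : C} (s : b₁ ⟶ b₁')
    (g : Hom₂ b₁' b₂ c) (f : Hom₂ a₁ a₂ b₁) :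
    comp₂₂₁ (map₂ s (𝟙 _) (𝟙 _) g) f = comp₂₂₁ g (map₂ (𝟙 _) (𝟙 _) s f)
  dinat₂₂₂ {a₁ a₂ b₁ b₂ b₂' c : C} (s : b₂ ⟶ b₂')
    (g : Hom₂ b₁ b₂' c) (f : Hom₂ a₁ a₂ b₂) :
    comp₂₂₂ (map₂ (𝟙 _) s (𝟙 _) g) f = comp₂₂₂ g (map₂ (𝟙 _) (𝟙 _) s f)
  dinat₃₂₁ {a₁ a₂ b₁ b₂ b₃ b₁' c : C} (s : b₁ ⟶ b₁')
    (g : Hom₃ b₁' b₂ b₃ c) (f : Hom₂ a₁ a₂ b₁) :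
    comp₃₂₁ (map₃ s (𝟙 _) (𝟙 _) (𝟙 _) g) f = comp₃₂₁ g (map₂ (𝟙 _) (𝟙 _) s f)
  dinat₃₂₂ {a₁ a₂ b₁ b₂ b₃ b₂' c : C} (s : b₂ ⟶ b₂')
    (g : Hom₃ b₁ b₂' b₃ c) (f : Hom₂ a₁ a₂ b₂) :
    comp₃₂₂ (map₃ (𝟙 _) s (𝟙 _) (𝟙 _) g) f = comp₃₂₂ g (map₂ (𝟙 _) (𝟙 _) s f)
  dinat₃₂₃ {a₁ a₂ b₁ b₂ b₃ b₃' c : C} (s : b₃ ⟶ b₃')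
    (g : Hom₃ b₁ b₂ b₃' c) (f : Hom₂ a₁ a₂ b₃) :
    comp₃₂₃ (map₃ (𝟙 _) (𝟙 _) s (𝟙 _) g) f = comp₃₂₃ g (map₂ (𝟙 _) (𝟙 _) s f)
  dinat₂₃₁ {a₁ a₂ a₃ b₁ b₂ b₁' c : C} (s : b₁ ⟶ b₁')
    (g : Hom₂ b₁' b₂ c) (f : Hom₃ a₁ a₂ a₃ b₁) :
    comp₂₃₁ (map₂ s (𝟙 _) (𝟙 _) g) f = comp₂₃₁ g (map₃ (𝟙 _) (𝟙 _) (𝟙 _) s f)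
  dinat₂₃₂ {a₁ a₂ a₃ b₁ b₂ b₂' c : C} (s : b₂ ⟶ b₂')
    (g : Hom₂ b₁ b₂' c) (f : Hom₃ a₁ a₂ a₃ b₂) :
    comp₂₃₂ (map₂ (𝟙 _) s (𝟙 _) g) f = comp₂₃₂ g (map₃ (𝟙 _) (𝟙 _) (𝟙 _) s f)
  dinat₂₀₁ {b₁ b₂ b₁' c : C} (s : b₁ ⟶ b₁')
    (g : Hom₂ b₁' b₂ c) (f : Hom₀ b₁) :
    comp₂₀₁ (map₂ s (𝟙 _) (𝟙 _) g) f = comp₂₀₁ g (map₀ s f)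
  dinat₂₀₂ {b₁ b₂ b₂' c : C} (s : b₂ ⟶ b₂')
    (g : Hom₂ b₁ b₂' c) (f : Hom₀ b₂) :
    comp₂₀₂ (map₂ (𝟙 _) s (𝟙 _) g) f = comp₂₀₂ g (map₀ s f)
  dinat₃₀₁ {b₁ b₂ b₃ b₁' c : C} (s : b₁ ⟶ b₁')
    (g : Hom₃ b₁' b₂ b₃ c) (f : Hom₀ b₁) :
    comp₃₀₁ (map₃ s (𝟙 _) (𝟙 _) (𝟙 _) g) f = comp₃₀₁ g (map₀ s f)
  dinat₃₀₂ {b₁ b₂ b₃ b₂' c : C} (s : b₂ ⟶ b₂')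
    (g : Hom₃ b₁ b₂' b₃ c) (f : Hom₀ b₂) :
    comp₃₀₂ (map₃ (𝟙 _) s (𝟙 _) (𝟙 _) g) f = comp₃₀₂ g (map₀ s f)
  dinat₃₀₃ {b₁ b₂ b₃ b₃' c : C} (s : b₃ ⟶ b₃')
    (g : Hom₃ b₁ b₂ b₃' c) (f : Hom₀ b₃) :
    comp₃₀₃ (map₃ (𝟙 _) (𝟙 _) s (𝟙 _) g) f = comp₃₀₃ g (map₀ s f)
  -- associativity `f ∘ᵢ (g ∘ⱼ h) = (f ∘ᵢ g) ∘ᵢ₊ⱼ₋₁ h` for `f`, `g`, `h` binary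
  assoc₁₁ {x y z w c d e : C} (f : Hom₂ c d e) (g : Hom₂ z w c) (h : Hom₂ x y z) :
    comp₂₃₁ f (comp₂₂₁ g h) = comp₃₂₁ (comp₂₂₁ f g) h
  assoc₁₂ {x y z w c d e : C} (f : Hom₂ c d e) (g : Hom₂ z w c) (h : Hom₂ x y w) :
    comp₂₃₁ f (comp₂₂₂ g h) = comp₃₂₂ (comp₂₂₁ f g) h
  assoc₂₁ {x y z w c d e : C} (f : Hom₂ c d e) (g : Hom₂ z w d) (h : Hom₂ x y z) :
    comp₂₃₂ f (comp₂₂₁ g h) = comp₃₂₂ (comp₂₂₂ f g) h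
  assoc₂₂ {x y z w c d e : C} (f : Hom₂ c d e) (g : Hom₂ z w d) (h : Hom₂ x y w) :
    comp₂₃₂ f (comp₂₂₂ g h) = comp₃₂₃ (comp₂₂₂ f g) h
  -- associativity `f ∘ᵢ (g ∘ⱼ h) = (f ∘ᵢ g) ∘ᵢ₊ⱼ₋₁ h` for `f`, `g` binary and `h` nullary
  assoc₁₁_null {z w c d e : C} (f : Hom₂ c d e) (g : Hom₂ z w c) (h : Hom₀ z) :
    map₂ (comp₂₀₁ g h) (𝟙 d) (𝟙 e) f = comp₃₀₁ (comp₂₂₁ f g) h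
  assoc₁₂_null {z w c d e : C} (f : Hom₂ c d e) (g : Hom₂ z w c) (h : Hom₀ w) :
    map₂ (comp₂₀₂ g h) (𝟙 d) (𝟙 e) f = comp₃₀₂ (comp₂₂₁ f g) h
  assoc₂₁_null {z w c d e : C} (f : Hom₂ c d e) (g : Hom₂ z w d) (h : Hom₀ z) :
    map₂ (𝟙 c) (comp₂₀₁ g h) (𝟙 e) f = comp₃₀₂ (comp₂₂₂ f g) h
  assoc₂₂_null {z w c d e : C} (f : Hom₂ c d e) (g : Hom₂ z w d) (h : Hom₀ w) :
    map₂ (𝟙 c) (comp₂₀₂ g h) (𝟙 e) f = comp₃₀₃ (comp₂₂₂ f g) h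
  -- commutativity `(f ∘₁ g) ∘ₙ₊₁ h = (f ∘₂ h) ∘₁ g` for `f` binary, `g` of arity `n` and `h` of
  -- arity `p`, where `(n, p) = (2, 2), (2, 0), (0, 2), (0, 0)`
  comm₂₂ {x y z w c d e : C} (f : Hom₂ c d e) (g : Hom₂ x y c) (h : Hom₂ z w d) :
    comp₃₂₃ (comp₂₂₁ f g) h = comp₃₂₁ (comp₂₂₂ f h) g
  comm₂₀ {x y c d e : C} (f : Hom₂ c d e) (g : Hom₂ x y c) (h : Hom₀ d) :
    comp₃₀₃ (comp₂₂₁ f g) h = map₂ (𝟙 x) (𝟙 y) (comp₂₀₂ f h) g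
  comm₀₂ {z w c d e : C} (f : Hom₂ c d e) (g : Hom₀ c) (h : Hom₂ z w d) :
    map₂ (𝟙 z) (𝟙 w) (comp₂₀₁ f g) h = comp₃₀₁ (comp₂₂₂ f h) g
  comm₀₀ {c d e : C} (f : Hom₂ c d e) (g : Hom₀ c) (h : Hom₀ d) :
    map₀ (comp₂₀₁ f g) h = map₀ (comp₂₀₂ f h) g

namespace ShortMulticategory

attribute [instance] ShortMulticategory.cat

/-- A morphism of short multicategories: a functor with natural families `Fₙ` on `n`-ary
multimaps, for `n = 0, 2, 3, 4`, commuting with all substitutions. -/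
structure Morphism (M N : ShortMulticategory.{v, u}) where
  functor : M.C ⥤ N.C
  F₀ {c : M.C} : M.Hom₀ c → N.Hom₀ (functor.obj c)
  F₂ {a₁ a₂ c : M.C} : M.Hom₂ a₁ a₂ c →
    N.Hom₂ (functor.obj a₁) (functor.obj a₂) (functor.obj c)
  F₃ {a₁ a₂ a₃ c : M.C} : M.Hom₃ a₁ a₂ a₃ c →
    N.Hom₃ (functor.obj a₁) (functor.obj a₂) (functor.obj a₃) (functor.obj c)
  F₄ {a₁ a₂ a₃ a₄ c : M.C} : M.Hom₄ a₁ a₂ a₃ a₄ c →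
    N.Hom₄ (functor.obj a₁) (functor.obj a₂) (functor.obj a₃) (functor.obj a₄) (functor.obj c)
  nat₀ {c c' : M.C} (r : c ⟶ c') (f : M.Hom₀ c) :
    F₀ (M.map₀ r f) = N.map₀ (functor.map r) (F₀ f)
  nat₂ {a₁ a₂ c a₁' a₂' c' : M.C} (p₁ : a₁' ⟶ a₁) (p₂ : a₂' ⟶ a₂) (r : c ⟶ c')
    (f : M.Hom₂ a₁ a₂ c) :
    F₂ (M.map₂ p₁ p₂ r f) =
      N.map₂ (functor.map p₁) (functor.map p₂) (functor.map r) (F₂ f)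
  nat₃ {a₁ a₂ a₃ c a₁' a₂' a₃' c' : M.C} (p₁ : a₁' ⟶ a₁) (p₂ : a₂' ⟶ a₂) (p₃ : a₃' ⟶ a₃)
    (r : c ⟶ c') (f : M.Hom₃ a₁ a₂ a₃ c) :
    F₃ (M.map₃ p₁ p₂ p₃ r f) =
      N.map₃ (functor.map p₁) (functor.map p₂) (functor.map p₃) (functor.map r) (F₃ f)
  nat₄ {a₁ a₂ a₃ a₄ c a₁' a₂' a₃' a₄' c' : M.C} (p₁ : a₁' ⟶ a₁) (p₂ : a₂' ⟶ a₂)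
    (p₃ : a₃' ⟶ a₃) (p₄ : a₄' ⟶ a₄) (r : c ⟶ c') (f : M.Hom₄ a₁ a₂ a₃ a₄ c) :
    F₄ (M.map₄ p₁ p₂ p₃ p₄ r f) =
      N.map₄ (functor.map p₁) (functor.map p₂) (functor.map p₃) (functor.map p₄)
        (functor.map r) (F₄ f)
  map_comp₂₂₁ {a₁ a₂ b₁ b₂ c : M.C} (g : M.Hom₂ b₁ b₂ c) (f : M.Hom₂ a₁ a₂ b₁) :
    F₃ (M.comp₂₂₁ g f) = N.comp₂₂₁ (F₂ g) (F₂ f)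
  map_comp₂₂₂ {a₁ a₂ b₁ b₂ c : M.C} (g : M.Hom₂ b₁ b₂ c) (f : M.Hom₂ a₁ a₂ b₂) :
    F₃ (M.comp₂₂₂ g f) = N.comp₂₂₂ (F₂ g) (F₂ f)
  map_comp₃₂₁ {a₁ a₂ b₁ b₂ b₃ c : M.C} (g : M.Hom₃ b₁ b₂ b₃ c) (f : M.Hom₂ a₁ a₂ b₁) :
    F₄ (M.comp₃₂₁ g f) = N.comp₃₂₁ (F₃ g) (F₂ f)
  map_comp₃₂₂ {a₁ a₂ b₁ b₂ b₃ c : M.C} (g : M.Hom₃ b₁ b₂ b₃ c) (f : M.Hom₂ a₁ a₂ b₂) :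
    F₄ (M.comp₃₂₂ g f) = N.comp₃₂₂ (F₃ g) (F₂ f)
  map_comp₃₂₃ {a₁ a₂ b₁ b₂ b₃ c : M.C} (g : M.Hom₃ b₁ b₂ b₃ c) (f : M.Hom₂ a₁ a₂ b₃) :
    F₄ (M.comp₃₂₃ g f) = N.comp₃₂₃ (F₃ g) (F₂ f)
  map_comp₂₃₁ {a₁ a₂ a₃ b₁ b₂ c : M.C} (g : M.Hom₂ b₁ b₂ c) (f : M.Hom₃ a₁ a₂ a₃ b₁) :
    F₄ (M.comp₂₃₁ g f) = N.comp₂₃₁ (F₂ g) (F₃ f)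
  map_comp₂₃₂ {a₁ a₂ a₃ b₁ b₂ c : M.C} (g : M.Hom₂ b₁ b₂ c) (f : M.Hom₃ a₁ a₂ a₃ b₂) :
    F₄ (M.comp₂₃₂ g f) = N.comp₂₃₂ (F₂ g) (F₃ f)
  map_comp₂₀₁ {b₁ b₂ c : M.C} (g : M.Hom₂ b₁ b₂ c) (f : M.Hom₀ b₁) :
    functor.map (M.comp₂₀₁ g f) = N.comp₂₀₁ (F₂ g) (F₀ f)
  map_comp₂₀₂ {b₁ b₂ c : M.C} (g : M.Hom₂ b₁ b₂ c) (f : M.Hom₀ b₂) :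
    functor.map (M.comp₂₀₂ g f) = N.comp₂₀₂ (F₂ g) (F₀ f)
  map_comp₃₀₁ {b₁ b₂ b₃ c : M.C} (g : M.Hom₃ b₁ b₂ b₃ c) (f : M.Hom₀ b₁) :
    F₂ (M.comp₃₀₁ g f) = N.comp₃₀₁ (F₃ g) (F₀ f)
  map_comp₃₀₂ {b₁ b₂ b₃ c : M.C} (g : M.Hom₃ b₁ b₂ b₃ c) (f : M.Hom₀ b₂) :
    F₂ (M.comp₃₀₂ g f) = N.comp₃₀₂ (F₃ g) (F₀ f)
  map_comp₃₀₃ {b₁ b₂ b₃ c : M.C} (g : M.Hom₃ b₁ b₂ b₃ c) (f : M.Hom₀ b₃) :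
    F₂ (M.comp₃₀₃ g f) = N.comp₃₀₃ (F₃ g) (F₀ f)

/-- The identity morphism. -/
def Morphism.id (M : ShortMulticategory.{v, u}) : Morphism M M where
  functor := 𝟭 M.C
  F₀ f := f
  F₂ f := f
  F₃ f := f
  F₄ f := f
  nat₀ _ _ := rfl
  nat₂ _ _ _ _ := rfl
  nat₃ _ _ _ _ _ := rfl
  nat₄ _ _ _ _ _ _ := rfl
  map_comp₂₂₁ _ _ := rfl
  map_comp₂₂₂ _ _ := rfl
  map_comp₃₂₁ _ _ := rfl
  map_comp₃₂₂ _ _ := rfl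
  map_comp₃₂₃ _ _ := rfl
  map_comp₂₃₁ _ _ := rfl
  map_comp₂₃₂ _ _ := rfl
  map_comp₂₀₁ _ _ := rfl
  map_comp₂₀₂ _ _ := rfl
  map_comp₃₀₁ _ _ := rfl
  map_comp₃₀₂ _ _ := rfl
  map_comp₃₀₃ _ _ := rfl

/-- Composition of morphisms. -/
def Morphism.comp {M N P : ShortMulticategory.{v, u}} (F : Morphism M N) (G : Morphism N P) :
    Morphism M P where
  functor := F.functor ⋙ G.functor
  F₀ f := G.F₀ (F.F₀ f)
  F₂ f := G.F₂ (F.F₂ f)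
  F₃ f := G.F₃ (F.F₃ f)
  F₄ f := G.F₄ (F.F₄ f)
  nat₀ _ _ := by rw [F.nat₀, G.nat₀]; rfl
  nat₂ _ _ _ _ := by rw [F.nat₂, G.nat₂]; rfl
  nat₃ _ _ _ _ _ := by rw [F.nat₃, G.nat₃]; rfl
  nat₄ _ _ _ _ _ _ := by rw [F.nat₄, G.nat₄]; rfl
  map_comp₂₂₁ _ _ := by rw [F.map_comp₂₂₁, G.map_comp₂₂₁]
  map_comp₂₂₂ _ _ := by rw [F.map_comp₂₂₂, G.map_comp₂₂₂]
  map_comp₃₂₁ _ _ := by rw [F.map_comp₃₂₁, G.map_comp₃₂₁]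
  map_comp₃₂₂ _ _ := by rw [F.map_comp₃₂₂, G.map_comp₃₂₂]
  map_comp₃₂₃ _ _ := by rw [F.map_comp₃₂₃, G.map_comp₃₂₃]
  map_comp₂₃₁ _ _ := by rw [F.map_comp₂₃₁, G.map_comp₂₃₁]
  map_comp₂₃₂ _ _ := by rw [F.map_comp₂₃₂, G.map_comp₂₃₂]
  map_comp₂₀₁ _ _ := by rw [Functor.comp_map, F.map_comp₂₀₁, G.map_comp₂₀₁]
  map_comp₂₀₂ _ _ := by rw [Functor.comp_map, F.map_comp₂₀₂, G.map_comp₂₀₂]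
  map_comp₃₀₁ _ _ := by rw [F.map_comp₃₀₁, G.map_comp₃₀₁]
  map_comp₃₀₂ _ _ := by rw [F.map_comp₃₀₂, G.map_comp₃₀₂]
  map_comp₃₀₃ _ _ := by rw [F.map_comp₃₀₃, G.map_comp₃₀₃]

/-- The category of short multicategories. -/
instance : Category ShortMulticategory.{v, u} where
  Hom := Morphism
  id := Morphism.id
  comp := Morphism.comp

/-- A nullary multimap `u` is a left universal nullary map classifier. -/
def IsLeftUniversal₀ (M : ShortMulticategory.{v, u}) {i : M.C} (u : M.Hom₀ i) : Prop :=
  (∀ d, Function.Bijective fun g : i ⟶ d => M.map₀ g u) ∧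
  (∀ x d, Function.Bijective fun g : M.Hom₂ i x d => M.comp₂₀₁ g u) ∧
  (∀ x y d, Function.Bijective fun g : M.Hom₃ i x y d => M.comp₃₀₁ g u)

/-- A binary multimap `θ` is a left universal binary map classifier. -/
def IsLeftUniversal₂ (M : ShortMulticategory.{v, u}) {a b m : M.C} (θ : M.Hom₂ a b m) : Prop :=
  (∀ d, Function.Bijective fun g : m ⟶ d => M.map₂ (𝟙 a) (𝟙 b) g θ) ∧
  (∀ x d, Function.Bijective fun g : M.Hom₂ m x d => M.comp₂₂₁ g θ) ∧
  (∀ x y d, Function.Bijective fun g : M.Hom₃ m x y d => M.comp₃₂₁ g θ)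

/-- A short multicategory is left representable when it admits left universal nullary and binary
map classifiers. -/
def IsLeftRepresentable (M : ShortMulticategory.{v, u}) : Prop :=
  (∃ (i : M.C) (u : M.Hom₀ i), M.IsLeftUniversal₀ u) ∧
  ∀ a b : M.C, ∃ (m : M.C) (θ : M.Hom₂ a b m), M.IsLeftUniversal₂ θ

end ShortMulticategory

/-- The full subcategory of left representable short multicategories. -/
abbrev LeftRepShortMulticategory : Type (max (u + 1) (v + 1)) :=
  ObjectProperty.FullSubcategory (C := ShortMulticategory.{v, u})
    ShortMulticategory.IsLeftRepresentable

/-! ### Skew monoidal categories -/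

/-- A (left) skew monoidal category. The fields `tensorObj`, `tensorHom` form a functor
`C × C ⥤ C`. -/
structure SkewMonoidalCategory where
  C : Type u
  [cat : Category.{v} C]
  tensorObj : C → C → C
  tensorHom {a a' b b' : C} (f : a ⟶ a') (g : b ⟶ b') : tensorObj a b ⟶ tensorObj a' b'
  tensor_id (a b : C) : tensorHom (𝟙 a) (𝟙 b) = 𝟙 (tensorObj a b)
  tensor_comp {a a' a'' b b' b'' : C} (f : a ⟶ a') (f' : a' ⟶ a'') (g : b ⟶ b') (g' : b' ⟶ b'') :
    tensorHom (f ≫ f') (g ≫ g') = tensorHom f g ≫ tensorHom f' g'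
  unit : C
  α (a b c : C) : tensorObj (tensorObj a b) c ⟶ tensorObj a (tensorObj b c)
  lam (a : C) : tensorObj unit a ⟶ a
  rho (a : C) : a ⟶ tensorObj a unit
  α_nat {a a' b b' c c' : C} (f : a ⟶ a') (g : b ⟶ b') (h : c ⟶ c') :
    tensorHom (tensorHom f g) h ≫ α a' b' c' = α a b c ≫ tensorHom f (tensorHom g h)
  lam_nat {a a' : C} (f : a ⟶ a') : tensorHom (𝟙 unit) f ≫ lam a' = lam a ≫ f
  rho_nat {a a' : C} (f : a ⟶ a') : f ≫ rho a' = rho a ≫ tensorHom f (𝟙 unit)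
  pentagon (a b c d : C) :
    tensorHom (α a b c) (𝟙 d) ≫ α a (tensorObj b c) d ≫ tensorHom (𝟙 a) (α b c d) =
      α (tensorObj a b) c d ≫ α a b (tensorObj c d)
  α_lam (a b : C) : α unit a b ≫ lam (tensorObj a b) = tensorHom (lam a) (𝟙 b)
  rho_α (a b : C) : rho (tensorObj a b) ≫ α a b unit = tensorHom (𝟙 a) (rho b)
  triangle (a b : C) :
    tensorHom (rho a) (𝟙 b) ≫ α a unit b ≫ tensorHom (𝟙 a) (lam b) = 𝟙 (tensorObj a b)
  rho_lam : rho unit ≫ lam unit = 𝟙 unit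

namespace SkewMonoidalCategory

attribute [instance] SkewMonoidalCategory.cat

/-- A skew monoidal category is left normal when its left unit maps are invertible. -/
def IsLeftNormal (A : SkewMonoidalCategory.{v, u}) : Prop :=
  ∀ a : A.C, IsIso (A.lam a)

/-- Lax monoidal functors between skew monoidal categories. -/
structure LaxFunctor (A B : SkewMonoidalCategory.{v, u}) where
  functor : A.C ⥤ B.C
  f₀ : B.unit ⟶ functor.obj A.unit
  f₂ (a b : A.C) : B.tensorObj (functor.obj a) (functor.obj b) ⟶ functor.obj (A.tensorObj a b)
  f₂_nat {a a' b b' : A.C} (p : a ⟶ a') (q : b ⟶ b') :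
    B.tensorHom (functor.map p) (functor.map q) ≫ f₂ a' b' =
      f₂ a b ≫ functor.map (A.tensorHom p q)
  map_α (a b c : A.C) :
    B.tensorHom (f₂ a b) (𝟙 (functor.obj c)) ≫ f₂ (A.tensorObj a b) c ≫ functor.map (A.α a b c) =
      B.α (functor.obj a) (functor.obj b) (functor.obj c) ≫
        B.tensorHom (𝟙 (functor.obj a)) (f₂ b c) ≫ f₂ a (A.tensorObj b c)
  map_lam (a : A.C) :
    B.tensorHom f₀ (𝟙 (functor.obj a)) ≫ f₂ A.unit a ≫ functor.map (A.lam a) =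
      B.lam (functor.obj a)
  map_rho (a : A.C) :
    B.rho (functor.obj a) ≫ B.tensorHom (𝟙 (functor.obj a)) f₀ ≫ f₂ a A.unit =
      functor.map (A.rho a)

theorem LaxFunctor.ext_of {A B : SkewMonoidalCategory.{v, u}} {F G : LaxFunctor A B}
    (h : F.functor = G.functor) (h₀ : HEq F.f₀ G.f₀) (h₂ : HEq F.f₂ G.f₂) : F = G := by
  obtain ⟨F, _, _, _, _, _, _⟩ := F
  obtain ⟨G, _, _, _, _, _, _⟩ := G
  obtain rfl : F = G := h
  obtain rfl := eq_of_heq h₀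
  obtain rfl := eq_of_heq h₂
  rfl

/-- The identity lax monoidal functor. -/
def LaxFunctor.id (A : SkewMonoidalCategory.{v, u}) : LaxFunctor A A where
  functor := 𝟭 A.C
  f₀ := 𝟙 _
  f₂ a b := 𝟙 _
  f₂_nat p q := by simp
  map_α a b c := by simp [A.tensor_id]
  map_lam a := by simp [A.tensor_id]
  map_rho a := by simp [A.tensor_id]

/-- Composition of lax monoidal functors. -/
def LaxFunctor.comp {A B D : SkewMonoidalCategory.{v, u}} (F : LaxFunctor A B)
    (G : LaxFunctor B D) : LaxFunctor A D where
  functor := F.functor ⋙ G.functor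
  f₀ := G.f₀ ≫ G.functor.map F.f₀
  f₂ a b := G.f₂ (F.functor.obj a) (F.functor.obj b) ≫ G.functor.map (F.f₂ a b)
  f₂_nat p q := by
    simp only [Functor.comp_obj, Functor.comp_map, Category.assoc]
    rw [reassoc_of% G.f₂_nat, ← G.functor.map_comp, F.f₂_nat, G.functor.map_comp]
  map_α a b c := by
    simp only [Functor.comp_obj, Functor.comp_map, Category.assoc]
    have h1 := G.f₂_nat (F.f₂ a b) (𝟙 (F.functor.obj c))
    have h2 := G.f₂_nat (𝟙 (F.functor.obj a)) (F.f₂ b c)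
    have h3 := G.map_α (F.functor.obj a) (F.functor.obj b) (F.functor.obj c)
    have h4 := congrArg G.functor.map (F.map_α a b c)
    rw [G.functor.map_id] at h1 h2
    simp only [Functor.map_comp] at h3 h4
    have e1 := D.tensor_comp (G.f₂ (F.functor.obj a) (F.functor.obj b)) (G.functor.map (F.f₂ a b))
      (𝟙 (G.functor.obj (F.functor.obj c))) (𝟙 _)
    have e2 := D.tensor_comp (𝟙 (G.functor.obj (F.functor.obj a))) (𝟙 _)
      (G.f₂ (F.functor.obj b) (F.functor.obj c)) (G.functor.map (F.f₂ b c))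
    rw [Category.comp_id] at e1 e2
    rw [e1, e2]
    simp only [Category.assoc]
    rw [reassoc_of% h1, h4, reassoc_of% h3, reassoc_of% h2]
  map_lam a := by
    simp only [Functor.comp_obj, Functor.comp_map, Category.assoc]
    have h1 := G.f₂_nat F.f₀ (𝟙 (F.functor.obj a))
    have h3 := G.map_lam (F.functor.obj a)
    have h4 := congrArg G.functor.map (F.map_lam a)
    rw [G.functor.map_id] at h1
    simp only [Functor.map_comp] at h3 h4
    have e1 := D.tensor_comp G.f₀ (G.functor.map F.f₀)
      (𝟙 (G.functor.obj (F.functor.obj a))) (𝟙 _)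
    rw [Category.comp_id] at e1
    rw [e1, Category.assoc, reassoc_of% h1, h4, h3]
  map_rho a := by
    simp only [Functor.comp_obj, Functor.comp_map]
    have h1 := G.f₂_nat (𝟙 (F.functor.obj a)) F.f₀
    have h3 := G.map_rho (F.functor.obj a)
    have h4 := congrArg G.functor.map (F.map_rho a)
    rw [G.functor.map_id] at h1
    simp only [Functor.map_comp] at h3 h4
    have e1 := D.tensor_comp (𝟙 (G.functor.obj (F.functor.obj a))) (𝟙 _) G.f₀
      (G.functor.map F.f₀)
    rw [Category.comp_id] at e1
    rw [e1, Category.assoc, reassoc_of% h1, ← h4, reassoc_of% h3]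

/-- The category of skew monoidal categories and lax monoidal functors. -/
instance : Category SkewMonoidalCategory.{v, u} where
  Hom := LaxFunctor
  id := LaxFunctor.id
  comp := LaxFunctor.comp
  id_comp F := by
    refine LaxFunctor.ext_of rfl (heq_of_eq ?_) (heq_of_eq ?_)
    · change F.f₀ ≫ F.functor.map (𝟙 _) = _
      simp
    · funext a b
      change F.f₂ a b ≫ F.functor.map (𝟙 _) = _
      simp
  comp_id F := by
    refine LaxFunctor.ext_of rfl (heq_of_eq ?_) (heq_of_eq ?_)
    · exact Category.id_comp _
    · funext a b
      exact Category.id_comp _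
  assoc F G H := by
    refine LaxFunctor.ext_of rfl (heq_of_eq ?_) (heq_of_eq ?_)
    · change H.f₀ ≫ H.functor.map (G.f₀ ≫ G.functor.map F.f₀) =
        (H.f₀ ≫ H.functor.map G.f₀) ≫ H.functor.map (G.functor.map F.f₀)
      simp
    · funext a b
      change H.f₂ _ _ ≫ H.functor.map (G.f₂ _ _ ≫ G.functor.map (F.f₂ a b)) =
        (H.f₂ _ _ ≫ H.functor.map (G.f₂ _ _)) ≫ H.functor.map (G.functor.map (F.f₂ a b))
      simp

end SkewMonoidalCategory

/-- The full subcategory of left normal skew monoidal categories. -/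
abbrev LeftNormalSkewMonoidalCategory : Type (max (u + 1) (v + 1)) :=
  ObjectProperty.FullSubcategory (C := SkewMonoidalCategory.{v, u})
    SkewMonoidalCategory.IsLeftNormal

/-! ### The functor from left representable short multicategories to left normal skew monoidal
categories -/

namespace ShortMulticategory

section lemmas

variable (M : ShortMulticategory.{v, u})

theorem post₂_comp {a b c d e : M.C} (x : c ⟶ d) (y : d ⟶ e) (f : M.Hom₂ a b c) :
    M.map₂ (𝟙 a) (𝟙 b) (x ≫ y) f = M.map₂ (𝟙 a) (𝟙 b) y (M.map₂ (𝟙 a) (𝟙 b) x f) := by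
  rw [← M.map₂_comp, Category.comp_id, Category.comp_id]

theorem post₃_comp {a b c d e k : M.C} (x : d ⟶ e) (y : e ⟶ k) (f : M.Hom₃ a b c d) :
    M.map₃ (𝟙 a) (𝟙 b) (𝟙 c) (x ≫ y) f =
      M.map₃ (𝟙 a) (𝟙 b) (𝟙 c) y (M.map₃ (𝟙 a) (𝟙 b) (𝟙 c) x f) := by
  rw [← M.map₃_comp, Category.comp_id, Category.comp_id, Category.comp_id]

theorem post₄_comp {a b c d e k l : M.C} (x : e ⟶ k) (y : k ⟶ l) (f : M.Hom₄ a b c d e) :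
    M.map₄ (𝟙 a) (𝟙 b) (𝟙 c) (𝟙 d) (x ≫ y) f =
      M.map₄ (𝟙 a) (𝟙 b) (𝟙 c) (𝟙 d) y (M.map₄ (𝟙 a) (𝟙 b) (𝟙 c) (𝟙 d) x f) := by
  rw [← M.map₄_comp, Category.comp_id, Category.comp_id, Category.comp_id, Category.comp_id]

theorem post₂_pre {a b c a' b' c' : M.C} (p : a' ⟶ a) (q : b' ⟶ b) (r : c ⟶ c')
    (f : M.Hom₂ a b c) :
    M.map₂ (𝟙 a') (𝟙 b') r (M.map₂ p q (𝟙 c) f) = M.map₂ p q (𝟙 c') (M.map₂ (𝟙 a) (𝟙 b) r f) := by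
  rw [← M.map₂_comp, ← M.map₂_comp]
  simp

theorem post₃_pre {a b c d a' b' c' d' : M.C} (p : a' ⟶ a) (q : b' ⟶ b) (s : c' ⟶ c)
    (r : d ⟶ d') (f : M.Hom₃ a b c d) :
    M.map₃ (𝟙 a') (𝟙 b') (𝟙 c') r (M.map₃ p q s (𝟙 d) f) =
      M.map₃ p q s (𝟙 d') (M.map₃ (𝟙 a) (𝟙 b) (𝟙 c) r f) := by
  rw [← M.map₃_comp, ← M.map₃_comp]
  simp

theorem post₂₂₁ {a₁ a₂ b₁ b₂ c c' : M.C} (r : c ⟶ c')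
    (g : M.Hom₂ b₁ b₂ c) (f : M.Hom₂ a₁ a₂ b₁) :
    M.comp₂₂₁ (M.map₂ (𝟙 _) (𝟙 _) r g) f = M.map₃ (𝟙 _) (𝟙 _) (𝟙 _) r (M.comp₂₂₁ g f) := by
  have h := M.nat₂₂₁ (𝟙 _) (𝟙 _) (𝟙 _) r g f
  simpa only [M.map₂_id] using h

theorem post₂₂₂ {a₁ a₂ b₁ b₂ c c' : M.C} (r : c ⟶ c')
    (g : M.Hom₂ b₁ b₂ c) (f : M.Hom₂ a₁ a₂ b₂) :
    M.comp₂₂₂ (M.map₂ (𝟙 _) (𝟙 _) r g) f = M.map₃ (𝟙 _) (𝟙 _) (𝟙 _) r (M.comp₂₂₂ g f) := by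
  have h := M.nat₂₂₂ (𝟙 _) (𝟙 _) (𝟙 _) r g f
  simpa only [M.map₂_id] using h

theorem post₃₂₁ {a₁ a₂ b₁ b₂ b₃ c c' : M.C} (r : c ⟶ c')
    (g : M.Hom₃ b₁ b₂ b₃ c) (f : M.Hom₂ a₁ a₂ b₁) :
    M.comp₃₂₁ (M.map₃ (𝟙 _) (𝟙 _) (𝟙 _) r g) f = M.map₄ (𝟙 _) (𝟙 _) (𝟙 _) (𝟙 _)
        r (M.comp₃₂₁ g f) := by
  have h := M.nat₃₂₁ (𝟙 _) (𝟙 _) (𝟙 _) (𝟙 _) r g f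
  simpa only [M.map₂_id] using h

theorem post₃₂₂ {a₁ a₂ b₁ b₂ b₃ c c' : M.C} (r : c ⟶ c')
    (g : M.Hom₃ b₁ b₂ b₃ c) (f : M.Hom₂ a₁ a₂ b₂) :
    M.comp₃₂₂ (M.map₃ (𝟙 _) (𝟙 _) (𝟙 _) r g) f = M.map₄ (𝟙 _) (𝟙 _) (𝟙 _) (𝟙 _)
        r (M.comp₃₂₂ g f) := by
  have h := M.nat₃₂₂ (𝟙 _) (𝟙 _) (𝟙 _) (𝟙 _) r g f
  simpa only [M.map₂_id] using h

theorem post₃₂₃ {a₁ a₂ b₁ b₂ b₃ c c' : M.C} (r : c ⟶ c')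
    (g : M.Hom₃ b₁ b₂ b₃ c) (f : M.Hom₂ a₁ a₂ b₃) :
    M.comp₃₂₃ (M.map₃ (𝟙 _) (𝟙 _) (𝟙 _) r g) f = M.map₄ (𝟙 _) (𝟙 _) (𝟙 _) (𝟙 _)
        r (M.comp₃₂₃ g f) := by
  have h := M.nat₃₂₃ (𝟙 _) (𝟙 _) (𝟙 _) (𝟙 _) r g f
  simpa only [M.map₂_id] using h

theorem post₂₃₁ {a₁ a₂ a₃ b₁ b₂ c c' : M.C} (r : c ⟶ c')
    (g : M.Hom₂ b₁ b₂ c) (f : M.Hom₃ a₁ a₂ a₃ b₁) :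
    M.comp₂₃₁ (M.map₂ (𝟙 _) (𝟙 _) r g) f = M.map₄ (𝟙 _) (𝟙 _) (𝟙 _) (𝟙 _) r (M.comp₂₃₁ g f) := by
  have h := M.nat₂₃₁ (𝟙 _) (𝟙 _) (𝟙 _) (𝟙 _) r g f
  simpa only [M.map₃_id] using h

theorem post₂₃₂ {a₁ a₂ a₃ b₁ b₂ c c' : M.C} (r : c ⟶ c')
    (g : M.Hom₂ b₁ b₂ c) (f : M.Hom₃ a₁ a₂ a₃ b₂) :
    M.comp₂₃₂ (M.map₂ (𝟙 _) (𝟙 _) r g) f = M.map₄ (𝟙 _) (𝟙 _) (𝟙 _) (𝟙 _) r (M.comp₂₃₂ g f) := by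
  have h := M.nat₂₃₂ (𝟙 _) (𝟙 _) (𝟙 _) (𝟙 _) r g f
  simpa only [M.map₃_id] using h

theorem post₂₀₁ {b₁ b₂ c c' : M.C} (r : c ⟶ c')
    (g : M.Hom₂ b₁ b₂ c) (f : M.Hom₀ b₁) :
    M.comp₂₀₁ (M.map₂ (𝟙 _) (𝟙 _) r g) f = M.comp₂₀₁ g f ≫ r := by
  have h := M.nat₂₀₁ (𝟙 _) r g f
  simpa only [Category.id_comp] using h

theorem post₂₀₂ {b₁ b₂ c c' : M.C} (r : c ⟶ c')
    (g : M.Hom₂ b₁ b₂ c) (f : M.Hom₀ b₂) :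
    M.comp₂₀₂ (M.map₂ (𝟙 _) (𝟙 _) r g) f = M.comp₂₀₂ g f ≫ r := by
  have h := M.nat₂₀₂ (𝟙 _) r g f
  simpa only [Category.id_comp] using h

theorem post₃₀₁ {b₁ b₂ b₃ c c' : M.C} (r : c ⟶ c')
    (g : M.Hom₃ b₁ b₂ b₃ c) (f : M.Hom₀ b₁) :
    M.comp₃₀₁ (M.map₃ (𝟙 _) (𝟙 _) (𝟙 _) r g) f = M.map₂ (𝟙 _) (𝟙 _) r (M.comp₃₀₁ g f) := by
  have h := M.nat₃₀₁ (𝟙 _) (𝟙 _) r g f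
  simpa only [Category.id_comp] using h

theorem post₃₀₂ {b₁ b₂ b₃ c c' : M.C} (r : c ⟶ c')
    (g : M.Hom₃ b₁ b₂ b₃ c) (f : M.Hom₀ b₂) :
    M.comp₃₀₂ (M.map₃ (𝟙 _) (𝟙 _) (𝟙 _) r g) f = M.map₂ (𝟙 _) (𝟙 _) r (M.comp₃₀₂ g f) := by
  have h := M.nat₃₀₂ (𝟙 _) (𝟙 _) r g f
  simpa only [Category.id_comp] using h

theorem post₃₀₃ {b₁ b₂ b₃ c c' : M.C} (r : c ⟶ c')
    (g : M.Hom₃ b₁ b₂ b₃ c) (f : M.Hom₀ b₃) :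
    M.comp₃₀₃ (M.map₃ (𝟙 _) (𝟙 _) (𝟙 _) r g) f = M.map₂ (𝟙 _) (𝟙 _) r (M.comp₃₀₃ g f) := by
  have h := M.nat₃₀₃ (𝟙 _) (𝟙 _) r g f
  simpa only [Category.id_comp] using h

end lemmas

/-- A choice of left universal nullary and binary map classifiers in a short multicategory. -/
structure Classifiers (M : ShortMulticategory.{v, u}) where
  unit : M.C
  u : M.Hom₀ unit
  u_univ : M.IsLeftUniversal₀ u
  tensor : M.C → M.C → M.C
  θ (a b : M.C) : M.Hom₂ a b (tensor a b)
  θ_univ (a b : M.C) : M.IsLeftUniversal₂ (θ a b)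

theorem IsLeftRepresentable.nonempty_classifiers {M : ShortMulticategory.{v, u}}
    (h : M.IsLeftRepresentable) : Nonempty M.Classifiers := by
  obtain ⟨⟨i, u, hu⟩, h⟩ := h
  choose m θ hθ using h
  exact ⟨⟨i, u, hu, m, θ, hθ⟩⟩

namespace Classifiers

variable {M : ShortMulticategory.{v, u}} (χ : M.Classifiers)

theorem hom_ext₀ {d : M.C} {x y : χ.unit ⟶ d} (h : M.map₀ x χ.u = M.map₀ y χ.u) : x = y :=
  (χ.u_univ.1 d).1 h

theorem hom_ext₂ {a b d : M.C} {x y : χ.tensor a b ⟶ d}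
    (h : M.map₂ (𝟙 a) (𝟙 b) x (χ.θ a b) = M.map₂ (𝟙 a) (𝟙 b) y (χ.θ a b)) : x = y :=
  ((χ.θ_univ a b).1 d).1 h

/-- The ternary map classifier `a, b, c → (ab)c`. -/
def θ₃ (a b c : M.C) : M.Hom₃ a b c (χ.tensor (χ.tensor a b) c) :=
  M.comp₂₂₁ (χ.θ (χ.tensor a b) c) (χ.θ a b)

theorem hom_ext₃ {a b c d : M.C} {x y : χ.tensor (χ.tensor a b) c ⟶ d}
    (h : M.map₃ (𝟙 a) (𝟙 b) (𝟙 c) x (χ.θ₃ a b c) = M.map₃ (𝟙 a) (𝟙 b) (𝟙 c) y (χ.θ₃ a b c)) :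
    x = y := by
  unfold θ₃ at h
  rw [← post₂₂₁, ← post₂₂₁] at h
  exact χ.hom_ext₂ (((χ.θ_univ a b).2.1 _ _).1 h)

theorem hom_ext₄ {a b c d e : M.C} {x y : χ.tensor (χ.tensor (χ.tensor a b) c) d ⟶ e}
    (h : M.map₄ (𝟙 a) (𝟙 b) (𝟙 c) (𝟙 d) x
        (M.comp₃₂₁ (M.comp₂₂₁ (χ.θ (χ.tensor (χ.tensor a b) c) d) (χ.θ (χ.tensor a b) c))
          (χ.θ a b)) =
      M.map₄ (𝟙 a) (𝟙 b) (𝟙 c) (𝟙 d) y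
        (M.comp₃₂₁ (M.comp₂₂₁ (χ.θ (χ.tensor (χ.tensor a b) c) d) (χ.θ (χ.tensor a b) c))
          (χ.θ a b))) : x = y := by
  rw [← post₃₂₁, ← post₃₂₁] at h
  exact χ.hom_ext₃ (((χ.θ_univ a b).2.2 _ _ _).1 h)

theorem exists_lift₃ {a b c d : M.C} (f : M.Hom₃ a b c d) :
    ∃ x : χ.tensor (χ.tensor a b) c ⟶ d, M.map₃ (𝟙 a) (𝟙 b) (𝟙 c) x (χ.θ₃ a b c) = f := by
  obtain ⟨g, rfl⟩ := ((χ.θ_univ a b).2.1 c d).2 f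
  obtain ⟨x, rfl⟩ := ((χ.θ_univ (χ.tensor a b) c).1 d).2 g
  exact ⟨x, (M.post₂₂₁ x _ _).symm⟩

/-- The map `a → ia` obtained by substituting `u` into the first input of `θ`. -/
def η (a : M.C) : a ⟶ χ.tensor χ.unit a :=
  M.comp₂₀₁ (χ.θ χ.unit a) χ.u

theorem hom_extη {a d : M.C} {x y : χ.tensor χ.unit a ⟶ d} (h : χ.η a ≫ x = χ.η a ≫ y) :
    x = y := by
  unfold η at h
  rw [← post₂₀₁, ← post₂₀₁] at h
  exact χ.hom_ext₂ ((χ.u_univ.2.1 _ _).1 h)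

theorem exists_liftη {a d : M.C} (f : a ⟶ d) :
    ∃ x : χ.tensor χ.unit a ⟶ d, χ.η a ≫ x = f := by
  obtain ⟨g, rfl⟩ := (χ.u_univ.2.1 a d).2 f
  obtain ⟨x, rfl⟩ := ((χ.θ_univ χ.unit a).1 d).2 g
  exact ⟨x, (M.post₂₀₁ x _ _).symm⟩

/-- The map out of the nullary map classifier induced by a nullary multimap. -/
noncomputable def lift₀ {d : M.C} (f : M.Hom₀ d) : χ.unit ⟶ d :=
  ((χ.u_univ.1 d).2 f).choose

theorem lift₀_spec {d : M.C} (f : M.Hom₀ d) : M.map₀ (χ.lift₀ f) χ.u = f :=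
  ((χ.u_univ.1 d).2 f).choose_spec

/-- The map out of the binary map classifier induced by a binary multimap. -/
noncomputable def lift₂ {a b d : M.C} (f : M.Hom₂ a b d) : χ.tensor a b ⟶ d :=
  (((χ.θ_univ a b).1 d).2 f).choose

theorem lift₂_spec {a b d : M.C} (f : M.Hom₂ a b d) :
    M.map₂ (𝟙 a) (𝟙 b) (χ.lift₂ f) (χ.θ a b) = f :=
  (((χ.θ_univ a b).1 d).2 f).choose_spec

/-- The tensor product `fg` of maps: the unique map with `fg ∘ θ = θ ∘ (f, g)`. -/
noncomputable def tensorHom {a a' b b' : M.C} (f : a ⟶ a') (g : b ⟶ b') :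
    χ.tensor a b ⟶ χ.tensor a' b' :=
  χ.lift₂ (M.map₂ f g (𝟙 _) (χ.θ a' b'))

theorem tensorHom_spec {a a' b b' : M.C} (f : a ⟶ a') (g : b ⟶ b') :
    M.map₂ (𝟙 a) (𝟙 b) (χ.tensorHom f g) (χ.θ a b) = M.map₂ f g (𝟙 _) (χ.θ a' b') :=
  χ.lift₂_spec _

/-- The associator: the unique map with `α ∘ (θ ∘₁ θ) = θ ∘₂ θ`. -/
noncomputable def assoc (a b c : M.C) :
    χ.tensor (χ.tensor a b) c ⟶ χ.tensor a (χ.tensor b c) :=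
  (χ.exists_lift₃ (M.comp₂₂₂ (χ.θ a (χ.tensor b c)) (χ.θ b c))).choose

theorem assoc_spec (a b c : M.C) :
    M.map₃ (𝟙 a) (𝟙 b) (𝟙 c) (χ.assoc a b c) (M.comp₂₂₁ (χ.θ (χ.tensor a b) c) (χ.θ a b)) =
      M.comp₂₂₂ (χ.θ a (χ.tensor b c)) (χ.θ b c) :=
  (χ.exists_lift₃ (M.comp₂₂₂ (χ.θ a (χ.tensor b c)) (χ.θ b c))).choose_spec

/-- The left unit map: the unique map with `λ ∘ (θ ∘₁ u) = 1`. -/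
noncomputable def lam (a : M.C) : χ.tensor χ.unit a ⟶ a :=
  (χ.exists_liftη (𝟙 a)).choose

theorem lam_spec (a : M.C) : χ.η a ≫ χ.lam a = 𝟙 a :=
  (χ.exists_liftη (𝟙 a)).choose_spec

/-- The right unit map `θ ∘₂ u`. -/
def rho (a : M.C) : a ⟶ χ.tensor a χ.unit :=
  M.comp₂₀₂ (χ.θ a χ.unit) χ.u

-- the tensor product with a map, applied after a substitution into `θ`
theorem tensor_comp₂₂₁ {a₁ a₂ b c b' c' : M.C} (f : b ⟶ b') (g : c ⟶ c') (h : M.Hom₂ a₁ a₂ b) :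
    M.map₃ (𝟙 _) (𝟙 _) (𝟙 _) (χ.tensorHom f g) (M.comp₂₂₁ (χ.θ b c) h) =
      M.map₃ (𝟙 _) (𝟙 _) g (𝟙 _) (M.comp₂₂₁ (χ.θ b' c') (M.map₂ (𝟙 _) (𝟙 _) f h)) := by
  rw [← post₂₂₁, tensorHom_spec]
  have e : M.map₂ f g (𝟙 _) (χ.θ b' c') =
      M.map₂ f (𝟙 _) (𝟙 _) (M.map₂ (𝟙 _) g (𝟙 _) (χ.θ b' c')) := by
    rw [← M.map₂_comp]; simp
  rw [e, M.dinat₂₂₁]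
  have n := M.nat₂₂₁ (𝟙 _) (𝟙 _) g (𝟙 _) (χ.θ b' c') (M.map₂ (𝟙 _) (𝟙 _) f h)
  rwa [M.map₂_id] at n

theorem tensor_comp₂₂₂ {a₁ a₂ b c b' c' : M.C} (f : b ⟶ b') (g : c ⟶ c') (h : M.Hom₂ a₁ a₂ c) :
    M.map₃ (𝟙 _) (𝟙 _) (𝟙 _) (χ.tensorHom f g) (M.comp₂₂₂ (χ.θ b c) h) =
      M.map₃ f (𝟙 _) (𝟙 _) (𝟙 _) (M.comp₂₂₂ (χ.θ b' c') (M.map₂ (𝟙 _) (𝟙 _) g h)) := by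
  rw [← post₂₂₂, tensorHom_spec]
  have e : M.map₂ f g (𝟙 _) (χ.θ b' c') =
      M.map₂ (𝟙 _) g (𝟙 _) (M.map₂ f (𝟙 _) (𝟙 _) (χ.θ b' c')) := by
    rw [← M.map₂_comp]; simp
  rw [e, M.dinat₂₂₂]
  have n := M.nat₂₂₂ (𝟙 _) (𝟙 _) f (𝟙 _) (χ.θ b' c') (M.map₂ (𝟙 _) (𝟙 _) g h)
  rwa [M.map₂_id] at n

theorem tensor_comp₂₃₁ {a₁ a₂ a₃ b c b' : M.C} (f : b ⟶ b') (h : M.Hom₃ a₁ a₂ a₃ b) :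
    M.map₄ (𝟙 _) (𝟙 _) (𝟙 _) (𝟙 _) (χ.tensorHom f (𝟙 c)) (M.comp₂₃₁ (χ.θ b c) h) =
      M.comp₂₃₁ (χ.θ b' c) (M.map₃ (𝟙 _) (𝟙 _) (𝟙 _) f h) := by
  rw [← post₂₃₁, tensorHom_spec, M.dinat₂₃₁]

theorem tensor_comp₂₃₂ {a₁ a₂ a₃ b c c' : M.C} (g : c ⟶ c') (h : M.Hom₃ a₁ a₂ a₃ c) :
    M.map₄ (𝟙 _) (𝟙 _) (𝟙 _) (𝟙 _) (χ.tensorHom (𝟙 b) g) (M.comp₂₃₂ (χ.θ b c) h) =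
      M.comp₂₃₂ (χ.θ b c') (M.map₃ (𝟙 _) (𝟙 _) (𝟙 _) g h) := by
  rw [← post₂₃₂, tensorHom_spec, M.dinat₂₃₂]

theorem tensor_comp₂₀₁ {b c b' c' : M.C} (f : b ⟶ b') (g : c ⟶ c') (h : M.Hom₀ b) :
    M.comp₂₀₁ (χ.θ b c) h ≫ χ.tensorHom f g =
      g ≫ M.comp₂₀₁ (χ.θ b' c') (M.map₀ f h) := by
  rw [← post₂₀₁, tensorHom_spec]
  have e : M.map₂ f g (𝟙 _) (χ.θ b' c') =
      M.map₂ f (𝟙 _) (𝟙 _) (M.map₂ (𝟙 _) g (𝟙 _) (χ.θ b' c')) := by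
    rw [← M.map₂_comp]; simp
  rw [e, M.dinat₂₀₁, M.nat₂₀₁, Category.comp_id]

theorem tensor_comp₂₀₂ {b c b' c' : M.C} (f : b ⟶ b') (g : c ⟶ c') (h : M.Hom₀ c) :
    M.comp₂₀₂ (χ.θ b c) h ≫ χ.tensorHom f g =
      f ≫ M.comp₂₀₂ (χ.θ b' c') (M.map₀ g h) := by
  rw [← post₂₀₂, tensorHom_spec]
  have e : M.map₂ f g (𝟙 _) (χ.θ b' c') =
      M.map₂ (𝟙 _) g (𝟙 _) (M.map₂ f (𝟙 _) (𝟙 _) (χ.θ b' c')) := by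
    rw [← M.map₂_comp]; simp
  rw [e, M.dinat₂₀₂, M.nat₂₀₂, Category.comp_id]

/-- The skew monoidal category given by binary and nullary map classifiers. -/
noncomputable def skewMonoidal : SkewMonoidalCategory.{v, u} where
  C := M.C
  tensorObj := χ.tensor
  tensorHom f g := χ.tensorHom f g
  tensor_id a b := χ.hom_ext₂ (χ.tensorHom_spec _ _)
  tensor_comp f f' g g' := χ.hom_ext₂ <| by
    rw [tensorHom_spec, post₂_comp, tensorHom_spec, post₂_pre, tensorHom_spec, ← M.map₂_comp]
    simp
  unit := χ.unit
  α := χ.assoc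
  lam := χ.lam
  rho := χ.rho
  α_nat {a a' b b' c c'} f g h := χ.hom_ext₃ <| by
    unfold θ₃
    rw [post₃_comp, tensor_comp₂₂₁, tensorHom_spec, post₃_pre, post₃_comp, assoc_spec,
      tensor_comp₂₂₂, tensorHom_spec]
    have n := M.nat₂₂₁ f g (𝟙 c') (𝟙 _) (χ.θ (χ.tensor a' b') c') (χ.θ a' b')
    have n' := M.nat₂₂₂ g h (𝟙 a') (𝟙 _) (χ.θ a' (χ.tensor b' c')) (χ.θ b' c')
    rw [M.map₂_id] at n n'
    rw [n, n', post₃_pre, assoc_spec, ← M.map₃_comp, ← M.map₃_comp]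
    simp
  lam_nat f := χ.hom_extη <| by
    have h := χ.tensor_comp₂₀₁ (𝟙 _) f χ.u
    rw [M.map₀_id] at h
    change χ.η _ ≫ _ = f ≫ χ.η _ at h
    rw [reassoc_of% h, lam_spec, ← Category.assoc, lam_spec, Category.id_comp, Category.comp_id]
  rho_nat f := by
    have h := χ.tensor_comp₂₀₂ f (𝟙 _) χ.u
    rw [M.map₀_id] at h
    exact h.symm
  pentagon a b c d := χ.hom_ext₄ <| by
    rw [post₄_comp, post₄_comp, post₄_comp]
    rw [← M.assoc₁₁, tensor_comp₂₃₁, assoc_spec, M.assoc₁₂, ← post₃₂₂, assoc_spec, ← M.assoc₂₁,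
      tensor_comp₂₃₂, assoc_spec]
    rw [M.assoc₁₁, ← post₃₂₁, assoc_spec, ← M.comm₂₂, ← post₃₂₃, assoc_spec, M.assoc₂₂]
  α_lam a b := χ.hom_ext₃ <| (χ.u_univ.2.2 _ _ _).1 <| by
    change M.comp₃₀₁ _ _ = M.comp₃₀₁ _ _
    unfold θ₃
    rw [post₃_comp, assoc_spec, post₃₀₁, ← M.comm₀₂, ← post₂_comp, tensor_comp₂₂₁, M.map₃_id]
    rw [← M.assoc₁₁_null]
    have h := M.post₂₀₁ (χ.lam a) (χ.θ χ.unit a) χ.u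
    change _ = χ.η a ≫ χ.lam a at h
    change M.map₂ _ _ (χ.η _ ≫ χ.lam _) _ = _
    rw [h, lam_spec, lam_spec]
  rho_α a b := χ.hom_ext₂ <| by
    rw [post₂_comp, tensorHom_spec]
    unfold rho
    rw [← M.comm₂₀, ← post₃₀₃, assoc_spec, M.assoc₂₂_null]
  triangle a b := χ.hom_ext₂ <| by
    rw [post₂_comp, post₂_comp, tensorHom_spec, M.map₂_id]
    unfold rho
    rw [M.assoc₁₂_null, ← post₃₀₂, assoc_spec, ← M.assoc₂₁_null, post₂_pre, tensorHom_spec,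
      ← M.map₂_comp]
    change M.map₂ _ (χ.η b ≫ χ.lam b) _ _ = _
    rw [lam_spec]
    simp [M.map₂_id]
  rho_lam := χ.hom_ext₀ <| by
    rw [M.map₀_comp]
    unfold rho
    rw [← M.comm₀₀, ← M.map₀_comp]
    exact congrArg (fun x => M.map₀ x χ.u) (χ.lam_spec χ.unit)

theorem lam_η (a : M.C) : χ.lam a ≫ χ.η a = 𝟙 _ :=
  χ.hom_extη <| by rw [← Category.assoc, lam_spec, Category.id_comp, Category.comp_id]

theorem skewMonoidal_isLeftNormal : χ.skewMonoidal.IsLeftNormal := fun a =>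
  ⟨χ.η a, χ.lam_η a, χ.lam_spec a⟩

section morphism

variable {N : ShortMulticategory.{v, u}} (ψ : N.Classifiers) (F : Morphism M N)

theorem lax_nat {a a' b b' : M.C} (p : a ⟶ a') (q : b ⟶ b') :
    ψ.tensorHom (F.functor.map p) (F.functor.map q) ≫ ψ.lift₂ (F.F₂ (χ.θ a' b')) =
      ψ.lift₂ (F.F₂ (χ.θ a b)) ≫ F.functor.map (χ.tensorHom p q) :=
  ψ.hom_ext₂ <| by
    rw [post₂_comp, tensorHom_spec, post₂_pre, lift₂_spec, post₂_comp, lift₂_spec]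
    have h1 := F.nat₂ p q (𝟙 _) (χ.θ _ _)
    have h2 := F.nat₂ (𝟙 _) (𝟙 _) (χ.tensorHom p q) (χ.θ _ _)
    rw [tensorHom_spec, h1] at h2
    simpa only [F.functor.map_id] using h2

theorem lax_assoc (a b c : M.C) :
    ψ.tensorHom (ψ.lift₂ (F.F₂ (χ.θ a b))) (𝟙 (F.functor.obj c)) ≫
        ψ.lift₂ (F.F₂ (χ.θ (χ.tensor a b) c)) ≫ F.functor.map (χ.assoc a b c) =
      ψ.assoc (F.functor.obj a) (F.functor.obj b) (F.functor.obj c) ≫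
        ψ.tensorHom (𝟙 (F.functor.obj a)) (ψ.lift₂ (F.F₂ (χ.θ b c))) ≫
          ψ.lift₂ (F.F₂ (χ.θ a (χ.tensor b c))) :=
  ψ.hom_ext₃ <| by
    unfold θ₃
    rw [post₃_comp, post₃_comp, tensor_comp₂₂₁, N.map₃_id, lift₂_spec, ← post₂₂₁, lift₂_spec,
      post₃_comp, post₃_comp, assoc_spec, tensor_comp₂₂₂, N.map₃_id, lift₂_spec, ← post₂₂₂,
      lift₂_spec, ← F.map_comp₂₂₁, ← F.map_comp₂₂₂, ← χ.assoc_spec, F.nat₃]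
    simp only [F.functor.map_id]

theorem lax_lam (a : M.C) :
    ψ.tensorHom (ψ.lift₀ (F.F₀ χ.u)) (𝟙 (F.functor.obj a)) ≫
        ψ.lift₂ (F.F₂ (χ.θ χ.unit a)) ≫ F.functor.map (χ.lam a) = ψ.lam (F.functor.obj a) :=
  ψ.hom_extη <| by
    have h := ψ.tensor_comp₂₀₁ (ψ.lift₀ (F.F₀ χ.u)) (𝟙 (F.functor.obj a)) ψ.u
    rw [lift₀_spec, Category.id_comp] at h
    rw [lam_spec]
    unfold η
    rw [reassoc_of% h, ← Category.assoc, ← post₂₀₁, lift₂_spec, ← F.map_comp₂₀₁,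
      ← F.functor.map_comp]
    change F.functor.map (χ.η a ≫ χ.lam a) = _
    rw [lam_spec, F.functor.map_id]

theorem lax_rho (a : M.C) :
    ψ.rho (F.functor.obj a) ≫ ψ.tensorHom (𝟙 (F.functor.obj a)) (ψ.lift₀ (F.F₀ χ.u)) ≫
        ψ.lift₂ (F.F₂ (χ.θ a χ.unit)) = F.functor.map (χ.rho a) := by
  have h := ψ.tensor_comp₂₀₂ (𝟙 (F.functor.obj a)) (ψ.lift₀ (F.F₀ χ.u)) ψ.u
  rw [lift₀_spec, Category.id_comp] at h
  unfold rho
  rw [reassoc_of% h, ← post₂₀₂, lift₂_spec, F.map_comp₂₀₂]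

/-- The lax monoidal functor given by a morphism of short multicategories: `f₀` is the unique map
with `f₀ ∘ u = F₀ u` and `f₂` is the unique map with `f₂ ∘ θ = F₂ θ`. -/
noncomputable def laxFunctor :
    SkewMonoidalCategory.LaxFunctor χ.skewMonoidal ψ.skewMonoidal where
  functor := F.functor
  f₀ := ψ.lift₀ (F.F₀ χ.u)
  f₂ a b := ψ.lift₂ (F.F₂ (χ.θ a b))
  f₂_nat p q := χ.lax_nat ψ F p q
  map_α a b c := χ.lax_assoc ψ F a b c
  map_lam a := χ.lax_lam ψ F a
  map_rho a := χ.lax_rho ψ F a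

theorem lift₂_comp {P : ShortMulticategory.{v, u}} (ω : P.Classifiers) (G : Morphism N P)
    (a b : M.C) :
    ω.lift₂ (G.F₂ (F.F₂ (χ.θ a b))) =
      ω.lift₂ (G.F₂ (ψ.θ (F.functor.obj a) (F.functor.obj b))) ≫
        G.functor.map (ψ.lift₂ (F.F₂ (χ.θ a b))) :=
  ω.hom_ext₂ <| by
    have h := G.nat₂ (𝟙 _) (𝟙 _) (ψ.lift₂ (F.F₂ (χ.θ a b))) (ψ.θ _ _)
    rw [lift₂_spec] at h
    rw [G.functor.map_id, G.functor.map_id] at h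
    rw [lift₂_spec, P.post₂_comp, lift₂_spec, h]

theorem lift₀_comp {P : ShortMulticategory.{v, u}} (ω : P.Classifiers) (G : Morphism N P) :
    ω.lift₀ (G.F₀ (F.F₀ χ.u)) =
      ω.lift₀ (G.F₀ ψ.u) ≫ G.functor.map (ψ.lift₀ (F.F₀ χ.u)) :=
  ω.hom_ext₀ <| by
    rw [lift₀_spec, P.map₀_comp, lift₀_spec, ← G.nat₀, lift₀_spec]

end morphism

end Classifiers

end ShortMulticategory

/-- The functor `K` from left representable short multicategories to left normal skew monoidal
categories, for a choice of left universal nullary and binary map classifiers in each left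
representable short multicategory. -/
noncomputable def functorK (χ : ∀ M : LeftRepShortMulticategory.{v, u}, M.obj.Classifiers) :
    LeftRepShortMulticategory.{v, u} ⥤ LeftNormalSkewMonoidalCategory.{v, u} where
  obj M := ⟨(χ M).skewMonoidal, (χ M).skewMonoidal_isLeftNormal⟩
  map {M N} F := ObjectProperty.homMk ((χ M).laxFunctor (χ N) F.hom)
  map_id M := by
    refine ObjectProperty.hom_ext _ (SkewMonoidalCategory.LaxFunctor.ext_of rfl (heq_of_eq ?_)
      (heq_of_eq ?_))
    · exact (χ M).hom_ext₀ (((χ M).lift₀_spec _).trans (M.obj.map₀_id _).symm)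
    · funext a b
      exact (χ M).hom_ext₂ (((χ M).lift₂_spec _).trans (M.obj.map₂_id _).symm)
  map_comp {M N P} F G := by
    refine ObjectProperty.hom_ext _ (SkewMonoidalCategory.LaxFunctor.ext_of rfl (heq_of_eq ?_)
      (heq_of_eq ?_))
    · exact (χ M).lift₀_comp (χ N) F.hom (χ P) G.hom
    · funext a b
      exact (χ M).lift₂_comp (χ N) F.hom (χ P) G.hom a b

/-! ### The forgetful functor from multicategories to short multicategories -/

namespace Multicategory

section substitution

variable (M : Multicategory.{v, u})

/-- Substitution with the lists of inputs specified up to equality. -/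
def subst (l r : List M.Obj) {Θ Γ Ξ : List M.Obj} {b c : M.Obj} (hΘ : Θ = l ++ b :: r)
    (hΞ : Ξ = l ++ Γ ++ r) (g : M.Hom Θ c) (f : M.Hom Γ b) : M.Hom Ξ c :=
  castDom hΞ.symm (M.comp l r (castDom hΘ g) f)

theorem subst_assoc {l r l' r' Θ Φ Γ Ψ Ξ : List M.Obj} {b c d : M.Obj} {hΘ : Θ = l ++ c :: r}
    {hΦ : Φ = l' ++ b :: r'} {hΨ : Ψ = l' ++ Γ ++ r'} {hΞ : Ξ = l ++ Ψ ++ r}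
    (h : M.Hom Θ d) (g : M.Hom Φ c) (f : M.Hom Γ b) :
    M.subst l r hΘ hΞ h (M.subst l' r' hΦ hΨ g f) =
      M.subst (l ++ l') (r' ++ r) (by simp [hΦ]) (by simp [hΞ, hΨ])
        (M.subst l r (Ξ := l ++ Φ ++ r) hΘ rfl h g) f := by
  subst hΘ hΦ hΨ hΞ
  have e := (castDom_eq_iff _ _ _).1 (M.assoc l r l' r' h g f)
  simpa [subst] using e

theorem subst_comm (l m r : List M.Obj) {Θ Γ Δ Ξ Φ Φ' : List M.Obj} {b c d : M.Obj}
    (hΘ : Θ = l ++ b :: (m ++ c :: r)) (hΞ : Ξ = (l ++ Γ ++ m) ++ Δ ++ r)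
    (hΦ : Φ = l ++ Γ ++ (m ++ c :: r)) (hΦ' : Φ' = (l ++ b :: m) ++ Δ ++ r)
    (h : M.Hom Θ d) (g : M.Hom Γ b) (f : M.Hom Δ c) :
    M.subst (l ++ Γ ++ m) r (by simp [hΦ]) hΞ (M.subst l (m ++ c :: r) hΘ hΦ h g) f =
      M.subst l (m ++ Δ ++ r) (by simp [hΦ']) (by simp [hΞ])
        (M.subst (l ++ b :: m) r (by simp [hΘ]) hΦ' h f) g := by
  subst hΘ hΦ hΦ' hΞ
  have e := (castDom_eq_iff _ _ _).1 (M.comm l m r h g f)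
  simpa [subst] using e

theorem subst_subst_before (m : List M.Obj) {l r L R Θ Γ Δ Ξ Φ : List M.Obj} {b c d : M.Obj}
    {hΘ : Θ = l ++ b :: r} {hΦ : Φ = l ++ Γ ++ r} {hΦ' : Φ = L ++ c :: R} {hΞ : Ξ = L ++ Δ ++ R}
    (h : M.Hom Θ d) (g : M.Hom Γ b) (f : M.Hom Δ c)
    (hL : L = l ++ Γ ++ m) (hr : r = m ++ c :: R) :
    M.subst L R hΦ' hΞ (M.subst l r hΘ hΦ h g) f =
      M.subst l (m ++ Δ ++ R) (Θ := (l ++ b :: m) ++ Δ ++ R) (by simp) (by simp [hΞ, hL])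
        (M.subst (l ++ b :: m) R (by simp [hΘ, hr]) rfl h f) g := by
  subst hL hr
  exact M.subst_comm l m R hΘ hΞ hΦ rfl h g f

theorem subst_subst_after (m : List M.Obj) {l r L R Θ Γ Δ Ξ Φ : List M.Obj} {b c d : M.Obj}
    {hΘ : Θ = l ++ c :: r} {hΦ : Φ = l ++ Δ ++ r} {hΦ' : Φ = L ++ b :: R} {hΞ : Ξ = L ++ Γ ++ R}
    (h : M.Hom Θ d) (f : M.Hom Δ c) (g : M.Hom Γ b)
    (hl : l = L ++ b :: m) (hR : R = m ++ Δ ++ r) :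
    M.subst L R hΦ' hΞ (M.subst l r hΘ hΦ h f) g =
      M.subst (L ++ Γ ++ m) r (Θ := L ++ Γ ++ (m ++ c :: r)) (by simp) (by simp [hΞ, hR])
        (M.subst L (m ++ c :: r) (by simp [hΘ, hl]) rfl h g) f := by
  subst hl hR
  exact (M.subst_comm L m r (by simp [hΘ]) (by simp [hΞ]) rfl hΦ h g f).symm

theorem subst_id {l r Θ Ξ : List M.Obj} {b c : M.Obj} {hΘ : Θ = l ++ b :: r}
    {hΞ : Ξ = l ++ [b] ++ r} (g : M.Hom Θ c) :
    M.subst l r hΘ hΞ g (M.id b) = castDom (by simp [hΘ, hΞ]) g := by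
  subst hΘ hΞ
  have e := (castDom_eq_iff _ _ _).1 (M.comp_id l r g)
  simpa [subst] using e

/-- Postcomposition of a multimap with a unary one. -/
def post {Γ : List M.Obj} {c d : M.Obj} (r : M.Hom [c] d) (f : M.Hom Γ c) : M.Hom Γ d :=
  M.subst [] [] rfl (by simp) r f

theorem post_id {Γ : List M.Obj} {c : M.Obj} (f : M.Hom Γ c) : M.post (M.id c) f = f := by
  simpa [post, subst] using M.id_comp f

theorem post_subst {l r Θ Γ Ξ : List M.Obj} {b c d : M.Obj} {hΘ : Θ = l ++ b :: r}
    {hΞ : Ξ = l ++ Γ ++ r} (s : M.Hom [c] d) (g : M.Hom Θ c) (f : M.Hom Γ b) :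
    M.post s (M.subst l r hΘ hΞ g f) = M.subst l r hΘ hΞ (M.post s g) f := by
  unfold post
  rw [subst_assoc]
  subst hΘ hΞ
  simp [subst, ← comp_castDom M rfl (List.append_nil r) rfl]

theorem post_post {Γ : List M.Obj} {c d e : M.Obj} (s : M.Hom [d] e) (t : M.Hom [c] d)
    (f : M.Hom Γ c) : M.post s (M.post t f) = M.post (M.post s t) f :=
  M.post_subst s t f

/-- The action of unary multimaps on the inputs and the output of a multimap. -/
def act₂ {a₁ a₂ a₁' a₂' c c' : M.Obj} (p₁ : M.Hom [a₁'] a₁) (p₂ : M.Hom [a₂'] a₂)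
    (r : M.Hom [c] c') (f : M.Hom [a₁, a₂] c) : M.Hom [a₁', a₂'] c' :=
  M.post r (M.subst (Ξ := [a₁', a₂']) [a₁'] [] rfl rfl
      (M.subst (Ξ := [a₁', a₂]) [] [a₂] rfl rfl f p₁) p₂)

theorem act₂_id {a₁ a₂ c : M.Obj} (f : M.Hom [a₁, a₂] c) :
    M.act₂ (M.id _) (M.id _) (M.id c) f = f := by
  simp only [act₂, post_id, subst_id, castDom_rfl]

theorem act₂_comp {a₁ a₂ a₁' a₂' a₁'' a₂'' c c' c'' : M.Obj}
    (p₁ : M.Hom [a₁'] a₁) (p₂ : M.Hom [a₂'] a₂)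
    (p₁' : M.Hom [a₁''] a₁') (p₂' : M.Hom [a₂''] a₂')
    (r : M.Hom [c] c') (r' : M.Hom [c'] c'') (f : M.Hom [a₁, a₂] c) :
    M.act₂ (M.post p₁ p₁') (M.post p₂ p₂') (M.post r' r) f =
      M.act₂ p₁' p₂' r' (M.act₂ p₁ p₂ r f) := by
  unfold act₂
  simp only [← post_subst, post_post]
  rw [M.subst_subst_after [] _ p₂ p₁']
  unfold post
  rw [M.subst_assoc _ p₂ p₂', M.subst_assoc _ p₁ p₁']
  all_goals rfl

/-- The action of unary multimaps on the inputs and the output of a multimap. -/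
def act₃ {a₁ a₂ a₃ a₁' a₂' a₃' c c' : M.Obj} (p₁ : M.Hom [a₁'] a₁) (p₂ : M.Hom [a₂'] a₂)
    (p₃ : M.Hom [a₃'] a₃)
    (r : M.Hom [c] c') (f : M.Hom [a₁, a₂, a₃] c) : M.Hom [a₁', a₂', a₃'] c' :=
  M.post r (M.subst (Ξ := [a₁', a₂', a₃']) [a₁', a₂'] [] rfl rfl
      (M.subst (Ξ := [a₁', a₂', a₃]) [a₁'] [a₃] rfl rfl
      (M.subst (Ξ := [a₁', a₂, a₃]) [] [a₂, a₃] rfl rfl f p₁) p₂) p₃)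

theorem act₃_id {a₁ a₂ a₃ c : M.Obj} (f : M.Hom [a₁, a₂, a₃] c) :
    M.act₃ (M.id _) (M.id _) (M.id _) (M.id c) f = f := by
  simp only [act₃, post_id, subst_id, castDom_rfl]

theorem act₃_comp {a₁ a₂ a₃ a₁' a₂' a₃' a₁'' a₂'' a₃'' c c' c'' : M.Obj}
    (p₁ : M.Hom [a₁'] a₁) (p₂ : M.Hom [a₂'] a₂) (p₃ : M.Hom [a₃'] a₃)
    (p₁' : M.Hom [a₁''] a₁') (p₂' : M.Hom [a₂''] a₂') (p₃' : M.Hom [a₃''] a₃')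
    (r : M.Hom [c] c') (r' : M.Hom [c'] c'') (f : M.Hom [a₁, a₂, a₃] c) :
    M.act₃ (M.post p₁ p₁') (M.post p₂ p₂') (M.post p₃ p₃') (M.post r' r) f =
      M.act₃ p₁' p₂' p₃' r' (M.act₃ p₁ p₂ p₃ r f) := by
  unfold act₃
  simp only [← post_subst, post_post]
  rw [M.subst_subst_after [a₂'] _ p₃ p₁',
    M.subst_subst_after [] _ p₂ p₁',
    M.subst_subst_after [] _ p₃ p₂']
  unfold post
  rw [M.subst_assoc _ p₃ p₃', M.subst_assoc _ p₂ p₂', M.subst_assoc _ p₁ p₁']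
  all_goals rfl

/-- The action of unary multimaps on the inputs and the output of a multimap. -/
def act₄ {a₁ a₂ a₃ a₄ a₁' a₂' a₃' a₄' c c' : M.Obj} (p₁ : M.Hom [a₁'] a₁) (p₂ : M.Hom [a₂'] a₂)
    (p₃ : M.Hom [a₃'] a₃) (p₄ : M.Hom [a₄'] a₄)
    (r : M.Hom [c] c') (f : M.Hom [a₁, a₂, a₃, a₄] c) : M.Hom [a₁', a₂', a₃', a₄'] c' :=
  M.post r (M.subst (Ξ := [a₁', a₂', a₃', a₄']) [a₁', a₂', a₃'] [] rfl rfl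
      (M.subst (Ξ := [a₁', a₂', a₃', a₄]) [a₁', a₂'] [a₄] rfl rfl
      (M.subst (Ξ := [a₁', a₂', a₃, a₄]) [a₁'] [a₃, a₄] rfl rfl
      (M.subst (Ξ := [a₁', a₂, a₃, a₄]) [] [a₂, a₃, a₄] rfl rfl f p₁) p₂) p₃) p₄)

theorem act₄_id {a₁ a₂ a₃ a₄ c : M.Obj} (f : M.Hom [a₁, a₂, a₃, a₄] c) :
    M.act₄ (M.id _) (M.id _) (M.id _) (M.id _) (M.id c) f = f := by
  simp only [act₄, post_id, subst_id, castDom_rfl]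

theorem act₄_comp {a₁ a₂ a₃ a₄ a₁' a₂' a₃' a₄' a₁'' a₂'' a₃'' a₄'' c c' c'' : M.Obj}
    (p₁ : M.Hom [a₁'] a₁) (p₂ : M.Hom [a₂'] a₂) (p₃ : M.Hom [a₃'] a₃) (p₄ : M.Hom [a₄'] a₄)
    (p₁' : M.Hom [a₁''] a₁') (p₂' : M.Hom [a₂''] a₂') (p₃' : M.Hom [a₃''] a₃') (p₄' : M.Hom
        [a₄''] a₄')
    (r : M.Hom [c] c') (r' : M.Hom [c'] c'') (f : M.Hom [a₁, a₂, a₃, a₄] c) :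
    M.act₄ (M.post p₁ p₁') (M.post p₂ p₂') (M.post p₃ p₃') (M.post p₄ p₄') (M.post r' r) f =
      M.act₄ p₁' p₂' p₃' p₄' r' (M.act₄ p₁ p₂ p₃ p₄ r f) := by
  unfold act₄
  simp only [← post_subst, post_post]
  rw [M.subst_subst_after [a₂', a₃'] _ p₄ p₁',
    M.subst_subst_after [a₂'] _ p₃ p₁',
    M.subst_subst_after [] _ p₂ p₁',
    M.subst_subst_after [a₃'] _ p₄ p₂',
    M.subst_subst_after [] _ p₃ p₂',
    M.subst_subst_after [] _ p₄ p₃']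
  unfold post
  rw
      [M.subst_assoc _ p₄ p₄', M.subst_assoc _ p₃ p₃', M.subst_assoc _ p₂ p₂', M.subst_assoc _ p₁ p₁']
  all_goals rfl

theorem nat₂₂₁ {a₁ a₂ a₁' a₂' b₁ b₂ b₂' c c' : M.Obj}
    (p₁ : M.Hom [a₁'] a₁) (p₂ : M.Hom [a₂'] a₂) (q₂ : M.Hom [b₂'] b₂) (r : M.Hom [c] c')
    (g : M.Hom [b₁, b₂] c) (f : M.Hom [a₁, a₂] b₁) :
    M.subst (Ξ := [a₁', a₂', b₂']) [] [b₂'] rfl rfl (M.act₂ (M.id _) q₂ r g) (M.act₂ p₁ p₂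
        (M.id _) f) =
      M.act₃ p₁ p₂ q₂ r (M.subst (Ξ := [a₁, a₂, b₂]) [] [b₂] rfl rfl g f) := by
  simp only [act₂, act₃, post_id, subst_id, castDom_rfl]
  rw [← post_subst,
    M.subst_subst_after [] _ q₂ _,
    M.subst_assoc _ _ p₂,
    M.subst_assoc _ _ p₁]
  all_goals rfl

theorem nat₂₂₂ {a₁ a₂ a₁' a₂' b₁ b₂ b₁' c c' : M.Obj}
    (p₁ : M.Hom [a₁'] a₁) (p₂ : M.Hom [a₂'] a₂) (q₁ : M.Hom [b₁'] b₁) (r : M.Hom [c] c')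
    (g : M.Hom [b₁, b₂] c) (f : M.Hom [a₁, a₂] b₂) :
    M.subst (Ξ := [b₁', a₁', a₂']) [b₁'] [] rfl rfl (M.act₂ q₁ (M.id _) r g) (M.act₂ p₁ p₂
        (M.id _) f) =
      M.act₃ q₁ p₁ p₂ r (M.subst (Ξ := [b₁, a₁, a₂]) [b₁] [] rfl rfl g f) := by
  simp only [act₂, act₃, post_id, subst_id, castDom_rfl]
  rw [← post_subst,
    M.subst_assoc _ _ p₂,
    M.subst_assoc _ _ p₁,
    M.subst_subst_before [] _ q₁ f]
  all_goals rfl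

theorem nat₃₂₁ {a₁ a₂ a₁' a₂' b₁ b₂ b₃ b₂' b₃' c c' : M.Obj}
    (p₁ : M.Hom [a₁'] a₁) (p₂ : M.Hom [a₂'] a₂) (q₂ : M.Hom [b₂'] b₂) (q₃ : M.Hom [b₃'] b₃)
        (r : M.Hom [c] c')
    (g : M.Hom [b₁, b₂, b₃] c) (f : M.Hom [a₁, a₂] b₁) :
    M.subst (Ξ := [a₁', a₂', b₂', b₃']) [] [b₂', b₃'] rfl rfl (M.act₃ (M.id _) q₂ q₃ r g)
        (M.act₂ p₁ p₂ (M.id _) f) =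
      M.act₄ p₁ p₂ q₂ q₃ r (M.subst (Ξ := [a₁, a₂, b₂, b₃]) [] [b₂, b₃] rfl rfl g f) := by
  simp only [act₃, act₂, act₄, post_id, subst_id, castDom_rfl]
  rw [← post_subst,
    M.subst_subst_after [b₂'] _ q₃ _,
    M.subst_subst_after [] _ q₂ _,
    M.subst_assoc _ _ p₂,
    M.subst_assoc _ _ p₁]
  all_goals rfl

theorem nat₃₂₂ {a₁ a₂ a₁' a₂' b₁ b₂ b₃ b₁' b₃' c c' : M.Obj}
    (p₁ : M.Hom [a₁'] a₁) (p₂ : M.Hom [a₂'] a₂) (q₁ : M.Hom [b₁'] b₁) (q₃ : M.Hom [b₃'] b₃)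
        (r : M.Hom [c] c')
    (g : M.Hom [b₁, b₂, b₃] c) (f : M.Hom [a₁, a₂] b₂) :
    M.subst (Ξ := [b₁', a₁', a₂', b₃']) [b₁'] [b₃'] rfl rfl (M.act₃ q₁ (M.id _) q₃ r g)
        (M.act₂ p₁ p₂ (M.id _) f) =
      M.act₄ q₁ p₁ p₂ q₃ r (M.subst (Ξ := [b₁, a₁, a₂, b₃]) [b₁] [b₃] rfl rfl g f) := by
  simp only [act₃, act₂, act₄, post_id, subst_id, castDom_rfl]
  rw [← post_subst,
    M.subst_subst_after [] _ q₃ _,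
    M.subst_assoc _ _ p₂,
    M.subst_assoc _ _ p₁,
    M.subst_subst_before [] _ q₁ f]
  all_goals rfl

theorem nat₃₂₃ {a₁ a₂ a₁' a₂' b₁ b₂ b₃ b₁' b₂' c c' : M.Obj}
    (p₁ : M.Hom [a₁'] a₁) (p₂ : M.Hom [a₂'] a₂) (q₁ : M.Hom [b₁'] b₁) (q₂ : M.Hom [b₂'] b₂)
        (r : M.Hom [c] c')
    (g : M.Hom [b₁, b₂, b₃] c) (f : M.Hom [a₁, a₂] b₃) :
    M.subst (Ξ := [b₁', b₂', a₁', a₂']) [b₁', b₂'] [] rfl rfl (M.act₃ q₁ q₂ (M.id _) r g)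
        (M.act₂ p₁ p₂ (M.id _) f) =
      M.act₄ q₁ q₂ p₁ p₂ r (M.subst (Ξ := [b₁, b₂, a₁, a₂]) [b₁, b₂] [] rfl rfl g f) := by
  simp only [act₃, act₂, act₄, post_id, subst_id, castDom_rfl]
  rw [← post_subst,
    M.subst_assoc _ _ p₂,
    M.subst_assoc _ _ p₁,
    M.subst_subst_before [] _ q₂ f,
    M.subst_subst_before [b₂] _ q₁ f]
  all_goals rfl

theorem nat₂₃₁ {a₁ a₂ a₃ a₁' a₂' a₃' b₁ b₂ b₂' c c' : M.Obj}
    (p₁ : M.Hom [a₁'] a₁) (p₂ : M.Hom [a₂'] a₂) (p₃ : M.Hom [a₃'] a₃) (q₂ : M.Hom [b₂'] b₂)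
        (r : M.Hom [c] c')
    (g : M.Hom [b₁, b₂] c) (f : M.Hom [a₁, a₂, a₃] b₁) :
    M.subst (Ξ := [a₁', a₂', a₃', b₂']) [] [b₂'] rfl rfl (M.act₂ (M.id _) q₂ r g) (M.act₃ p₁ p₂ p₃
        (M.id _) f) =
      M.act₄ p₁ p₂ p₃ q₂ r (M.subst (Ξ := [a₁, a₂, a₃, b₂]) [] [b₂] rfl rfl g f) := by
  simp only [act₂, act₃, act₄, post_id, subst_id, castDom_rfl]
  rw [← post_subst,
    M.subst_subst_after [] _ q₂ _,
    M.subst_assoc _ _ p₃,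
    M.subst_assoc _ _ p₂,
    M.subst_assoc _ _ p₁]
  all_goals rfl

theorem nat₂₃₂ {a₁ a₂ a₃ a₁' a₂' a₃' b₁ b₂ b₁' c c' : M.Obj}
    (p₁ : M.Hom [a₁'] a₁) (p₂ : M.Hom [a₂'] a₂) (p₃ : M.Hom [a₃'] a₃) (q₁ : M.Hom [b₁'] b₁)
        (r : M.Hom [c] c')
    (g : M.Hom [b₁, b₂] c) (f : M.Hom [a₁, a₂, a₃] b₂) :
    M.subst (Ξ := [b₁', a₁', a₂', a₃']) [b₁'] [] rfl rfl (M.act₂ q₁ (M.id _) r g) (M.act₃ p₁ p₂ p₃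
        (M.id _) f) =
      M.act₄ q₁ p₁ p₂ p₃ r (M.subst (Ξ := [b₁, a₁, a₂, a₃]) [b₁] [] rfl rfl g f) := by
  simp only [act₂, act₃, act₄, post_id, subst_id, castDom_rfl]
  rw [← post_subst,
    M.subst_assoc _ _ p₃,
    M.subst_assoc _ _ p₂,
    M.subst_assoc _ _ p₁,
    M.subst_subst_before [] _ q₁ f]
  all_goals rfl

theorem nat₂₀₁ {b₁ b₂ b₂' c c' : M.Obj}
    (q₂ : M.Hom [b₂'] b₂) (r : M.Hom [c] c')
    (g : M.Hom [b₁, b₂] c) (f : M.Hom [] b₁) :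
    M.subst (Ξ := [b₂']) [] [b₂'] rfl rfl (M.act₂ (M.id _) q₂ r g) f =
      M.post (M.post r (M.subst (Ξ := [b₂]) [] [b₂] rfl rfl g f)) q₂ := by
  simp only [act₂, subst_id, castDom_rfl]
  rw [← post_subst,
    M.subst_subst_after [] _ q₂ _,
    M.post_subst]
  all_goals rfl

theorem nat₂₀₂ {b₁ b₂ b₁' c c' : M.Obj}
    (q₁ : M.Hom [b₁'] b₁) (r : M.Hom [c] c')
    (g : M.Hom [b₁, b₂] c) (f : M.Hom [] b₂) :
    M.subst (Ξ := [b₁']) [b₁'] [] rfl rfl (M.act₂ q₁ (M.id _) r g) f =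
      M.post (M.post r (M.subst (Ξ := [b₁]) [b₁] [] rfl rfl g f)) q₁ := by
  simp only [act₂, subst_id, castDom_rfl]
  rw [← post_subst,
    M.subst_subst_before [] _ q₁ f,
    M.post_subst]
  all_goals rfl

theorem nat₃₀₁ {b₁ b₂ b₃ b₂' b₃' c c' : M.Obj}
    (q₂ : M.Hom [b₂'] b₂) (q₃ : M.Hom [b₃'] b₃) (r : M.Hom [c] c')
    (g : M.Hom [b₁, b₂, b₃] c) (f : M.Hom [] b₁) :
    M.subst (Ξ := [b₂', b₃']) [] [b₂', b₃'] rfl rfl (M.act₃ (M.id _) q₂ q₃ r g) f =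
      M.act₂ q₂ q₃ r (M.subst (Ξ := [b₂, b₃]) [] [b₂, b₃] rfl rfl g f) := by
  simp only [act₃, act₂, subst_id, castDom_rfl]
  rw [← post_subst,
    M.subst_subst_after [b₂'] _ q₃ _,
    M.subst_subst_after [] _ q₂ _]
  all_goals rfl

theorem nat₃₀₂ {b₁ b₂ b₃ b₁' b₃' c c' : M.Obj}
    (q₁ : M.Hom [b₁'] b₁) (q₃ : M.Hom [b₃'] b₃) (r : M.Hom [c] c')
    (g : M.Hom [b₁, b₂, b₃] c) (f : M.Hom [] b₂) :
    M.subst (Ξ := [b₁', b₃']) [b₁'] [b₃'] rfl rfl (M.act₃ q₁ (M.id _) q₃ r g) f =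
      M.act₂ q₁ q₃ r (M.subst (Ξ := [b₁, b₃]) [b₁] [b₃] rfl rfl g f) := by
  simp only [act₃, act₂, subst_id, castDom_rfl]
  rw [← post_subst,
    M.subst_subst_after [] _ q₃ _,
    M.subst_subst_before [] _ q₁ f]
  all_goals rfl

theorem nat₃₀₃ {b₁ b₂ b₃ b₁' b₂' c c' : M.Obj}
    (q₁ : M.Hom [b₁'] b₁) (q₂ : M.Hom [b₂'] b₂) (r : M.Hom [c] c')
    (g : M.Hom [b₁, b₂, b₃] c) (f : M.Hom [] b₃) :
    M.subst (Ξ := [b₁', b₂']) [b₁', b₂'] [] rfl rfl (M.act₃ q₁ q₂ (M.id _) r g) f =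
      M.act₂ q₁ q₂ r (M.subst (Ξ := [b₁, b₂]) [b₁, b₂] [] rfl rfl g f) := by
  simp only [act₃, act₂, subst_id, castDom_rfl]
  rw [← post_subst,
    M.subst_subst_before [] _ q₂ f,
    M.subst_subst_before [b₂] _ q₁ f]
  all_goals rfl

theorem subst_dinat {l r Θ Θ' Γ Ξ : List M.Obj} {a b c : M.Obj} {hΘ : Θ = l ++ b :: r}
    {hΘ' : Θ' = l ++ [a] ++ r} {hΘ'' : Θ' = l ++ a :: r} {hΞ : Ξ = l ++ Γ ++ r} {g : M.Hom Θ c}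
    {s : M.Hom [a] b} {f : M.Hom Γ a} {x : M.Hom Θ' c} {y : M.Hom Γ b}
    (hx : x = M.subst l r hΘ hΘ' g s) (hy : y = M.post s f) :
    M.subst l r hΘ'' hΞ x f = M.subst l r hΘ hΞ g y := by
  subst hx hy hΘ hΘ' hΞ
  unfold post
  rw [subst_assoc]
  simp [subst, ← comp_castDom M (List.append_nil l) rfl rfl]

theorem act₂_pre₁ {a₁ a₂ b c : M.Obj} (s : M.Hom [b] a₁) (f : M.Hom [a₁, a₂] c) :
    M.act₂ s (M.id _) (M.id _) f =
      M.subst (Ξ := [b, a₂]) [] [a₂] rfl rfl f s := by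
  simp only [act₂, post_id, subst_id, castDom_rfl]

theorem act₂_pre₂ {a₁ a₂ b c : M.Obj} (s : M.Hom [b] a₂) (f : M.Hom [a₁, a₂] c) :
    M.act₂ (M.id _) s (M.id _) f =
      M.subst (Ξ := [a₁, b]) [a₁] [] rfl rfl f s := by
  simp only [act₂, post_id, subst_id, castDom_rfl]

theorem act₂_post {a₁ a₂ c d : M.Obj} (s : M.Hom [c] d) (f : M.Hom [a₁, a₂] c) :
    M.act₂ (M.id _) (M.id _) s f = M.post s f := by
  simp only [act₂, subst_id, castDom_rfl]

theorem act₃_pre₁ {a₁ a₂ a₃ b c : M.Obj} (s : M.Hom [b] a₁) (f : M.Hom [a₁, a₂, a₃] c) :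
    M.act₃ s (M.id _) (M.id _) (M.id _) f =
      M.subst (Ξ := [b, a₂, a₃]) [] [a₂, a₃] rfl rfl f s := by
  simp only [act₃, post_id, subst_id, castDom_rfl]

theorem act₃_pre₂ {a₁ a₂ a₃ b c : M.Obj} (s : M.Hom [b] a₂) (f : M.Hom [a₁, a₂, a₃] c) :
    M.act₃ (M.id _) s (M.id _) (M.id _) f =
      M.subst (Ξ := [a₁, b, a₃]) [a₁] [a₃] rfl rfl f s := by
  simp only [act₃, post_id, subst_id, castDom_rfl]

theorem act₃_pre₃ {a₁ a₂ a₃ b c : M.Obj} (s : M.Hom [b] a₃) (f : M.Hom [a₁, a₂, a₃] c) :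
    M.act₃ (M.id _) (M.id _) s (M.id _) f =
      M.subst (Ξ := [a₁, a₂, b]) [a₁, a₂] [] rfl rfl f s := by
  simp only [act₃, post_id, subst_id, castDom_rfl]

theorem act₃_post {a₁ a₂ a₃ c d : M.Obj} (s : M.Hom [c] d) (f : M.Hom [a₁, a₂, a₃] c) :
    M.act₃ (M.id _) (M.id _) (M.id _) s f = M.post s f := by
  simp only [act₃, subst_id, castDom_rfl]

end substitution

/-- The short multicategory underlying a multicategory. -/
def toShort (M : Multicategory.{v, u}) : ShortMulticategory.{v, u} where
  C := M.Obj
  Hom₀ c := M.Hom [] c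
  Hom₂ a₁ a₂ c := M.Hom [a₁, a₂] c
  Hom₃ a₁ a₂ a₃ c := M.Hom [a₁, a₂, a₃] c
  Hom₄ a₁ a₂ a₃ a₄ c := M.Hom [a₁, a₂, a₃, a₄] c
  map₀ r f := M.post r f
  map₂ p₁ p₂ r f := M.act₂ p₁ p₂ r f
  map₃ p₁ p₂ p₃ r f := M.act₃ p₁ p₂ p₃ r f
  map₄ p₁ p₂ p₃ p₄ r f := M.act₄ p₁ p₂ p₃ p₄ r f
  map₀_id f := M.post_id f
  map₂_id f := M.act₂_id f
  map₃_id f := M.act₃_id f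
  map₄_id f := M.act₄_id f
  map₀_comp r r' f := (M.post_post r' r f).symm
  map₂_comp p₁ p₁' p₂ p₂' r r' f := M.act₂_comp p₁ p₂ p₁' p₂' r r' f
  map₃_comp p₁ p₁' p₂ p₂' p₃ p₃' r r' f := M.act₃_comp p₁ p₂ p₃ p₁' p₂' p₃' r r' f
  map₄_comp p₁ p₁' p₂ p₂' p₃ p₃' p₄ p₄' r r' f :=
    M.act₄_comp p₁ p₂ p₃ p₄ p₁' p₂' p₃' p₄' r r' f
  comp₂₂₁ {a₁ a₂ _ b₂ _} g f := M.subst (Ξ := [a₁, a₂, b₂]) [] [b₂] rfl rfl g f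
  comp₂₂₂ {a₁ a₂ b₁ _ _} g f := M.subst (Ξ := [b₁, a₁, a₂]) [b₁] [] rfl rfl g f
  comp₃₂₁ {a₁ a₂ _ b₂ b₃ _} g f := M.subst (Ξ := [a₁, a₂, b₂, b₃]) [] [b₂, b₃] rfl rfl g f
  comp₃₂₂ {a₁ a₂ b₁ _ b₃ _} g f := M.subst (Ξ := [b₁, a₁, a₂, b₃]) [b₁] [b₃] rfl rfl g f
  comp₃₂₃ {a₁ a₂ b₁ b₂ _ _} g f := M.subst (Ξ := [b₁, b₂, a₁, a₂]) [b₁, b₂] [] rfl rfl g f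
  comp₂₃₁ {a₁ a₂ a₃ _ b₂ _} g f := M.subst (Ξ := [a₁, a₂, a₃, b₂]) [] [b₂] rfl rfl g f
  comp₂₃₂ {a₁ a₂ a₃ b₁ _ _} g f := M.subst (Ξ := [b₁, a₁, a₂, a₃]) [b₁] [] rfl rfl g f
  comp₂₀₁ {_ b₂ _} g f := M.subst (Ξ := [b₂]) [] [b₂] rfl rfl g f
  comp₂₀₂ {b₁ _ _} g f := M.subst (Ξ := [b₁]) [b₁] [] rfl rfl g f
  comp₃₀₁ {_ b₂ b₃ _} g f := M.subst (Ξ := [b₂, b₃]) [] [b₂, b₃] rfl rfl g f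
  comp₃₀₂ {b₁ _ b₃ _} g f := M.subst (Ξ := [b₁, b₃]) [b₁] [b₃] rfl rfl g f
  comp₃₀₃ {b₁ b₂ _ _} g f := M.subst (Ξ := [b₁, b₂]) [b₁, b₂] [] rfl rfl g f
  nat₂₂₁ _ _ _ r g f := M.nat₂₂₁ _ _ _ r g f
  nat₂₂₂ _ _ _ r g f := M.nat₂₂₂ _ _ _ r g f
  nat₃₂₁ _ _ _ _ r g f := M.nat₃₂₁ _ _ _ _ r g f
  nat₃₂₂ _ _ _ _ r g f := M.nat₃₂₂ _ _ _ _ r g f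
  nat₃₂₃ _ _ _ _ r g f := M.nat₃₂₃ _ _ _ _ r g f
  nat₂₃₁ _ _ _ _ r g f := M.nat₂₃₁ _ _ _ _ r g f
  nat₂₃₂ _ _ _ _ r g f := M.nat₂₃₂ _ _ _ _ r g f
  nat₂₀₁ _ r g f := M.nat₂₀₁ _ r g f
  nat₂₀₂ _ r g f := M.nat₂₀₂ _ r g f
  nat₃₀₁ _ _ r g f := M.nat₃₀₁ _ _ r g f
  nat₃₀₂ _ _ r g f := M.nat₃₀₂ _ _ r g f
  nat₃₀₃ _ _ r g f := M.nat₃₀₃ _ _ r g f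
  dinat₂₂₁ s g f := M.subst_dinat (M.act₂_pre₁ s g) (M.act₂_post s f)
  dinat₂₂₂ s g f := M.subst_dinat (M.act₂_pre₂ s g) (M.act₂_post s f)
  dinat₃₂₁ s g f := M.subst_dinat (M.act₃_pre₁ s g) (M.act₂_post s f)
  dinat₃₂₂ s g f := M.subst_dinat (M.act₃_pre₂ s g) (M.act₂_post s f)
  dinat₃₂₃ s g f := M.subst_dinat (M.act₃_pre₃ s g) (M.act₂_post s f)
  dinat₂₃₁ s g f := M.subst_dinat (M.act₂_pre₁ s g) (M.act₃_post s f)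
  dinat₂₃₂ s g f := M.subst_dinat (M.act₂_pre₂ s g) (M.act₃_post s f)
  dinat₂₀₁ s g _ := M.subst_dinat (M.act₂_pre₁ s g) rfl
  dinat₂₀₂ s g _ := M.subst_dinat (M.act₂_pre₂ s g) rfl
  dinat₃₀₁ s g _ := M.subst_dinat (M.act₃_pre₁ s g) rfl
  dinat₃₀₂ s g _ := M.subst_dinat (M.act₃_pre₂ s g) rfl
  dinat₃₀₃ s g _ := M.subst_dinat (M.act₃_pre₃ s g) rfl
  assoc₁₁ f g h := M.subst_assoc f g h
  assoc₁₂ f g h := M.subst_assoc f g h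
  assoc₂₁ f g h := M.subst_assoc f g h
  assoc₂₂ f g h := M.subst_assoc f g h
  assoc₁₁_null f g h := (M.act₂_pre₁ _ f).trans (M.subst_assoc f g h)
  assoc₁₂_null f g h := (M.act₂_pre₁ _ f).trans (M.subst_assoc f g h)
  assoc₂₁_null f g h := (M.act₂_pre₂ _ f).trans (M.subst_assoc f g h)
  assoc₂₂_null f g h := (M.act₂_pre₂ _ f).trans (M.subst_assoc f g h)
  comm₂₂ f g h := M.subst_comm [] [] [] rfl rfl rfl rfl f g h
  comm₂₀ f g h := (M.subst_comm [] [] [] rfl rfl rfl rfl f g h).trans (M.act₂_post _ g).symm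
  comm₀₂ f g h := (M.act₂_post _ h).trans (M.subst_comm [] [] [] rfl rfl rfl rfl f g h)
  comm₀₀ f g h := M.subst_comm [] [] [] rfl rfl rfl rfl f g h

section morphism

variable {M N : Multicategory.{v, u}} (F : Multifunctor M N)

theorem Multifunctor.map_subst {l r Θ Γ Ξ : List M.Obj} {b c : M.Obj} (hΘ : Θ = l ++ b :: r)
    (hΞ : Ξ = l ++ Γ ++ r) (g : M.Hom Θ c) (f : M.Hom Γ b) :
    F.map (M.subst l r hΘ hΞ g f) =
      N.subst (l.map F.obj) (r.map F.obj) (by simp [hΘ]) (by simp [hΞ]) (F.map g) (F.map f) := by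
  subst hΘ hΞ
  have e := (castDom_eq_iff _ _ _).1 (F.map_comp l r g f)
  simpa [subst] using e

theorem Multifunctor.map_post {Γ : List M.Obj} {c d : M.Obj} (s : M.Hom [c] d) (f : M.Hom Γ c) :
    F.map (M.post s f) = N.post (F.map s) (F.map f) :=
  F.map_subst _ _ s f

theorem Multifunctor.map_act₂ {a₁ a₂ a₁' a₂' c c' : M.Obj}
    (p₁ : M.Hom [a₁'] a₁) (p₂ : M.Hom [a₂'] a₂)
    (r : M.Hom [c] c') (f : M.Hom [a₁, a₂] c) :
    F.map (M.act₂ p₁ p₂ r f) =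
      N.act₂ (F.map p₁) (F.map p₂) (F.map r) (F.map f) := by
  unfold act₂
  rw [F.map_post, F.map_subst, F.map_subst]
  rfl

theorem Multifunctor.map_act₃ {a₁ a₂ a₃ a₁' a₂' a₃' c c' : M.Obj}
    (p₁ : M.Hom [a₁'] a₁) (p₂ : M.Hom [a₂'] a₂) (p₃ : M.Hom [a₃'] a₃)
    (r : M.Hom [c] c') (f : M.Hom [a₁, a₂, a₃] c) :
    F.map (M.act₃ p₁ p₂ p₃ r f) =
      N.act₃ (F.map p₁) (F.map p₂) (F.map p₃) (F.map r) (F.map f) := by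
  unfold act₃
  rw [F.map_post, F.map_subst, F.map_subst, F.map_subst]
  rfl

theorem Multifunctor.map_act₄ {a₁ a₂ a₃ a₄ a₁' a₂' a₃' a₄' c c' : M.Obj}
    (p₁ : M.Hom [a₁'] a₁) (p₂ : M.Hom [a₂'] a₂) (p₃ : M.Hom [a₃'] a₃) (p₄ : M.Hom [a₄'] a₄)
    (r : M.Hom [c] c') (f : M.Hom [a₁, a₂, a₃, a₄] c) :
    F.map (M.act₄ p₁ p₂ p₃ p₄ r f) =
      N.act₄ (F.map p₁) (F.map p₂) (F.map p₃) (F.map p₄) (F.map r) (F.map f) := by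
  unfold act₄
  rw [F.map_post, F.map_subst, F.map_subst, F.map_subst, F.map_subst]
  rfl

/-- The morphism of short multicategories underlying a multifunctor. -/
def Multifunctor.toShort : ShortMulticategory.Morphism M.toShort N.toShort where
  functor :=
    { obj := F.obj
      map := fun f => F.map f
      map_id := F.map_id
      map_comp := fun f g => F.map_comp [] [] g f }
  F₀ f := F.map f
  F₂ f := F.map f
  F₃ f := F.map f
  F₄ f := F.map f
  nat₀ r f := F.map_post r f
  nat₂ p₁ p₂ r f := F.map_act₂ p₁ p₂ r f
  nat₃ p₁ p₂ p₃ r f := F.map_act₃ p₁ p₂ p₃ r f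
  nat₄ p₁ p₂ p₃ p₄ r f := F.map_act₄ p₁ p₂ p₃ p₄ r f
  map_comp₂₂₁ {_ _ b₁ b₂ _} g f := F.map_subst (l := []) (r := [b₂]) (Θ := [b₁, b₂]) rfl rfl g f
  map_comp₂₂₂ {_ _ b₁ b₂ _} g f := F.map_subst (l := [b₁]) (r := []) (Θ := [b₁, b₂]) rfl rfl g f
  map_comp₃₂₁ {_ _ b₁ b₂ b₃ _} g f :=
    F.map_subst (l := []) (r := [b₂, b₃]) (Θ := [b₁, b₂, b₃]) rfl rfl g f
  map_comp₃₂₂ {_ _ b₁ b₂ b₃ _} g f :=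
    F.map_subst (l := [b₁]) (r := [b₃]) (Θ := [b₁, b₂, b₃]) rfl rfl g f
  map_comp₃₂₃ {_ _ b₁ b₂ b₃ _} g f :=
    F.map_subst (l := [b₁, b₂]) (r := []) (Θ := [b₁, b₂, b₃]) rfl rfl g f
  map_comp₂₃₁ {_ _ _ b₁ b₂ _} g f := F.map_subst (l := []) (r := [b₂]) (Θ := [b₁, b₂]) rfl rfl g f
  map_comp₂₃₂ {_ _ _ b₁ b₂ _} g f := F.map_subst (l := [b₁]) (r := []) (Θ := [b₁, b₂]) rfl rfl g f
  map_comp₂₀₁ {b₁ b₂ _} g f := F.map_subst (l := []) (r := [b₂]) (Θ := [b₁, b₂]) rfl rfl g f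
  map_comp₂₀₂ {b₁ b₂ _} g f := F.map_subst (l := [b₁]) (r := []) (Θ := [b₁, b₂]) rfl rfl g f
  map_comp₃₀₁ {b₁ b₂ b₃ _} g f :=
    F.map_subst (l := []) (r := [b₂, b₃]) (Θ := [b₁, b₂, b₃]) rfl rfl g f
  map_comp₃₀₂ {b₁ b₂ b₃ _} g f :=
    F.map_subst (l := [b₁]) (r := [b₃]) (Θ := [b₁, b₂, b₃]) rfl rfl g f
  map_comp₃₀₃ {b₁ b₂ b₃ _} g f :=
    F.map_subst (l := [b₁, b₂]) (r := []) (Θ := [b₁, b₂, b₃]) rfl rfl g f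

end morphism

theorem IsLeftRepresentable.toShort {M : Multicategory.{v, u}} (h : M.IsLeftRepresentable) :
    M.toShort.IsLeftRepresentable := by
  refine ⟨?_, fun a b => ?_⟩
  · obtain ⟨m, θ, h, h'⟩ := h []
    exact ⟨m, θ, h, fun x d => h' [x] d, fun x y d => h' [x, y] d⟩
  · obtain ⟨m, θ, h, h'⟩ := h [a, b]
    refine ⟨m, θ, fun d => ?_, fun x d => h' [x] d, fun x y d => h' [x, y] d⟩
    refine Eq.mp (congrArg Function.Bijective ?_) (h d)
    funext g
    exact (M.act₂_post g θ).symm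

end Multicategory

/-- The forgetful functor `U` from multicategories to short multicategories. -/
def forgetToShort : Multicategory.{v, u} ⥤ ShortMulticategory.{v, u} where
  obj M := M.toShort
  map F := F.toShort

/-- The forgetful functor `U_lr` from left representable multicategories to left representable
short multicategories. -/
def functorUlr : LeftRepMulticategory.{v, u} ⥤ LeftRepShortMulticategory.{v, u} :=
  ObjectProperty.lift _ (ObjectProperty.ι _ ⋙ forgetToShort) fun M => M.property.toShort

/-! ### The functor `K` is full and faithful -/

namespace ShortMulticategory

/-! Three facts carry the theorem: `K` is fully faithful, `U_lr` is fully faithful, and every left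
normal skew monoidal category `A` is isomorphic to the image under `U_lr` followed by `K` of a left
representable multicategory built from `A`. The third makes `K` essentially surjective. It also
handles `U_lr`: applied to `A = K M` it gives an isomorphism in the target of `K`, which lifts
through the fully faithful `K` to an isomorphism of `M` with an object in the image of `U_lr`.

For `K`: universality writes every multimap of arity 0, 2, 3 or 4 uniquely in terms of a unary map
and the classifiers `u`, `θ`. A morphism is therefore determined by its functor together with `F₀ u`
and `F₂ θ`, which is exactly the data `(F, f₀, f₂)` (`laxFunctor_injective`). Conversely, a lax
functor prescribes images of `u` and `θ`, and these extend along the factorizations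
(`Images.morphism`). Compatibility with `∘₁` of binary maps is built in; with `∘₂` it is the axiom
for `α`; with nullary substitution into binary maps it comes from the axioms for `λ` and `ρ`. The
remaining substitutions reduce to these by the associativity and commutativity laws.

For `U_lr`: a multimap of arity at least 2 is `g ∘₁ θ` for a unique `g` of arity one less. By
recursion a multifunctor is determined in low arities, and a short morphism extends to all arities.
That the extension respects substitution (`ShortMap.ext_subst`) is proved by peeling classifiers off
both multimaps until only the substitutions known to the short morphism remain.

For the third fact: multimaps `a₁, …, aₙ → b` are the maps `((i a₁) ⋯) aₙ ⟶ b`. To substitute, the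
partial product `x` of the earlier inputs is moved past a block `Γ` by `ρ` and iterated associators,
`unshift : fold x Γ ⟶ x (fold i Γ)`. The multicategory laws are iterated forms of the skew monoidal
axioms, with `sub_assoc_shift` the main point; they hold without left normality. Invertibility of
`λ` is what makes every invertible map `fold i Γ ⟶ m` a left universal classifier and identifies
unary multimaps `i a ⟶ b` with maps `a ⟶ b`. -/

theorem map₂_eq_post_pre (M : ShortMulticategory.{v, u}) {a b c a' b' c' : M.C}
    (p : a' ⟶ a) (q : b' ⟶ b) (r : c ⟶ c') (f : M.Hom₂ a b c) :
    M.map₂ p q r f = M.map₂ p q (𝟙 _) (M.map₂ (𝟙 _) (𝟙 _) r f) := by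
  rw [← M.map₂_comp]; simp

theorem Morphism.ext_of_functor {M N : ShortMulticategory.{v, u}} {F G : Morphism M N}
    (h : F.functor = G.functor) (h₀ : ∀ {c} (f : M.Hom₀ c), HEq (F.F₀ f) (G.F₀ f))
    (h₂ : ∀ {a₁ a₂ c} (f : M.Hom₂ a₁ a₂ c), HEq (F.F₂ f) (G.F₂ f))
    (h₃ : ∀ {a₁ a₂ a₃ c} (f : M.Hom₃ a₁ a₂ a₃ c), HEq (F.F₃ f) (G.F₃ f))
    (h₄ : ∀ {a₁ a₂ a₃ a₄ c} (f : M.Hom₄ a₁ a₂ a₃ a₄ c), HEq (F.F₄ f) (G.F₄ f)) : F = G := by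
  obtain ⟨F, F₀, F₂, F₃, F₄⟩ := F
  obtain ⟨G, G₀, G₂, G₃, G₄⟩ := G
  obtain rfl : F = G := h
  obtain rfl : @F₀ = @G₀ := by funext c f; exact eq_of_heq (h₀ f)
  obtain rfl : @F₂ = @G₂ := by funext _ _ _ f; exact eq_of_heq (h₂ f)
  obtain rfl : @F₃ = @G₃ := by funext _ _ _ _ f; exact eq_of_heq (h₃ f)
  obtain rfl : @F₄ = @G₄ := by funext _ _ _ _ _ f; exact eq_of_heq (h₄ f)
  rfl

/-! ### Faithfulness of `K`: morphisms are determined by their values on the classifiers. -/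

namespace Classifiers

variable {M N : ShortMulticategory.{v, u}} (χ : M.Classifiers) (ψ : N.Classifiers)

/-- Since `f` is `χ.lift₀ f` applied to `u`, naturality leaves `F₀ u` as the only nullary datum. The
right side mentions `F` only through its lax functor. -/
theorem map₀_lift (F : Morphism M N) {c : M.C} (f : M.Hom₀ c) :
    F.F₀ f = N.map₀ (ψ.lift₀ (F.F₀ χ.u) ≫ F.functor.map (χ.lift₀ f)) ψ.u := by
  rw [N.map₀_comp, lift₀_spec, ← F.nat₀, lift₀_spec]

theorem map₂_lift (F : Morphism M N) {a b c : M.C} (f : M.Hom₂ a b c) :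
    F.F₂ f = N.map₂ (𝟙 _) (𝟙 _) (ψ.lift₂ (F.F₂ (χ.θ a b)) ≫ F.functor.map (χ.lift₂ f))
      (ψ.θ _ _) := by
  rw [post₂_comp, lift₂_spec, ← F.functor.map_id, ← F.functor.map_id, ← F.nat₂, lift₂_spec]

theorem laxFunctor_injective {F G : Morphism M N} (h : χ.laxFunctor ψ F = χ.laxFunctor ψ G) :
    F = G := by
  have e : F.functor = G.functor := congrArg SkewMonoidalCategory.LaxFunctor.functor h
  have e₀ : ∀ {c} (f : M.Hom₀ c), HEq (F.F₀ f) (G.F₀ f) := fun f => by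
    rw [χ.map₀_lift ψ F, χ.map₀_lift ψ G]
    -- Every occurrence of `F` is displayed as a component of its lax functor, so that `h` rewrites
    -- the whole expression at once, types included.
    change HEq (N.map₀ ((χ.laxFunctor ψ F).f₀ ≫ (χ.laxFunctor ψ F).functor.map _) _)
      (N.map₀ ((χ.laxFunctor ψ G).f₀ ≫ (χ.laxFunctor ψ G).functor.map _) _)
    rw [h]
  have e₂ : ∀ {a b c} (f : M.Hom₂ a b c), HEq (F.F₂ f) (G.F₂ f) := fun f => by
    rw [χ.map₂_lift ψ F, χ.map₂_lift ψ G]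
    change HEq (N.map₂ (𝟙 ((χ.laxFunctor ψ F).functor.obj _))
        (𝟙 ((χ.laxFunctor ψ F).functor.obj _)) ((χ.laxFunctor ψ F).f₂ _ _ ≫
          (χ.laxFunctor ψ F).functor.map _) (ψ.θ _ _))
      (N.map₂ (𝟙 ((χ.laxFunctor ψ G).functor.obj _))
        (𝟙 ((χ.laxFunctor ψ G).functor.obj _)) ((χ.laxFunctor ψ G).f₂ _ _ ≫
          (χ.laxFunctor ψ G).functor.map _) (ψ.θ _ _))
    rw [h]
  -- Once the functors are identified the heterogeneous equalities become equalities. The fields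
  -- kept, `m₁` and `m₂`, are compatibility with `∘₁` of a binary map into a binary and into a
  -- ternary one: all that is needed to recover `F₃` and `F₄`.
  obtain ⟨F, F₀, F₂, F₃, F₄, _, _, _, _, m₁, _, m₂⟩ := F
  obtain ⟨G, G₀, G₂, G₃, G₄, _, _, _, _, m₁', _, m₂'⟩ := G
  obtain rfl : F = G := e
  have e₃ : ∀ {a b c d} (f : M.Hom₃ a b c d), HEq (F₃ f) (G₃ f) := fun {a b c d} f => by
    obtain ⟨g, rfl⟩ := ((χ.θ_univ a b).2.1 _ _).2 f
    dsimp only at m₁ m₁' e₂ ⊢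
    rw [m₁, m₁', eq_of_heq (e₂ g), eq_of_heq (e₂ (χ.θ a b))]
  refine Morphism.ext_of_functor rfl e₀ e₂ e₃ fun {a b c d e} f => ?_
  obtain ⟨g, rfl⟩ := ((χ.θ_univ a b).2.2 _ _ _).2 f
  dsimp only at m₂ m₂' e₂ ⊢
  rw [m₂, m₂', eq_of_heq (e₃ g), eq_of_heq (e₂ (χ.θ a b))]

/-! #### Extension of a lax monoidal functor to multimaps -/

/-- Multimaps `V`, `T` in `N` that are compatible, like the images of the classifiers `u`, `θ` under
a morphism of short multicategories, with the structure maps of `M`. -/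
structure Images (Φ : M.C ⥤ N.C) where
  V : N.Hom₀ (Φ.obj χ.unit)
  T (a b : M.C) : N.Hom₂ (Φ.obj a) (Φ.obj b) (Φ.obj (χ.tensor a b))
  nat {a a' b b' : M.C} (p : a ⟶ a') (q : b ⟶ b') :
    N.map₂ (𝟙 _) (𝟙 _) (Φ.map (χ.tensorHom p q)) (T a b) =
      N.map₂ (Φ.map p) (Φ.map q) (𝟙 _) (T a' b')
  assoc (a b c : M.C) :
    N.map₃ (𝟙 _) (𝟙 _) (𝟙 _) (Φ.map (χ.assoc a b c)) (N.comp₂₂₁ (T (χ.tensor a b) c) (T a b)) =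
      N.comp₂₂₂ (T a (χ.tensor b c)) (T b c)
  η (a : M.C) : N.comp₂₀₁ (T χ.unit a) V = Φ.map (χ.η a)
  rho (a : M.C) : N.comp₂₀₂ (T a χ.unit) V = Φ.map (χ.rho a)

namespace Images

variable {χ} {Φ : M.C ⥤ N.C} (I : χ.Images Φ)

/-- The action on nullary multimaps. -/
noncomputable def ext₀ {c : M.C} (f : M.Hom₀ c) : N.Hom₀ (Φ.obj c) :=
  N.map₀ (Φ.map (χ.lift₀ f)) I.V

/-- The action on binary multimaps. -/
noncomputable def ext₂ {a b c : M.C} (f : M.Hom₂ a b c) :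
    N.Hom₂ (Φ.obj a) (Φ.obj b) (Φ.obj c) :=
  N.map₂ (𝟙 _) (𝟙 _) (Φ.map (χ.lift₂ f)) (I.T a b)

/-- The action on ternary multimaps. -/
noncomputable def ext₃ {a b c d : M.C} (f : M.Hom₃ a b c d) :
    N.Hom₃ (Φ.obj a) (Φ.obj b) (Φ.obj c) (Φ.obj d) :=
  N.comp₂₂₁ (I.ext₂ (((χ.θ_univ a b).2.1 _ _).2 f).choose) (I.T a b)

/-- The action on quaternary multimaps. -/
noncomputable def ext₄ {a b c d e : M.C} (f : M.Hom₄ a b c d e) :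
    N.Hom₄ (Φ.obj a) (Φ.obj b) (Φ.obj c) (Φ.obj d) (Φ.obj e) :=
  N.comp₃₂₁ (I.ext₃ (((χ.θ_univ a b).2.2 _ _ _).2 f).choose) (I.T a b)

/-! ### Compatibility of the extension with unary actions and substitutions. -/

theorem ext₀_map {c : M.C} (x : χ.unit ⟶ c) : I.ext₀ (M.map₀ x χ.u) = N.map₀ (Φ.map x) I.V := by
  unfold ext₀
  rw [χ.hom_ext₀ (χ.lift₀_spec (M.map₀ x χ.u))]

theorem ext₂_map {a b c : M.C} (x : χ.tensor a b ⟶ c) :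
    I.ext₂ (M.map₂ (𝟙 _) (𝟙 _) x (χ.θ a b)) = N.map₂ (𝟙 _) (𝟙 _) (Φ.map x) (I.T a b) := by
  unfold ext₂
  rw [χ.hom_ext₂ (χ.lift₂_spec (M.map₂ _ _ x (χ.θ a b)))]

theorem ext₂_θ (a b : M.C) : I.ext₂ (χ.θ a b) = I.T a b := by
  have h := I.ext₂_map (𝟙 (χ.tensor a b))
  rwa [M.map₂_id, Φ.map_id, N.map₂_id] at h

/-- Factorizations through `θ` are unique, so the one chosen in `ext₃` must be `f`. -/
theorem ext₃_comp {a b c d : M.C} (f : M.Hom₂ (χ.tensor a b) c d) :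
    I.ext₃ (M.comp₂₂₁ f (χ.θ a b)) = N.comp₂₂₁ (I.ext₂ f) (I.T a b) := by
  have h := (((χ.θ_univ a b).2.1 _ _).2 (M.comp₂₂₁ f (χ.θ a b))).choose_spec
  unfold ext₃
  rw [((χ.θ_univ a b).2.1 _ _).1 h]

theorem ext₄_comp {a b c d e : M.C} (f : M.Hom₃ (χ.tensor a b) c d e) :
    I.ext₄ (M.comp₃₂₁ f (χ.θ a b)) = N.comp₃₂₁ (I.ext₃ f) (I.T a b) := by
  have h := (((χ.θ_univ a b).2.2 _ _ _).2 (M.comp₃₂₁ f (χ.θ a b))).choose_spec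
  unfold ext₄
  rw [((χ.θ_univ a b).2.2 _ _ _).1 h]

theorem nat₀ {c c' : M.C} (r : c ⟶ c') (f : M.Hom₀ c) :
    I.ext₀ (M.map₀ r f) = N.map₀ (Φ.map r) (I.ext₀ f) := by
  obtain ⟨x, rfl⟩ := (χ.u_univ.1 _).2 f
  dsimp only
  rw [← M.map₀_comp, ext₀_map, ext₀_map, ← N.map₀_comp, Φ.map_comp]

/-- With `f = x ∘ θ`, acting by `p₁`, `p₂`, `r` gives the composite of `p₁ p₂`, `x` and `r` applied
to `θ`. The field `nat` of `I` makes the same exchange for `T`. -/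
theorem nat₂ {a₁ a₂ c a₁' a₂' c' : M.C} (p₁ : a₁' ⟶ a₁) (p₂ : a₂' ⟶ a₂) (r : c ⟶ c')
    (f : M.Hom₂ a₁ a₂ c) :
    I.ext₂ (M.map₂ p₁ p₂ r f) = N.map₂ (Φ.map p₁) (Φ.map p₂) (Φ.map r) (I.ext₂ f) := by
  obtain ⟨x, rfl⟩ := ((χ.θ_univ _ _).1 _).2 f
  dsimp only
  rw [M.map₂_eq_post_pre, ← post₂_comp, ← post₂_pre, ← tensorHom_spec, ← post₂_comp, ext₂_map,
    ext₂_map, Φ.map_comp, post₂_comp, I.nat, post₂_pre, Φ.map_comp, N.map₂_eq_post_pre _ _ (Φ.map r),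
    ← post₂_comp]

theorem post₂ {a₁ a₂ c c' : M.C} (r : c ⟶ c') (f : M.Hom₂ a₁ a₂ c) :
    I.ext₂ (M.map₂ (𝟙 _) (𝟙 _) r f) = N.map₂ (𝟙 _) (𝟙 _) (Φ.map r) (I.ext₂ f) := by
  rw [nat₂, Φ.map_id, Φ.map_id]

theorem pre₂₁ {a₁ a₂ c a₁' : M.C} (p₁ : a₁' ⟶ a₁) (f : M.Hom₂ a₁ a₂ c) :
    I.ext₂ (M.map₂ p₁ (𝟙 _) (𝟙 _) f) = N.map₂ (Φ.map p₁) (𝟙 _) (𝟙 _) (I.ext₂ f) := by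
  rw [nat₂, Φ.map_id, Φ.map_id]

theorem pre₂₂ {a₁ a₂ c a₂' : M.C} (p₂ : a₂' ⟶ a₂) (f : M.Hom₂ a₁ a₂ c) :
    I.ext₂ (M.map₂ (𝟙 _) p₂ (𝟙 _) f) = N.map₂ (𝟙 _) (Φ.map p₂) (𝟙 _) (I.ext₂ f) := by
  rw [nat₂, Φ.map_id, Φ.map_id]

/-- Dinaturality moves the unary part of `f` into `g`. What remains is substitution of `θ` itself,
the case that defines `ext₃`. -/
theorem map_comp₂₂₁ {a₁ a₂ b₁ b₂ c : M.C} (g : M.Hom₂ b₁ b₂ c) (f : M.Hom₂ a₁ a₂ b₁) :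
    I.ext₃ (M.comp₂₂₁ g f) = N.comp₂₂₁ (I.ext₂ g) (I.ext₂ f) := by
  obtain ⟨x, rfl⟩ := ((χ.θ_univ _ _).1 _).2 f
  dsimp only
  rw [← M.dinat₂₂₁, ext₃_comp, pre₂₁, N.dinat₂₂₁, ext₂_map]

theorem nat₃ {a₁ a₂ a₃ c a₁' a₂' a₃' c' : M.C} (p₁ : a₁' ⟶ a₁) (p₂ : a₂' ⟶ a₂) (p₃ : a₃' ⟶ a₃)
    (r : c ⟶ c') (f : M.Hom₃ a₁ a₂ a₃ c) :
    I.ext₃ (M.map₃ p₁ p₂ p₃ r f) =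
      N.map₃ (Φ.map p₁) (Φ.map p₂) (Φ.map p₃) (Φ.map r) (I.ext₃ f) := by
  obtain ⟨x, rfl⟩ := ((χ.θ_univ _ _).2.1 _ _).2 f
  dsimp only
  rw [← M.nat₂₂₁, map_comp₂₂₁, nat₂, nat₂, Φ.map_id, N.nat₂₂₁, ← map_comp₂₂₁]

theorem post₃ {a₁ a₂ a₃ c c' : M.C} (r : c ⟶ c') (f : M.Hom₃ a₁ a₂ a₃ c) :
    I.ext₃ (M.map₃ (𝟙 _) (𝟙 _) (𝟙 _) r f) = N.map₃ (𝟙 _) (𝟙 _) (𝟙 _) (Φ.map r) (I.ext₃ f) := by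
  rw [nat₃, Φ.map_id, Φ.map_id, Φ.map_id]

/-- Dinaturality and naturality reduce to `g = θ`, `f = θ`. There `θ ∘₂ θ = α ∘ (θ ∘₁ θ)` in `M`,
and the same relation for `T` is the field `assoc` of `I`. -/
theorem map_comp₂₂₂ {a₁ a₂ b₁ b₂ c : M.C} (g : M.Hom₂ b₁ b₂ c) (f : M.Hom₂ a₁ a₂ b₂) :
    I.ext₃ (M.comp₂₂₂ g f) = N.comp₂₂₂ (I.ext₂ g) (I.ext₂ f) := by
  obtain ⟨y, rfl⟩ := ((χ.θ_univ _ _).1 _).2 f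
  dsimp only
  rw [← M.dinat₂₂₂, ext₂_map, ← N.dinat₂₂₂, ← pre₂₂]
  obtain ⟨x, hx⟩ := ((χ.θ_univ _ _).1 _).2 (M.map₂ (𝟙 _) y (𝟙 _) g)
  dsimp only at hx
  rw [← hx, post₂₂₂, post₃, ext₂_map, post₂₂₂, ← assoc_spec, post₃, map_comp₂₂₁, ext₂_θ, ext₂_θ,
    I.assoc]

theorem map_comp₃₂₁ {a₁ a₂ b₁ b₂ b₃ c : M.C} (g : M.Hom₃ b₁ b₂ b₃ c) (f : M.Hom₂ a₁ a₂ b₁) :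
    I.ext₄ (M.comp₃₂₁ g f) = N.comp₃₂₁ (I.ext₃ g) (I.ext₂ f) := by
  obtain ⟨x, rfl⟩ := ((χ.θ_univ _ _).1 _).2 f
  dsimp only
  rw [← M.dinat₃₂₁, ext₄_comp, nat₃, Φ.map_id, Φ.map_id, Φ.map_id, N.dinat₃₂₁, ext₂_map]

theorem nat₄ {a₁ a₂ a₃ a₄ c a₁' a₂' a₃' a₄' c' : M.C} (p₁ : a₁' ⟶ a₁) (p₂ : a₂' ⟶ a₂)
    (p₃ : a₃' ⟶ a₃) (p₄ : a₄' ⟶ a₄) (r : c ⟶ c') (f : M.Hom₄ a₁ a₂ a₃ a₄ c) :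
    I.ext₄ (M.map₄ p₁ p₂ p₃ p₄ r f) =
      N.map₄ (Φ.map p₁) (Φ.map p₂) (Φ.map p₃) (Φ.map p₄) (Φ.map r) (I.ext₄ f) := by
  obtain ⟨x, rfl⟩ := ((χ.θ_univ _ _).2.2 _ _ _).2 f
  dsimp only
  rw [← M.nat₃₂₁, map_comp₃₂₁, nat₂, nat₃, Φ.map_id, N.nat₃₂₁, ← map_comp₃₂₁]

/-- Here and in the three results that follow, the ternary multimap is factored as a binary one `∘₁
θ`. An associativity or commutativity law, used in `M` and again in `N`, then expresses the
substitution by ones already treated. -/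
theorem map_comp₂₃₁ {a₁ a₂ a₃ b₁ b₂ c : M.C} (g : M.Hom₂ b₁ b₂ c) (f : M.Hom₃ a₁ a₂ a₃ b₁) :
    I.ext₄ (M.comp₂₃₁ g f) = N.comp₂₃₁ (I.ext₂ g) (I.ext₃ f) := by
  obtain ⟨f, rfl⟩ := ((χ.θ_univ _ _).2.1 _ _).2 f
  dsimp only
  rw [M.assoc₁₁, map_comp₃₂₁, map_comp₂₂₁, map_comp₂₂₁, N.assoc₁₁]

theorem map_comp₃₂₂ {a₁ a₂ b₁ b₂ b₃ c : M.C} (g : M.Hom₃ b₁ b₂ b₃ c) (f : M.Hom₂ a₁ a₂ b₂) :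
    I.ext₄ (M.comp₃₂₂ g f) = N.comp₃₂₂ (I.ext₃ g) (I.ext₂ f) := by
  obtain ⟨g, rfl⟩ := ((χ.θ_univ _ _).2.1 _ _).2 g
  dsimp only
  rw [← M.assoc₁₂, map_comp₂₃₁, map_comp₂₂₁, map_comp₂₂₂, N.assoc₁₂]

theorem map_comp₃₂₃ {a₁ a₂ b₁ b₂ b₃ c : M.C} (g : M.Hom₃ b₁ b₂ b₃ c) (f : M.Hom₂ a₁ a₂ b₃) :
    I.ext₄ (M.comp₃₂₃ g f) = N.comp₃₂₃ (I.ext₃ g) (I.ext₂ f) := by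
  obtain ⟨g, rfl⟩ := ((χ.θ_univ _ _).2.1 _ _).2 g
  dsimp only
  rw [M.comm₂₂, map_comp₃₂₁, map_comp₂₂₁, map_comp₂₂₂, N.comm₂₂]

theorem map_comp₂₃₂ {a₁ a₂ a₃ b₁ b₂ c : M.C} (g : M.Hom₂ b₁ b₂ c) (f : M.Hom₃ a₁ a₂ a₃ b₂) :
    I.ext₄ (M.comp₂₃₂ g f) = N.comp₂₃₂ (I.ext₂ g) (I.ext₃ f) := by
  obtain ⟨f, rfl⟩ := ((χ.θ_univ _ _).2.1 _ _).2 f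
  dsimp only
  rw [M.assoc₂₁, map_comp₃₂₂, map_comp₂₂₁, map_comp₂₂₂, N.assoc₂₁]

/-- After the reduction to `g = θ`, `f = u`, the claim is the field `η` of `I`; in the other input
it is the field `rho`. -/
theorem map_comp₂₀₁ {b₁ b₂ c : M.C} (g : M.Hom₂ b₁ b₂ c) (f : M.Hom₀ b₁) :
    Φ.map (M.comp₂₀₁ g f) = N.comp₂₀₁ (I.ext₂ g) (I.ext₀ f) := by
  obtain ⟨y, rfl⟩ := (χ.u_univ.1 _).2 f
  dsimp only
  rw [← M.dinat₂₀₁, ext₀_map, ← N.dinat₂₀₁, ← pre₂₁]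
  obtain ⟨x, hx⟩ := ((χ.θ_univ _ _).1 _).2 (M.map₂ y (𝟙 _) (𝟙 _) g)
  dsimp only at hx
  rw [← hx, post₂₀₁, ext₂_map, post₂₀₁, I.η, Φ.map_comp]
  rfl

theorem map_comp₂₀₂ {b₁ b₂ c : M.C} (g : M.Hom₂ b₁ b₂ c) (f : M.Hom₀ b₂) :
    Φ.map (M.comp₂₀₂ g f) = N.comp₂₀₂ (I.ext₂ g) (I.ext₀ f) := by
  obtain ⟨y, rfl⟩ := (χ.u_univ.1 _).2 f
  dsimp only
  rw [← M.dinat₂₀₂, ext₀_map, ← N.dinat₂₀₂, ← pre₂₂]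
  obtain ⟨x, hx⟩ := ((χ.θ_univ _ _).1 _).2 (M.map₂ (𝟙 _) y (𝟙 _) g)
  dsimp only at hx
  rw [← hx, post₂₀₂, ext₂_map, post₂₀₂, I.rho, Φ.map_comp]
  rfl

/-- Factoring `g` through `θ` turns nullary substitution into a ternary map into nullary
substitution into a binary one: by associativity in the first two inputs, by commutativity in the
third. -/
theorem map_comp₃₀₁ {b₁ b₂ b₃ c : M.C} (g : M.Hom₃ b₁ b₂ b₃ c) (f : M.Hom₀ b₁) :
    I.ext₂ (M.comp₃₀₁ g f) = N.comp₃₀₁ (I.ext₃ g) (I.ext₀ f) := by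
  obtain ⟨g, rfl⟩ := ((χ.θ_univ _ _).2.1 _ _).2 g
  dsimp only
  rw [← M.assoc₁₁_null, pre₂₁, map_comp₂₀₁ I, map_comp₂₂₁, N.assoc₁₁_null]

theorem map_comp₃₀₂ {b₁ b₂ b₃ c : M.C} (g : M.Hom₃ b₁ b₂ b₃ c) (f : M.Hom₀ b₂) :
    I.ext₂ (M.comp₃₀₂ g f) = N.comp₃₀₂ (I.ext₃ g) (I.ext₀ f) := by
  obtain ⟨g, rfl⟩ := ((χ.θ_univ _ _).2.1 _ _).2 g
  dsimp only
  rw [← M.assoc₁₂_null, pre₂₁, map_comp₂₀₂ I, map_comp₂₂₁, N.assoc₁₂_null]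

theorem map_comp₃₀₃ {b₁ b₂ b₃ c : M.C} (g : M.Hom₃ b₁ b₂ b₃ c) (f : M.Hom₀ b₃) :
    I.ext₂ (M.comp₃₀₃ g f) = N.comp₃₀₃ (I.ext₃ g) (I.ext₀ f) := by
  obtain ⟨g, rfl⟩ := ((χ.θ_univ _ _).2.1 _ _).2 g
  dsimp only
  rw [M.comm₂₀, post₂, map_comp₂₀₂ I, map_comp₂₂₁, N.comm₂₀]

/-- The morphism of short multicategories that sends the classifiers of `M` to their images. -/
noncomputable def morphism : Morphism M N where
  functor := Φ
  F₀ f := I.ext₀ f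
  F₂ f := I.ext₂ f
  F₃ f := I.ext₃ f
  F₄ f := I.ext₄ f
  nat₀ := I.nat₀
  nat₂ := I.nat₂
  nat₃ := I.nat₃
  nat₄ := I.nat₄
  map_comp₂₂₁ := I.map_comp₂₂₁
  map_comp₂₂₂ := I.map_comp₂₂₂
  map_comp₃₂₁ := I.map_comp₃₂₁
  map_comp₃₂₂ := I.map_comp₃₂₂
  map_comp₃₂₃ := I.map_comp₃₂₃
  map_comp₂₃₁ := I.map_comp₂₃₁
  map_comp₂₃₂ := I.map_comp₂₃₂
  map_comp₂₀₁ := I.map_comp₂₀₁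
  map_comp₂₀₂ := I.map_comp₂₀₂
  map_comp₃₀₁ := I.map_comp₃₀₁
  map_comp₃₀₂ := I.map_comp₃₀₂
  map_comp₃₀₃ := I.map_comp₃₀₃

end Images

/-! ### Fullness of `K`: a lax monoidal functor supplies images of the classifiers. -/

section lax

variable {χ ψ}

/-- The images of the classifiers under a functor with maps `f₀` and `f₂` that satisfy the laws of a
lax monoidal functor. -/
def Images.ofLax (Φ : M.C ⥤ N.C) (f₀ : ψ.unit ⟶ Φ.obj χ.unit)
    (f₂ : ∀ a b : M.C, ψ.tensor (Φ.obj a) (Φ.obj b) ⟶ Φ.obj (χ.tensor a b))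
    (hnat : ∀ {a a' b b' : M.C} (p : a ⟶ a') (q : b ⟶ b'),
      ψ.tensorHom (Φ.map p) (Φ.map q) ≫ f₂ a' b' = f₂ a b ≫ Φ.map (χ.tensorHom p q))
    (hα : ∀ a b c : M.C, ψ.tensorHom (f₂ a b) (𝟙 (Φ.obj c)) ≫ f₂ (χ.tensor a b) c ≫
        Φ.map (χ.assoc a b c) =
      ψ.assoc _ _ _ ≫ ψ.tensorHom (𝟙 (Φ.obj a)) (f₂ b c) ≫ f₂ a (χ.tensor b c))
    (hlam : ∀ a : M.C, ψ.tensorHom f₀ (𝟙 (Φ.obj a)) ≫ f₂ χ.unit a ≫ Φ.map (χ.lam a) = ψ.lam _)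
    (hrho : ∀ a : M.C, ψ.rho (Φ.obj a) ≫ ψ.tensorHom (𝟙 _) f₀ ≫ f₂ a χ.unit = Φ.map (χ.rho a)) :
    χ.Images Φ where
  V := N.map₀ f₀ ψ.u
  T a b := N.map₂ (𝟙 _) (𝟙 _) (f₂ a b) (ψ.θ _ _)
  nat {a a' b b'} p q := by
    rw [← post₂_comp, ← hnat, post₂_comp, tensorHom_spec, post₂_pre]
  assoc a b c := by
    -- The associativity law of a lax functor is applied to the ternary classifier of `N`; each
    -- tensor factor is then absorbed into the binary classifiers.
    have h := congrArg (fun x => N.map₃ (𝟙 _) (𝟙 _) (𝟙 _) x (ψ.θ₃ _ _ _)) (hα a b c)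
    unfold θ₃ at h
    rw [post₃_comp, post₃_comp, tensor_comp₂₂₁, N.map₃_id, ← post₂₂₁, post₃_comp, post₃_comp,
      assoc_spec, tensor_comp₂₂₂, N.map₃_id, ← post₂₂₂] at h
    exact h
  η a := by
    have t := ψ.tensor_comp₂₀₁ f₀ (𝟙 (Φ.obj a)) ψ.u
    rw [Category.id_comp] at t
    -- The unit law of a lax functor concerns `λ`, while the claim concerns `η`. It shows that the
    -- map in question is a section of `Φ λ`; since `λ` is invertible with inverse `η`, this section
    -- must be `Φ η`.
    have e : N.comp₂₀₁ (N.map₂ (𝟙 _) (𝟙 _) (f₂ χ.unit a) (ψ.θ _ _)) (N.map₀ f₀ ψ.u) ≫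
        Φ.map (χ.lam a) = 𝟙 _ := by
      refine Eq.trans ?_ (ψ.lam_spec (Φ.obj a))
      rw [← hlam]
      unfold Classifiers.η
      rw [reassoc_of% t, post₂₀₁, Category.assoc]
    have l : Φ.map (χ.lam a) ≫ Φ.map (χ.η a) = 𝟙 _ := by rw [← Φ.map_comp, lam_η, Φ.map_id]
    rw [← Category.comp_id (N.comp₂₀₁ _ _), ← l, reassoc_of% e]
  rho a := by
    have t := ψ.tensor_comp₂₀₂ (𝟙 (Φ.obj a)) f₀ ψ.u
    rw [Category.id_comp] at t
    rw [← hrho]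
    unfold Classifiers.rho
    rw [reassoc_of% t, post₂₀₂]

/-- The images of the classifiers under a lax monoidal functor. -/
noncomputable def imagesOfLax
    (F : SkewMonoidalCategory.LaxFunctor χ.skewMonoidal ψ.skewMonoidal) :
    χ.Images (M := M) (N := N) F.functor :=
  Images.ofLax (ψ := ψ) F.functor F.f₀ F.f₂ F.f₂_nat F.map_α F.map_lam F.map_rho

/-- The extension sends `u` to `f₀ ∘ u` and `θ` to `f₂ ∘ θ`, so universality of the classifiers of
`N` returns `f₀` and `f₂`. -/
theorem laxFunctor_surjective
    (F : SkewMonoidalCategory.LaxFunctor χ.skewMonoidal ψ.skewMonoidal) :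
    ∃ G : Morphism M N, χ.laxFunctor ψ G = F := by
  refine ⟨(imagesOfLax F).morphism, ?_⟩
  refine SkewMonoidalCategory.LaxFunctor.ext_of rfl (heq_of_eq ?_) (heq_of_eq ?_)
  · refine ψ.hom_ext₀ ((ψ.lift₀_spec _).trans ?_)
    have h := (imagesOfLax F).ext₀_map (𝟙 χ.unit)
    rw [M.map₀_id] at h
    refine h.trans (Eq.trans ?_ (N.map₀_id _))
    exact congrArg (fun x => N.map₀ x _) (F.functor.map_id _)
  · funext a b
    exact ψ.hom_ext₂ ((ψ.lift₂_spec _).trans ((imagesOfLax F).ext₂_θ a b))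

end lax

end Classifiers

end ShortMulticategory

section functorK

variable (χ : ∀ M : LeftRepShortMulticategory.{v, u}, M.obj.Classifiers)

instance functorK_faithful : (functorK χ).Faithful where
  map_injective {M N} _ _ h :=
    ObjectProperty.hom_ext _ ((χ M).laxFunctor_injective (χ N)
      (congrArg (fun H => H.hom) h))

instance functorK_full : (functorK χ).Full where
  map_surjective {M N} F := by
    obtain ⟨G, hG⟩ := ShortMulticategory.Classifiers.laxFunctor_surjective F.hom
    exact ⟨ObjectProperty.homMk G, ObjectProperty.hom_ext _ hG⟩

end functorK

/-! ### The functor `U_lr` is full and faithful -/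

namespace Multicategory

variable {M N : Multicategory.{v, u}}

/-- All contexts are free up to propositional equality, because `List.map` commutes with `++` only
propositionally and the images of lists under an object map must also fit. -/
theorem subst_assoc_of_eq (M : Multicategory.{v, u}) {l r l' r' L R Θ Φ Γ Ψ Ξ Λ : List M.Obj}
    {b c d : M.Obj} {hΘ : Θ = l ++ c :: r} {hΦ : Φ = l' ++ b :: r'} {hΨ : Ψ = l' ++ Γ ++ r'}
    {hΞ : Ξ = l ++ Ψ ++ r} {hΛ : Λ = l ++ Φ ++ r} {hΛ' : Λ = L ++ b :: R} {hΞ' : Ξ = L ++ Γ ++ R}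
    (hL : L = l ++ l') (hR : R = r' ++ r)
    (h : M.Hom Θ d) (g : M.Hom Φ c) (f : M.Hom Γ b) :
    M.subst l r hΘ hΞ h (M.subst l' r' hΦ hΨ g f) =
      M.subst L R hΛ' hΞ' (M.subst l r hΘ hΛ h g) f := by
  subst hL hR hΛ
  exact M.subst_assoc h g f

theorem subst_comm_of_eq (M : Multicategory.{v, u}) (l m r : List M.Obj)
    {L R L' R' Θ Γ Δ Ξ Φ Φ' : List M.Obj} {b c d : M.Obj}
    {hΘ : Θ = l ++ b :: R} {hΘ' : Θ = L' ++ c :: r}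
    {hΦ : Φ = l ++ Γ ++ R} {hΦ' : Φ = L ++ c :: r} {hΞ : Ξ = L ++ Δ ++ r}
    {hΛ : Φ' = L' ++ Δ ++ r} {hΛ' : Φ' = l ++ b :: R'} {hΞ' : Ξ = l ++ Γ ++ R'}
    (hL : L = l ++ Γ ++ m) (hR : R = m ++ c :: r) (hL' : L' = l ++ b :: m) (hR' : R' = m ++ Δ ++ r)
    (h : M.Hom Θ d) (g : M.Hom Γ b) (f : M.Hom Δ c) :
    M.subst L r hΦ' hΞ (M.subst l R hΘ hΦ h g) f =
      M.subst l R' hΛ' hΞ' (M.subst L' r hΘ' hΛ h f) g := by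
  subst hL hR hL' hR'
  exact M.subst_comm l m r hΘ hΞ hΦ hΛ h g f

/-! ### Extension of a short morphism to all arities. -/

/-- The part of a morphism of short multicategories from which its extension to multimaps of all
arities is built. -/
structure ShortMap (M N : Multicategory.{v, u}) where
  obj : M.Obj → N.Obj
  F₀ {c : M.Obj} : M.Hom [] c → N.Hom [] (obj c)
  F₁ {a c : M.Obj} : M.Hom [a] c → N.Hom [obj a] (obj c)
  F₂ {a b c : M.Obj} : M.Hom [a, b] c → N.Hom [obj a, obj b] (obj c)
  F₃ {a b c d : M.Obj} : M.Hom [a, b, c] d → N.Hom [obj a, obj b, obj c] (obj d)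
  map_post₀ {c d : M.Obj} (r : M.Hom [c] d) (f : M.Hom [] c) :
    F₀ (M.post r f) = N.post (F₁ r) (F₀ f)
  map_post₁ {a c d : M.Obj} (r : M.Hom [c] d) (f : M.Hom [a] c) :
    F₁ (M.post r f) = N.post (F₁ r) (F₁ f)
  map_post₂ {a b c d : M.Obj} (r : M.Hom [c] d) (f : M.Hom [a, b] c) :
    F₂ (M.post r f) = N.post (F₁ r) (F₂ f)
  map_pre₁ {a b a' c : M.Obj} (f : M.Hom [a, b] c) (p : M.Hom [a'] a) :
    F₂ (M.subst (Ξ := [a', b]) [] [b] rfl rfl f p) =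
      N.subst (Ξ := [obj a', obj b]) [] [obj b] rfl rfl (F₂ f) (F₁ p)
  map_pre₂ {a b b' c : M.Obj} (f : M.Hom [a, b] c) (p : M.Hom [b'] b) :
    F₂ (M.subst (Ξ := [a, b']) [a] [] rfl rfl f p) =
      N.subst (Ξ := [obj a, obj b']) [obj a] [] rfl rfl (F₂ f) (F₁ p)
  map_comp₂₀₁ {a b c : M.Obj} (f : M.Hom [a, b] c) (p : M.Hom [] a) :
    F₁ (M.subst (Ξ := [b]) [] [b] rfl rfl f p) =
      N.subst (Ξ := [obj b]) [] [obj b] rfl rfl (F₂ f) (F₀ p)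
  map_comp₂₀₂ {a b c : M.Obj} (f : M.Hom [a, b] c) (p : M.Hom [] b) :
    F₁ (M.subst (Ξ := [a]) [a] [] rfl rfl f p) =
      N.subst (Ξ := [obj a]) [obj a] [] rfl rfl (F₂ f) (F₀ p)
  map_comp₂₂₁ {a b x y c : M.Obj} (f : M.Hom [a, b] c) (p : M.Hom [x, y] a) :
    F₃ (M.subst (Ξ := [x, y, b]) [] [b] rfl rfl f p) =
      N.subst (Ξ := [obj x, obj y, obj b]) [] [obj b] rfl rfl (F₂ f) (F₂ p)
  map_comp₂₂₂ {a b x y c : M.Obj} (f : M.Hom [a, b] c) (p : M.Hom [x, y] b) :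
    F₃ (M.subst (Ξ := [a, x, y]) [a] [] rfl rfl f p) =
      N.subst (Ξ := [obj a, obj x, obj y]) [obj a] [] rfl rfl (F₂ f) (F₂ p)

/-- A choice of left universal binary map classifiers in a multicategory. -/
structure BinaryClassifiers (M : Multicategory.{v, u}) where
  tensor : M.Obj → M.Obj → M.Obj
  θ (a b : M.Obj) : M.Hom [a, b] (tensor a b)
  univ (a b : M.Obj) (Γ : List M.Obj) (d : M.Obj) :
    Function.Bijective fun g : M.Hom (tensor a b :: Γ) d =>
      M.subst (Ξ := a :: b :: Γ) [] Γ rfl rfl g (θ a b)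

theorem IsLeftRepresentable.nonempty_binaryClassifiers (h : M.IsLeftRepresentable) :
    Nonempty M.BinaryClassifiers := by
  choose m θ hθ using fun a b => h [a, b]
  exact ⟨⟨m, θ, fun a b Γ d => (hθ a b).2 Γ d⟩⟩

namespace BinaryClassifiers

variable (χ : M.BinaryClassifiers)

/-- The multimap `g` with `g ∘₁ θ = f`. -/
noncomputable def lift {a b : M.Obj} {Γ : List M.Obj} {d : M.Obj} (f : M.Hom (a :: b :: Γ) d) :
    M.Hom (χ.tensor a b :: Γ) d :=
  ((χ.univ a b Γ d).2 f).choose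

theorem lift_spec {a b : M.Obj} {Γ : List M.Obj} {d : M.Obj} (f : M.Hom (a :: b :: Γ) d) :
    M.subst (Ξ := a :: b :: Γ) [] Γ rfl rfl (χ.lift f) (χ.θ a b) = f :=
  ((χ.univ a b Γ d).2 f).choose_spec

theorem lift_subst {a b : M.Obj} {Γ : List M.Obj} {d : M.Obj} (g : M.Hom (χ.tensor a b :: Γ) d) :
    χ.lift (M.subst (Ξ := a :: b :: Γ) [] Γ rfl rfl g (χ.θ a b)) = g :=
  (χ.univ a b Γ d).1 (χ.lift_spec _)

theorem exists_post {a b d : M.Obj} (f : M.Hom [a, b] d) :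
    ∃ g, M.post g (χ.θ a b) = f :=
  ⟨χ.lift f, χ.lift_spec f⟩

end BinaryClassifiers

namespace ShortMap

variable (F : ShortMap M N) (χ : M.BinaryClassifiers)

/-- The extension of a short map to multimaps with at least one input. -/
noncomputable def extCons : ∀ (Γ : List M.Obj) {x b : M.Obj}, M.Hom (x :: Γ) b →
    N.Hom (F.obj x :: Γ.map F.obj) (F.obj b)
  | [], _, _, f => F.F₁ f
  | a :: Γ, x, _, f =>
    N.subst (Ξ := F.obj x :: F.obj a :: Γ.map F.obj) [] (Γ.map F.obj) rfl rfl
      (extCons Γ (χ.lift f)) (F.F₂ (χ.θ x a))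

/-- The extension of a short map to all multimaps. -/
noncomputable def ext : ∀ {Γ : List M.Obj} {b : M.Obj}, M.Hom Γ b →
    N.Hom (Γ.map F.obj) (F.obj b)
  | [], _, f => F.F₀ f
  | _ :: Γ, _, f => F.extCons χ Γ f

theorem ext_θ {x a b : M.Obj} {Γ : List M.Obj} (g : M.Hom (χ.tensor x a :: Γ) b) :
    F.ext χ (M.subst (Ξ := x :: a :: Γ) [] Γ rfl rfl g (χ.θ x a)) =
      N.subst (Ξ := F.obj x :: F.obj a :: Γ.map F.obj) [] (Γ.map F.obj) rfl rfl
        (F.ext χ g) (F.F₂ (χ.θ x a)) := by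
  simp only [ext, extCons]
  rw [χ.lift_subst]

/-- Induction on the number of further inputs. Writing `f = g ∘₁ θ` and `θ ∘₁ p = q ∘ θ` with `q`
unary gives `f ∘₁ p = (g ∘₁ q) ∘₁ θ`, and `g` has one input fewer. -/
theorem ext_pre {Γ : List M.Obj} {x y b : M.Obj} (f : M.Hom (x :: Γ) b) (p : M.Hom [y] x) :
    F.ext χ (M.subst (Ξ := y :: Γ) [] Γ rfl rfl f p) =
      N.subst (Ξ := F.obj y :: Γ.map F.obj) [] (Γ.map F.obj) rfl rfl (F.ext χ f) (F.F₁ p) := by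
  induction Γ generalizing x y with
  | nil => exact F.map_post₁ f p
  | cons a Γ ih =>
    -- `q` is the tensor product of `p` with the identity of `a`.
    obtain ⟨q, hq⟩ := χ.exists_post (M.subst (Ξ := [y, a]) [] [a] rfl rfl (χ.θ x a) p)
    have e : M.subst (Ξ := y :: a :: Γ) [] (a :: Γ) rfl rfl f p =
        M.subst (Ξ := y :: a :: Γ) [] Γ rfl rfl
          (M.subst (Ξ := χ.tensor y a :: Γ) [] Γ rfl rfl (χ.lift f) q) (χ.θ y a) := by
      rw [M.subst_dinat (Θ := χ.tensor x a :: Γ) rfl rfl, hq]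
      conv_lhs => rw [← χ.lift_spec f]
      refine Eq.symm ?_
      exact M.subst_assoc _ _ _
    rw [e, ext_θ, ih, N.subst_dinat (Θ := F.obj (χ.tensor x a) :: Γ.map F.obj) rfl rfl,
      ← F.map_post₂, hq, F.map_pre₁]
    conv_rhs => rw [← χ.lift_spec f, ext_θ]
    exact N.subst_assoc _ _ _

/-- With `h = q ∘ θ` this splits into the unary substitution of `q` (`ext_pre`) and the defining
case `θ`. -/
theorem ext_binary {Γ : List M.Obj} {x y z b : M.Obj} (f : M.Hom (x :: Γ) b)
    (h : M.Hom [y, z] x) :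
    F.ext χ (M.subst (Ξ := y :: z :: Γ) [] Γ rfl rfl f h) =
      N.subst (Ξ := F.obj y :: F.obj z :: Γ.map F.obj) [] (Γ.map F.obj) rfl rfl (F.ext χ f)
        (F.F₂ h) := by
  obtain ⟨q, rfl⟩ := χ.exists_post h
  rw [← M.subst_dinat (Θ := x :: Γ) (Θ' := χ.tensor y z :: Γ) (hΘ' := rfl) (hΘ'' := rfl) rfl rfl,
    ext_θ, ext_pre, F.map_post₂]
  exact N.subst_dinat rfl rfl

/-- If `f = g ∘₁ θ`, then `f ∘₁ h = g ∘₁ (θ ∘₁ h)`, and `θ ∘₁ h` is unary. No nullary classifier is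
required. -/
theorem ext_nullary {Γ : List M.Obj} {x b : M.Obj} (f : M.Hom (x :: Γ) b)
    (h : M.Hom [] x) :
    F.ext χ (M.subst (Ξ := Γ) [] Γ rfl rfl f h) =
      N.subst (Ξ := Γ.map F.obj) [] (Γ.map F.obj) rfl rfl (F.ext χ f) (F.F₀ h) := by
  match Γ, f with
  | [], f => exact F.map_post₀ f h
  | a :: Γ, f =>
    have e : M.subst (Ξ := a :: Γ) [] (a :: Γ) rfl rfl f h =
        M.subst (Ξ := a :: Γ) [] Γ rfl rfl (χ.lift f)
          (M.subst (Ξ := [a]) [] [a] rfl rfl (χ.θ x a) h) := by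
      conv_lhs => rw [← χ.lift_spec f]
      refine Eq.symm ?_
      exact M.subst_assoc _ _ _
    rw [e, ext_pre, F.map_comp₂₀₁]
    conv_rhs => rw [← χ.lift_spec f, ext_θ]
    exact N.subst_assoc _ _ _

/-- Here the induction is on the arity of `h`: if `h = k ∘₁ θ`, then `f ∘₁ h = (f ∘₁ k) ∘₁ θ`, where
`k` has one input fewer and the outer substitution is binary. -/
theorem ext_subst_first {Γ Δ : List M.Obj} {x b : M.Obj} (f : M.Hom (x :: Γ) b)
    (h : M.Hom Δ x) :
    F.ext χ (M.subst (Ξ := Δ ++ Γ) [] Γ rfl rfl f h) =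
      N.subst [] (Γ.map F.obj) rfl (by simp) (F.ext χ f) (F.ext χ h) := by
  match Δ, h with
  | [], h => exact F.ext_nullary χ f h
  | y :: Δ, h =>
    induction Δ generalizing y with
    | nil => exact F.ext_pre χ f h
    | cons a Δ ih =>
      have e : M.subst (Ξ := y :: a :: (Δ ++ Γ)) [] Γ rfl rfl f h =
          M.subst (Ξ := y :: a :: (Δ ++ Γ)) [] (Δ ++ Γ) rfl rfl
            (M.subst (Ξ := χ.tensor y a :: (Δ ++ Γ)) [] Γ rfl rfl f (χ.lift h)) (χ.θ y a) := by
        conv_lhs => rw [← χ.lift_spec h]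
        exact M.subst_assoc _ _ _
      refine (congrArg (F.ext χ) e).trans ?_
      rw [ext_binary]
      have ih' := ih (χ.tensor y a) (χ.lift h)
      conv_rhs => rw [← χ.lift_spec h, ext_θ]
      refine (congrArg (fun k => N.subst _ _ _ _ k _) ih').trans (Eq.symm ?_)
      exact N.subst_assoc_of_eq rfl (by simp) _ _ _

theorem ext_eq_F₂ {a b c : M.Obj} (f : M.Hom [a, b] c) : F.ext χ f = F.F₂ f := by
  obtain ⟨g, rfl⟩ := χ.exists_post f
  exact (F.ext_θ χ g).trans (F.map_post₂ g _).symm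

theorem ext_eq_F₃ {a b c d : M.Obj} (f : M.Hom [a, b, c] d) : F.ext χ f = F.F₃ f := by
  rw [← χ.lift_spec f, ext_θ, ext_eq_F₂, F.map_comp₂₂₁]
  rfl

/-- A short map carries no quaternary component. This form is the one that compatibility of a
morphism with ternary-binary substitution compares with `F₄`. -/
theorem ext_quaternary {a b c d e : M.Obj} (f : M.Hom [a, b, c, d] e) :
    F.ext χ f =
      N.subst (Ξ := [F.obj a, F.obj b, F.obj c, F.obj d]) [] [F.obj c, F.obj d] rfl rfl
        (F.F₃ (χ.lift f)) (F.F₂ (χ.θ a b)) := by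
  conv_lhs => rw [← χ.lift_spec f, ext_θ, ext_eq_F₃]
  rfl

/-- If `f = g ∘₁ θ`, then `f ∘₂ h = g ∘₁ (θ ∘₂ h)`: a first-input substitution of a ternary
multimap, on which the extension is `F₃`. -/
theorem ext_subst_second_binary {Γ : List M.Obj} {x y z w b : M.Obj} (f : M.Hom (y :: x :: Γ) b)
    (h : M.Hom [z, w] x) :
    F.ext χ (M.subst (Ξ := y :: z :: w :: Γ) [y] Γ rfl rfl f h) =
      N.subst (Ξ := F.obj y :: F.obj z :: F.obj w :: Γ.map F.obj) [F.obj y] (Γ.map F.obj) rfl rfl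
        (F.ext χ f) (F.F₂ h) := by
  have e : M.subst (Ξ := y :: z :: w :: Γ) [y] Γ rfl rfl f h =
      M.subst (Ξ := [y, z, w] ++ Γ) [] Γ rfl rfl (χ.lift f)
        (M.subst (Ξ := [y, z, w]) [y] [] rfl rfl (χ.θ y x) h) := by
    conv_lhs => rw [← χ.lift_spec f]
    refine Eq.symm ?_
    exact M.subst_assoc _ _ _
  refine (congrArg (F.ext χ) e).trans ?_
  rw [ext_subst_first, ext_eq_F₃, F.map_comp₂₂₂]
  conv_rhs => rw [← χ.lift_spec f, ext_θ]
  exact N.subst_assoc _ _ _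

theorem ext_subst_second {Γ Δ : List M.Obj} {x y b : M.Obj} (f : M.Hom (y :: x :: Γ) b)
    (h : M.Hom Δ x) :
    F.ext χ (M.subst (Ξ := y :: (Δ ++ Γ)) [y] Γ rfl rfl f h) =
      N.subst [F.obj y] (Γ.map F.obj) rfl (by simp) (F.ext χ f) (F.ext χ h) := by
  match Δ, h with
  | [], h =>
    have e : M.subst (Ξ := y :: Γ) [y] Γ rfl rfl f h =
        M.subst (Ξ := y :: Γ) [] Γ rfl rfl (χ.lift f)
          (M.subst (Ξ := [y]) [y] [] rfl rfl (χ.θ y x) h) := by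
      conv_lhs => rw [← χ.lift_spec f]
      refine Eq.symm ?_
      exact M.subst_assoc _ _ _
    refine (congrArg (F.ext χ) e).trans ?_
    rw [ext_pre, F.map_comp₂₀₂]
    conv_rhs => rw [← χ.lift_spec f, ext_θ]
    exact N.subst_assoc _ _ _
  | [w], h =>
    have e : M.subst (Ξ := y :: w :: Γ) [y] Γ rfl rfl f h =
        M.subst (Ξ := y :: w :: Γ) [] Γ rfl rfl (χ.lift f)
          (M.subst (Ξ := [y, w]) [y] [] rfl rfl (χ.θ y x) h) := by
      conv_lhs => rw [← χ.lift_spec f]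
      refine Eq.symm ?_
      exact M.subst_assoc _ _ _
    refine (congrArg (F.ext χ) e).trans ?_
    rw [ext_binary, F.map_pre₂]
    conv_rhs => rw [← χ.lift_spec f, ext_θ]
    exact N.subst_assoc _ _ _
  -- For arity at most one the classifier is peeled off `f`. From arity two on it is peeled off `h`,
  -- which shortens the list by one and leaves a binary substitution in the second input.
  | w :: z :: Δ, h =>
    have ih := ext_subst_second f (χ.lift h)
    have e : M.subst (Ξ := y :: w :: z :: (Δ ++ Γ)) [y] Γ rfl rfl f h =
        M.subst (Ξ := y :: w :: z :: (Δ ++ Γ)) [y] (Δ ++ Γ) rfl rfl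
          (M.subst (Ξ := y :: χ.tensor w z :: (Δ ++ Γ)) [y] Γ rfl rfl f (χ.lift h)) (χ.θ w z) := by
      conv_lhs => rw [← χ.lift_spec h]
      exact M.subst_assoc _ _ _
    refine (congrArg (F.ext χ) e).trans ?_
    rw [ext_subst_second_binary]
    conv_rhs => rw [← χ.lift_spec h, ext_θ]
    refine (congrArg (fun k => N.subst _ _ _ _ k _) ih).trans (Eq.symm ?_)
    exact N.subst_assoc_of_eq rfl (by simp) _ _ _
termination_by Δ.length

/-- When at least two inputs precede the place of substitution, `f = g ∘₁ θ` with `θ` on the first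
two. Commutativity lets `h` be substituted into `g`, one place further left. The base cases are the
first and second inputs. -/
theorem ext_subst (l : List M.Obj) {Γ Δ : List M.Obj} {x b : M.Obj} (f : M.Hom (l ++ x :: Γ) b)
    (h : M.Hom Δ x) :
    F.ext χ (M.subst (Ξ := l ++ (Δ ++ Γ)) l Γ rfl (by simp) f h) =
      N.subst (l.map F.obj) (Γ.map F.obj) (by simp) (by simp) (F.ext χ f) (F.ext χ h) := by
  match l, f with
  | [], f => exact F.ext_subst_first χ f h
  | [y], f => exact F.ext_subst_second χ f h
  | y :: z :: l, f =>
    have ih := ext_subst (χ.tensor y z :: l) (χ.lift f) h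
    have e : M.subst (Ξ := y :: z :: (l ++ (Δ ++ Γ))) (y :: z :: l) Γ rfl (by simp) f h =
        M.subst (Ξ := y :: z :: (l ++ (Δ ++ Γ))) [] (l ++ (Δ ++ Γ)) rfl rfl
          (M.subst (Ξ := χ.tensor y z :: (l ++ (Δ ++ Γ))) (χ.tensor y z :: l) Γ rfl (by simp)
            (χ.lift f) h) (χ.θ y z) := by
      conv_lhs => rw [← χ.lift_spec f]
      exact M.subst_comm_of_eq [] l Γ (Γ := [y, z]) (Δ := Δ) rfl rfl rfl (List.append_assoc _ _ _).symm _ _ _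
    refine (congrArg (F.ext χ) e).trans ?_
    rw [ext_θ]
    conv_rhs => rw [← χ.lift_spec f, ext_θ]
    refine (congrArg (fun k => N.subst _ _ _ _ k _) ih).trans (Eq.symm ?_)
    refine N.subst_comm_of_eq [] (l.map F.obj) (Γ.map F.obj) (Γ := [F.obj y, F.obj z])
      (Δ := Δ.map F.obj) rfl ?_ rfl ?_ _ _ _ <;> simp
termination_by l.length

/-- The extension of a short map, as a multifunctor. -/
noncomputable def multifunctor (map_id : ∀ a : M.Obj, F.F₁ (M.id a) = N.id (F.obj a)) :
    Multifunctor M N where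
  obj := F.obj
  map f := F.ext χ f
  map_id := map_id
  map_comp l r Γ b c g f := by
    have h := F.ext_subst χ l g f
    have e : M.subst (Ξ := l ++ (Γ ++ r)) l r rfl (by simp) g f =
        castDom (H := M.Hom) (by simp) (M.comp l r g f) := rfl
    have e' : ∀ {Δ Δ' : List M.Obj} {b : M.Obj} (p : Δ = Δ') (k : M.Hom Δ b),
        F.ext χ (castDom (H := M.Hom) p k) =
          castDom (H := N.Hom) (congrArg (List.map F.obj) p) (F.ext χ k) := by
      intro Δ Δ' b p k
      subst p
      rfl
    rw [e, e', castDom_eq_iff] at h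
    rw [h]
    simp [subst]

/-- The short map underlying a morphism of short multicategories. -/
def ofMorphism (F : ShortMulticategory.Morphism M.toShort N.toShort) : ShortMap M N where
  obj := F.functor.obj
  F₀ f := F.F₀ f
  F₁ f := F.functor.map f
  F₂ f := F.F₂ f
  F₃ f := F.F₃ f
  map_post₀ r f := F.nat₀ r f
  map_post₁ r f := F.functor.map_comp f r
  map_post₂ {a b c d} r f := by
    -- In a short multicategory a unary map acts only through the simultaneous action on inputs and
    -- output, so the other variables are filled with identities on both sides.
    refine (congrArg F.F₂ (M.act₂_post r f).symm).trans ((F.nat₂ (𝟙 _) (𝟙 _) r f).trans ?_)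
    exact (congrArg₂ (fun p q => N.act₂ p q _ _) (F.functor.map_id a) (F.functor.map_id b)).trans
      (N.act₂_post _ _)
  map_pre₁ {a b a' c} f p := by
    refine (congrArg F.F₂ (M.act₂_pre₁ p f).symm).trans ((F.nat₂ p (𝟙 _) (𝟙 _) f).trans ?_)
    exact (congrArg₂ (fun q r => N.act₂ (F.functor.map p) q r (F.F₂ f)) (F.functor.map_id b) (F.functor.map_id c)).trans
      (N.act₂_pre₁ _ _)
  map_pre₂ {a b b' c} f p := by
    refine (congrArg F.F₂ (M.act₂_pre₂ p f).symm).trans ((F.nat₂ (𝟙 _) p (𝟙 _) f).trans ?_)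
    exact (congrArg₂ (fun q r => N.act₂ q (F.functor.map p) r (F.F₂ f)) (F.functor.map_id a) (F.functor.map_id c)).trans
      (N.act₂_pre₂ _ _)
  map_comp₂₀₁ f p := F.map_comp₂₀₁ f p
  map_comp₂₀₂ f p := F.map_comp₂₀₂ f p
  map_comp₂₂₁ f p := F.map_comp₂₂₁ f p
  map_comp₂₂₂ f p := F.map_comp₂₂₂ f p

end ShortMap

/-- The extension agrees with `F` by definition in arities 0 and 1, and by factoring through `θ` in
arities 2, 3 and 4. Only the source has to be left representable. -/
theorem toShort_surjective (hM : M.IsLeftRepresentable)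
    (F : ShortMulticategory.Morphism M.toShort N.toShort) :
    ∃ G : Multifunctor M N, G.toShort = F := by
  obtain ⟨χ⟩ := hM.nonempty_binaryClassifiers
  refine ⟨(ShortMap.ofMorphism F).multifunctor χ fun a => F.functor.map_id a, ?_⟩
  refine ShortMulticategory.Morphism.ext_of_functor rfl (fun f => HEq.rfl)
    (fun f => heq_of_eq ((ShortMap.ofMorphism F).ext_eq_F₂ χ f))
    (fun f => heq_of_eq ((ShortMap.ofMorphism F).ext_eq_F₃ χ f))
    (fun {a b c d e} f => heq_of_eq ?_)
  refine ((ShortMap.ofMorphism F).ext_quaternary χ f).trans ?_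
  refine (F.map_comp₃₂₁ (b₂ := c) (b₃ := d) (χ.lift (Γ := [c, d]) f) (χ.θ a b)).symm.trans ?_
  exact congrArg F.F₄ (χ.lift_spec (Γ := [c, d]) f)

/-- Agreement in arities 0, 1 and 2 suffices: a multimap with more inputs is `g ∘₁ θ`, and induction
on the number of inputs applies to `g`. -/
theorem toShort_injective (hM : M.IsLeftRepresentable) {G H : Multifunctor M N}
    (h : G.toShort = H.toShort) : G = H := by
  obtain ⟨χ⟩ := hM.nonempty_binaryClassifiers
  have h₀ : ∀ {c} (f : M.Hom [] c), HEq (G.map f) (H.map f) := fun f => by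
    change HEq (G.toShort.F₀ f) (H.toShort.F₀ f)
    rw [h]
  have h₁ : ∀ {a c} (f : M.Hom [a] c), HEq (G.map f) (H.map f) := fun {a c} f => by
    change HEq (G.toShort.functor.map (X := a) f) (H.toShort.functor.map (X := a) f)
    rw [h]
  have h₂ : ∀ {a b c} (f : M.Hom [a, b] c), HEq (G.map f) (H.map f) := fun f => by
    change HEq (G.toShort.F₂ f) (H.toShort.F₂ f)
    rw [h]
  have ho : G.obj = H.obj := congrArg (fun F => F.functor.obj) h
  obtain ⟨o, m, _, _⟩ := G
  obtain ⟨o', m', _, _⟩ := H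
  obtain rfl : o = o' := ho
  refine Multifunctor.ext_of rfl fun Γ b f => ?_
  match Γ, f with
  | [], f => exact h₀ f
  | x :: Γ, f =>
    induction Γ generalizing x with
    | nil => exact h₁ f
    | cons a Γ ih =>
      rw [← χ.lift_spec f, Multifunctor.map_subst, Multifunctor.map_subst,
        eq_of_heq (h₂ (χ.θ x a)), eq_of_heq (ih _ (χ.lift f))]

end Multicategory

instance functorUlr_faithful : functorUlr.{v, u}.Faithful where
  map_injective {M _} _ _ h :=
    ObjectProperty.hom_ext _ (Multicategory.toShort_injective M.property
      (congrArg (fun H => H.hom) h))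

instance functorUlr_full : functorUlr.{v, u}.Full where
  map_surjective {M N} F := by
    obtain ⟨G, hG⟩ := Multicategory.toShort_surjective M.property F.hom
    exact ⟨ObjectProperty.homMk G, ObjectProperty.hom_ext _ hG⟩

/-! ### The multicategory of a skew monoidal category -/

namespace SkewMonoidalCategory

variable (A : SkewMonoidalCategory.{v, u})

/-! ### Left bracketed products and their functoriality. -/

/-- The left bracketed tensor product `((x a₁) ⋯) aₙ`. -/
abbrev fold (x : A.C) : List A.C → A.C
  | [] => x
  | a :: Γ => fold (A.tensorObj x a) Γ

theorem fold_append (x : A.C) (Γ Δ : List A.C) :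
    A.fold x (Γ ++ Δ) = A.fold (A.fold x Γ) Δ := by
  induction Γ generalizing x with
  | nil => rfl
  | cons a Γ ih => exact ih _

variable {A}

theorem tensor_comp_id {a b c d : A.C} (f : a ⟶ b) (g : b ⟶ c) :
    A.tensorHom (f ≫ g) (𝟙 d) = A.tensorHom f (𝟙 d) ≫ A.tensorHom g (𝟙 d) := by
  rw [← A.tensor_comp, Category.comp_id]

theorem id_tensor_comp {a b c d : A.C} (f : a ⟶ b) (g : b ⟶ c) :
    A.tensorHom (𝟙 d) (f ≫ g) = A.tensorHom (𝟙 d) f ≫ A.tensorHom (𝟙 d) g := by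
  rw [← A.tensor_comp, Category.comp_id]

theorem tensor_exchange {a b c d : A.C} (f : a ⟶ b) (g : c ⟶ d) :
    A.tensorHom (𝟙 a) g ≫ A.tensorHom f (𝟙 d) = A.tensorHom f (𝟙 c) ≫ A.tensorHom (𝟙 b) g := by
  rw [← A.tensor_comp, ← A.tensor_comp]
  simp

/-- Functoriality of `A.fold x Γ` in `x`. -/
def foldMap : ∀ {x y : A.C} (_ : x ⟶ y) (Γ : List A.C), A.fold x Γ ⟶ A.fold y Γ
  | _, _, f, [] => f
  | _, _, f, a :: Γ => foldMap (A.tensorHom f (𝟙 a)) Γ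

theorem foldMap_cons {x y : A.C} (f : x ⟶ y) (a : A.C) (Γ : List A.C) :
    foldMap f (a :: Γ) = foldMap (A.tensorHom f (𝟙 a)) Γ := rfl

theorem foldMap_id (x : A.C) (Γ : List A.C) : foldMap (𝟙 x) Γ = 𝟙 _ := by
  induction Γ generalizing x with
  | nil => rfl
  | cons a Γ ih => exact (congrArg (foldMap · Γ) (A.tensor_id x a)).trans (ih _)

theorem foldMap_comp {x y z : A.C} (f : x ⟶ y) (g : y ⟶ z) (Γ : List A.C) :
    foldMap (f ≫ g) Γ = foldMap f Γ ≫ foldMap g Γ := by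
  induction Γ generalizing x y z with
  | nil => rfl
  | cons a Γ ih => exact (congrArg (foldMap · Γ) (tensor_comp_id f g)).trans (ih _ _)

theorem foldMap_eqToHom {x y : A.C} (h : x = y) (Γ : List A.C) :
    foldMap (eqToHom h) Γ = eqToHom (by rw [h]) := by
  subst h
  exact foldMap_id x Γ

/-- The canonical map induced by an equality of lists. -/
abbrev foldCast (x : A.C) {Γ Δ : List A.C} (h : Γ = Δ) : A.fold x Γ ⟶ A.fold x Δ :=
  eqToHom (by rw [h])

/-- The canonical map `fold x (Γ ++ Δ) ⟶ fold (fold x Γ) Δ`, with the list specified up to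
equality. -/
def split (x : A.C) {Λ Γ Δ : List A.C} (h : Λ = Γ ++ Δ) : A.fold x Λ ⟶ A.fold (A.fold x Γ) Δ :=
  eqToHom (by rw [h, fold_append])

theorem split_nat {x y : A.C} (f : x ⟶ y) {Λ Γ Δ : List A.C} (h : Λ = Γ ++ Δ) :
    foldMap f Λ ≫ split y h = split x h ≫ foldMap (foldMap f Γ) Δ := by
  subst h
  induction Γ generalizing x y with
  | nil => exact (Category.comp_id _).trans (Category.id_comp _).symm
  | cons a Γ ih => exact ih _

/-! ### Iterated forms of the skew monoidal axioms. -/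

/-- The iterated associator `fold (x y) Γ ⟶ x (fold y Γ)`. -/
def shift (x : A.C) : ∀ (y : A.C) (Γ : List A.C),
    A.fold (A.tensorObj x y) Γ ⟶ A.tensorObj x (A.fold y Γ)
  | _, [] => 𝟙 _
  | y, a :: Γ => foldMap (A.α x y a) Γ ≫ shift x (A.tensorObj y a) Γ

theorem shift_nat {x x' y y' : A.C} (f : x ⟶ x') (g : y ⟶ y') (Γ : List A.C) :
    foldMap (A.tensorHom f g) Γ ≫ shift x' y' Γ =
      shift x y Γ ≫ A.tensorHom f (foldMap g Γ) := by
  induction Γ generalizing y y' with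
  | nil => exact (Category.comp_id _).trans (Category.id_comp _).symm
  | cons a Γ ih =>
    simp only [foldMap_cons, shift]
    rw [← Category.assoc, ← foldMap_comp, A.α_nat, foldMap_comp, Category.assoc, ih, Category.assoc]

/-- Shifting `x` past a concatenation is shifting it past the two pieces in turn. `split` only
corrects the bracketing of `fold`, which is associative propositionally. -/
theorem shift_append (x y : A.C) {Λ Γ Δ : List A.C} (h : Λ = Γ ++ Δ) :
    shift x y Λ ≫ A.tensorHom (𝟙 x) (split y h) =
      split (A.tensorObj x y) h ≫ foldMap (shift x y Γ) Δ ≫ shift x (A.fold y Γ) Δ := by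
  subst h
  induction Γ generalizing y with
  | nil =>
    have e : foldMap (shift x y []) Δ = 𝟙 _ := foldMap_id _ _
    rw [e, Category.id_comp]
    refine (congrArg (_ ≫ ·) (A.tensor_id _ _)).trans ?_
    exact (Category.comp_id _).trans (Category.id_comp _).symm
  | cons a Γ ih =>
    have h := split_nat (A.α x y a) (rfl : Γ ++ Δ = Γ ++ Δ)
    have e : shift x y (a :: (Γ ++ Δ)) = foldMap (A.α x y a) (Γ ++ Δ) ≫
      shift x (A.tensorObj y a) (Γ ++ Δ) := rfl
    have e' : shift x y (a :: Γ) = foldMap (A.α x y a) Γ ≫ shift x (A.tensorObj y a) Γ := rfl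
    refine (congrArg (· ≫ _) e).trans ?_
    refine (Category.assoc _ _ _).trans ?_
    refine (congrArg (_ ≫ ·) (ih _)).trans ?_
    rw [reassoc_of% h, e', foldMap_comp, Category.assoc]
    rfl

/-- The pentagon with its last variable replaced by a list. Each entry of `Γ` costs one use of the
pentagon, with naturality of `shift` bringing the factors together. -/
theorem shift_pentagon (x y z : A.C) (Γ : List A.C) :
    foldMap (A.α x y z) Γ ≫ shift x (A.tensorObj y z) Γ ≫ A.tensorHom (𝟙 x) (shift y z Γ) =
      shift (A.tensorObj x y) z Γ ≫ A.α x y (A.fold z Γ) := by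
  induction Γ generalizing z with
  | nil =>
    simp only [shift, foldMap, fold, Category.id_comp]
    rw [A.tensor_id, Category.comp_id]
  | cons a Γ ih =>
    simp only [foldMap_cons, shift, Category.assoc]
    have p := congrArg (foldMap · Γ) (A.pentagon x y z a)
    simp only [foldMap_comp] at p
    refine Eq.trans ?_ (congrArg (_ ≫ ·) (ih _))
    rw [← reassoc_of% p, id_tensor_comp, reassoc_of% shift_nat]

/-- The canonical map `fold x Γ ⟶ x (fold i Γ)`. -/
def unshift (x : A.C) (Γ : List A.C) : A.fold x Γ ⟶ A.tensorObj x (A.fold A.unit Γ) :=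
  foldMap (A.rho x) Γ ≫ shift x A.unit Γ

theorem unshift_nat {x y : A.C} (f : x ⟶ y) (Γ : List A.C) :
    foldMap f Γ ≫ unshift y Γ = unshift x Γ ≫ A.tensorHom f (𝟙 _) := by
  unfold unshift
  rw [← Category.assoc, ← foldMap_comp, A.rho_nat, foldMap_comp, Category.assoc, shift_nat,
    foldMap_id, Category.assoc]

/-- `shift_pentagon` with the unit as third object, combined with the axiom relating `ρ` and `α`. -/
theorem unshift_α (x y : A.C) (Γ : List A.C) :
    unshift (A.tensorObj x y) Γ ≫ A.α x y _ =
      shift x y Γ ≫ A.tensorHom (𝟙 x) (unshift y Γ) := by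
  unfold unshift
  rw [Category.assoc, ← shift_pentagon, ← Category.assoc, ← foldMap_comp, A.rho_α,
    reassoc_of% shift_nat, ← id_tensor_comp]

theorem shift_lam (y : A.C) (Γ : List A.C) :
    shift A.unit y Γ ≫ A.lam _ = foldMap (A.lam y) Γ := by
  induction Γ generalizing y with
  | nil => exact Category.id_comp _
  | cons a Γ ih =>
    refine (Category.assoc _ _ _).trans ((congrArg (_ ≫ ·) (ih _)).trans ?_)
    rw [← foldMap_comp, A.α_lam]
    rfl

/-- The iterated associator followed by `λ` is `λ` on the innermost factor, where it cancels `ρ` by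
`λ_i ρ_i = 1`. This underlies the left identity law of the multicategory; the right one rests on
`unshift_singleton`, which is the triangle. -/
theorem unshift_lam (Γ : List A.C) : unshift A.unit Γ ≫ A.lam _ = 𝟙 _ := by
  unfold unshift
  rw [Category.assoc, shift_lam, ← foldMap_comp, A.rho_lam, foldMap_id]

theorem unshift_singleton (x a : A.C) :
    unshift x [a] ≫ A.tensorHom (𝟙 x) (A.lam a) = 𝟙 _ := by
  refine Eq.trans ?_ (A.triangle x a)
  simp only [unshift, shift, foldMap, fold, Category.comp_id, Category.assoc]

/-! ### Substitution and the multicategory laws. -/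

/-- Substitution of `f` into `g` after the inputs `x` and `l`. -/
def sub : ∀ (l : List A.C) (r : List A.C) {x : A.C} {Γ : List A.C} {b c : A.C}
    (_ : A.fold x (l ++ b :: r) ⟶ c) (_ : A.fold A.unit Γ ⟶ b), A.fold x (l ++ Γ ++ r) ⟶ c
  | [], r, x, Γ, _, _, g, f =>
    split x (rfl : Γ ++ r = Γ ++ r) ≫ foldMap (unshift x Γ ≫ A.tensorHom (𝟙 x) f) r ≫ g
  | _ :: l, r, _, _, _, _, g, f => sub l r g f

/-- Naturality in the base object. The base is kept arbitrary, although multimaps use only the unit,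
because earlier inputs are absorbed into it. -/
theorem sub_foldMap (l r : List A.C) {x y : A.C} {Γ : List A.C} {b c : A.C} (k : x ⟶ y)
    (g : A.fold y (l ++ b :: r) ⟶ c) (f : A.fold A.unit Γ ⟶ b) :
    sub l r (foldMap k (l ++ b :: r) ≫ g) f = foldMap k (l ++ Γ ++ r) ≫ sub l r g f := by
  induction l generalizing x y with
  | nil =>
    simp only [sub, List.nil_append]
    have h := split_nat k (rfl : Γ ++ r = Γ ++ r)
    rw [reassoc_of% h, foldMap_cons, ← Category.assoc (foldMap _ r), ← foldMap_comp,
      ← Category.assoc (foldMap _ r), ← foldMap_comp, Category.assoc, tensor_exchange,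
      reassoc_of% unshift_nat]
  | cons a l ih => exact ih _ _

theorem sub_split (Γ m r : List A.C) {x : A.C} {Δ : List A.C} {c d : A.C}
    (k : A.fold (A.fold x Γ) (m ++ c :: r) ⟶ d) (f : A.fold A.unit Δ ⟶ c) :
    sub (Γ ++ m) r (split x (by simp) ≫ k) f = split x (by simp) ≫ sub m r k f := by
  induction Γ generalizing x with
  | nil =>
    refine (congrArg (fun k => sub m r k f) (Category.id_comp k)).trans ?_
    exact (Category.id_comp _).symm
  | cons a Γ ih => exact ih _

/-- Once `l` is absorbed into the base, substituting `g` is precomposition with a map between base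
objects. It commutes with the later substitution by `sub_foldMap`. -/
theorem sub_comm (l m r : List A.C) {x : A.C} {Γ Δ : List A.C} {b c d : A.C}
    (h : A.fold x (l ++ b :: (m ++ c :: r)) ⟶ d) (g : A.fold A.unit Γ ⟶ b)
    (f : A.fold A.unit Δ ⟶ c) :
    foldCast x (Δ := l ++ Γ ++ m ++ Δ ++ r) (by simp) ≫
        sub (l ++ Γ ++ m) r (foldCast x (Δ := l ++ Γ ++ (m ++ c :: r)) (by simp) ≫
          sub l (m ++ c :: r) h g) f =
      sub l (m ++ Δ ++ r) (foldCast x (Δ := l ++ b :: m ++ Δ ++ r) (by simp) ≫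
        sub (l ++ b :: m) r (foldCast x (by simp) ≫ h) f) g := by
  induction l generalizing x with
  | nil =>
    have e := sub_split Γ m r (x := x)
      (foldMap (unshift x Γ ≫ A.tensorHom (𝟙 x) g) (m ++ c :: r) ≫ h) f
    have e' := sub_foldMap m r (unshift x Γ ≫ A.tensorHom (𝟙 x) g) h f
    refine Eq.trans (congrArg (fun k => foldCast x (by simp) ≫ sub (Γ ++ m) r k f) ?_)
      ((congrArg (foldCast x (by simp) ≫ ·) (e.trans (congrArg (_ ≫ ·) e'))).trans ?_)
    · simp only [sub, split, eqToHom_trans_assoc]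
    · refine (eqToHom_trans_assoc _ _ _).trans (congrArg (_ ≫ _ ≫ ·) ?_)
      refine Eq.trans ?_ (Category.id_comp _).symm
      exact congrArg (fun k => sub m r k f) (Category.id_comp h).symm
  | cons a l ih => exact ih _

theorem split_foldMap_comp {x y z w d : A.C} (k : x ⟶ y) {Λ Γ Δ : List A.C} (p : Λ = Γ ++ Δ)
    (s : A.fold y Γ ⟶ z) (q : z ⟶ w) (h : A.fold w Δ ⟶ d) :
    split x p ≫ foldMap ((foldMap k Γ ≫ s) ≫ q) Δ ≫ h =
      foldMap k Λ ≫ split y p ≫ foldMap (s ≫ q) Δ ≫ h := by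
  simp only [foldMap_comp, Category.assoc]
  rw [reassoc_of% split_nat]

/-- Associativity with `unshift x` replaced by `shift x y` for arbitrary `y`. The generality lets
the induction on `l'` run: each entry of `l'` is absorbed into `y`, and the associator produced on
the way is moved out by naturality. -/
theorem sub_assoc_shift (r l' r' : List A.C) {x y : A.C} {Γ : List A.C} {b c d : A.C}
    (h : A.fold (A.tensorObj x c) r ⟶ d) (g : A.fold y (l' ++ b :: r') ⟶ c)
    (f : A.fold A.unit Γ ⟶ b) :
    sub l' (r' ++ r) (split (A.tensorObj x y) (by simp) ≫
        foldMap (shift x y (l' ++ b :: r') ≫ A.tensorHom (𝟙 x) g) r ≫ h) f =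
      split (A.tensorObj x y) (by simp) ≫
        foldMap (shift x y (l' ++ Γ ++ r') ≫ A.tensorHom (𝟙 x) (sub l' r' g f)) r ≫ h := by
  induction l' generalizing y with
  | nil =>
    have e₁ := shift_append x y (rfl : Γ ++ r' = Γ ++ r')
    -- Shifting `x` past an input commutes with filling that input by `f`: `α` is natural in `f`,
    -- and `unshift_α` exchanges it with `unshift`.
    have e₂ : foldMap (unshift (A.tensorObj x y) Γ ≫ A.tensorHom (𝟙 (A.tensorObj x y)) f) r' ≫
        shift x y (b :: r') =
        foldMap (shift x y Γ) r' ≫ shift x (A.fold y Γ) r' ≫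
          A.tensorHom (𝟙 x) (foldMap (unshift y Γ ≫ A.tensorHom (𝟙 y) f) r') := by
      simp only [shift]
      rw [← shift_nat, ← Category.assoc, ← foldMap_comp, ← Category.assoc (foldMap _ _),
        ← foldMap_comp, Category.assoc, ← A.tensor_id, A.α_nat, reassoc_of% unshift_α,
        ← id_tensor_comp]
    have e₃ : split (A.tensorObj x y) (rfl : Γ ++ (r' ++ r) = Γ ++ (r' ++ r)) ≫
        foldMap (unshift (A.tensorObj x y) Γ ≫ A.tensorHom (𝟙 (A.tensorObj x y)) f) (r' ++ r) ≫
          split (A.tensorObj (A.tensorObj x y) b) (rfl : r' ++ r = r' ++ r) ≫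
            foldMap (shift x y (b :: r') ≫ A.tensorHom (𝟙 x) g) r ≫ h =
        split (A.tensorObj x y) (by simp : Γ ++ (r' ++ r) = (Γ ++ r') ++ r) ≫
          foldMap (shift x y (Γ ++ r') ≫ A.tensorHom (𝟙 x) (split y (rfl : Γ ++ r' = Γ ++ r') ≫
            foldMap (unshift y Γ ≫ A.tensorHom (𝟙 y) f) r' ≫ g)) r ≫ h := by
      rw [reassoc_of% split_nat, ← Category.assoc (foldMap _ r), ← foldMap_comp,
        reassoc_of% e₂, id_tensor_comp, reassoc_of% e₁, id_tensor_comp]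
      simp only [foldMap_comp, Category.assoc]
      simp only [split, foldMap_eqToHom, eqToHom_trans_assoc]
    exact e₃
  | cons a l' ih =>
    refine (congrArg (fun k => sub l' _ k f) (split_foldMap_comp _
      (by simp : l' ++ b :: (r' ++ r) = (l' ++ b :: r') ++ r) _ _ _)).trans ?_
    refine (sub_foldMap _ _ _ _ _).trans ((congrArg (_ ≫ ·) (ih _)).trans ?_)
    exact (split_foldMap_comp _ _ _ _ _).symm

/-- With `l` absorbed, `unshift` is `ρ` followed by `shift x i`. The factor `ρ` acts on the base and
moves out on both sides, leaving `sub_assoc_shift` at `y = i`. -/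
theorem sub_assoc (l r l' r' : List A.C) {x : A.C} {Γ : List A.C} {b c d : A.C}
    (h : A.fold x (l ++ c :: r) ⟶ d) (g : A.fold A.unit (l' ++ b :: r') ⟶ c)
    (f : A.fold A.unit Γ ⟶ b) :
    foldCast x (by simp) ≫ sub l r h (sub l' r' g f) =
      sub (l ++ l') (r' ++ r)
        (foldCast x (Δ := l ++ (l' ++ b :: r') ++ r) (by simp) ≫ sub l r h g) f := by
  induction l generalizing x with
  | nil =>
    have e := sub_assoc_shift r l' r' h g f
    have e₁ := split_foldMap_comp (A.rho x) (by simp : l' ++ b :: (r' ++ r) = (l' ++ b :: r') ++ r)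
      (shift x A.unit _) (A.tensorHom (𝟙 x) g) h
    have e₂ := split_foldMap_comp (A.rho x) (by simp : l' ++ Γ ++ (r' ++ r) = (l' ++ Γ ++ r') ++ r)
      (shift x A.unit _) (A.tensorHom (𝟙 x) (sub l' r' g f)) h
    refine Eq.trans ?_ ((e₂.trans ((congrArg (_ ≫ ·) e.symm).trans
      (sub_foldMap l' (r' ++ r) _ _ f).symm)).trans (congrArg (fun k => sub l' _ k f) ?_))
    · exact eqToHom_trans_assoc _ _ _
    · refine e₁.symm.trans ?_
      exact (eqToHom_trans_assoc _ _ _).symm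
  | cons a l ih => exact ih _

theorem sub_id (l r : List A.C) {x a b : A.C} (g : A.fold x (l ++ a :: r) ⟶ b) :
    eqToHom (by simp) ≫ sub l r (Γ := [a]) g (A.lam a) = g := by
  induction l generalizing x with
  | nil =>
    have h : foldMap (unshift x [a] ≫ A.tensorHom (𝟙 x) (A.lam a)) r = 𝟙 _ := by
      rw [unshift_singleton, foldMap_id]
    refine (Category.id_comp _).trans ((Category.id_comp _).trans ?_)
    exact (congrArg (· ≫ g) h).trans (Category.id_comp g)
  | cons a l ih => exact ih _

theorem castDom_eq_comp {Γ Δ : List A.C} {b : A.C} (e : Γ = Δ) (f : A.fold A.unit Γ ⟶ b) :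
    castDom (H := fun Γ b => A.fold A.unit Γ ⟶ b) e f = eqToHom (by rw [e]) ≫ f := by
  subst e
  simp

/-- The multicategory of a skew monoidal category: multimaps `a₁, …, aₙ → b` are the maps
`((i a₁) ⋯) aₙ ⟶ b`. -/
def multicategory (A : SkewMonoidalCategory.{v, u}) : Multicategory.{v, u} where
  Obj := A.C
  Hom Γ b := A.fold A.unit Γ ⟶ b
  id a := A.lam a
  comp l r _ _ _ g f := sub l r g f
  id_comp {Γ b} g := by
    rw [castDom_eq_comp]
    refine (eqToHom_trans_assoc _ _ _).trans ((Category.id_comp _).trans ?_)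
    -- Substituting into the identity multimap `λ` leaves `unshift` followed by `i g` and `λ`;
    -- naturality of `λ` brings it next to `unshift`, which it cancels.
    refine (Category.assoc _ _ _).trans ((congrArg (_ ≫ ·) (A.lam_nat g)).trans ?_)
    rw [reassoc_of% unshift_lam]
  comp_id l r a b g := by
    rw [castDom_eq_comp, sub_id]
  assoc l r l' r' Γ b c d h g f := by
    simp only [castDom_eq_comp]
    exact sub_assoc l r l' r' h g f
  comm l m r Γ Δ b c d h g f := by
    simp only [castDom_eq_comp]
    exact sub_comm l m r h g f

/-- When the outer multimap begins with `λ`, that `λ` cancels the `unshift` of the substitution, and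
`f` is simply placed in front. Classifiers and unary multimaps have this form. -/
theorem sub_lam (r : List A.C) {Γ : List A.C} {b c : A.C} (g : A.fold b r ⟶ c)
    (f : A.fold A.unit Γ ⟶ b) :
    sub (x := A.unit) [] r (foldMap (A.lam b) r ≫ g) f =
      split A.unit (rfl : Γ ++ r = Γ ++ r) ≫ foldMap f r ≫ g := by
  simp only [sub]
  rw [← Category.assoc (foldMap _ r), ← foldMap_comp, Category.assoc, A.lam_nat,
    reassoc_of% unshift_lam]

theorem sub_lam_comp (r : List A.C) {x a b c : A.C} (g : A.fold x (b :: r) ⟶ c) (p : a ⟶ b) :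
    sub (Γ := [a]) [] r g (A.lam a ≫ p) = foldMap (A.tensorHom (𝟙 x) p) r ≫ g := by
  refine (Category.id_comp _).trans (congrArg (fun k => foldMap k r ≫ g) ?_)
  rw [id_tensor_comp]
  exact (reassoc_of% unshift_singleton x a) _

/-! ### Left normality gives left representability. -/

theorem isIso_foldMap {x y : A.C} (f : x ⟶ y) [IsIso f] (Γ : List A.C) : IsIso (foldMap f Γ) :=
  ⟨foldMap (inv f) Γ, by rw [← foldMap_comp, IsIso.hom_inv_id, foldMap_id],
    by rw [← foldMap_comp, IsIso.inv_hom_id, foldMap_id]⟩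

theorem IsLeftNormal.isIso_unshift (h : A.IsLeftNormal) (Γ : List A.C) :
    IsIso (unshift A.unit Γ) := by
  have := h (A.fold A.unit Γ)
  have e : unshift A.unit Γ = inv (A.lam _) := by
    rw [← cancel_mono (A.lam _), unshift_lam, IsIso.inv_hom_id]
  rw [e]
  infer_instance

/-- Substitution into the first input is precomposition with a map assembled from `unshift i Γ` and
`i θ`. Left normality makes the first invertible, with inverse `λ`, and `θ` is invertible by
hypothesis. -/
theorem IsLeftNormal.bijective_sub (h : A.IsLeftNormal) {Γ : List A.C} {m : A.C}
    (θ : A.fold A.unit Γ ⟶ m) [IsIso θ] (r : List A.C) (d : A.C) :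
    Function.Bijective fun g : A.fold A.unit (m :: r) ⟶ d => sub (x := A.unit) [] r g θ := by
  have := h.isIso_unshift Γ
  have : IsIso (A.tensorHom (𝟙 A.unit) θ) :=
    ⟨A.tensorHom (𝟙 A.unit) (inv θ), by rw [← id_tensor_comp, IsIso.hom_inv_id, A.tensor_id],
      by rw [← id_tensor_comp, IsIso.inv_hom_id, A.tensor_id]⟩
  have := isIso_foldMap (unshift A.unit Γ ≫ A.tensorHom (𝟙 A.unit) θ) r
  have : IsIso (split A.unit (rfl : Γ ++ r = Γ ++ r)) := by unfold split; infer_instance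
  refine ⟨fun g g' e => ?_, fun f => ⟨inv (foldMap (unshift A.unit Γ ≫
    A.tensorHom (𝟙 A.unit) θ) r) ≫ inv (split A.unit (rfl : Γ ++ r = Γ ++ r)) ≫ f, ?_⟩⟩
  · exact (cancel_epi _).1 ((cancel_epi _).1 e)
  · exact (congrArg (_ ≫ ·) (IsIso.hom_inv_id_assoc _ _)).trans (IsIso.hom_inv_id_assoc _ _)

theorem IsLeftNormal.isLeftUniversal (h : A.IsLeftNormal) {Γ : List A.C} {m : A.C}
    (θ : A.fold A.unit Γ ⟶ m) [IsIso θ] :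
    A.multicategory.IsLeftUniversal (Γ := Γ) (m := m) θ :=
  ⟨fun d => h.bijective_sub θ [] d, fun r d => h.bijective_sub θ r d⟩

theorem IsLeftNormal.isLeftRepresentable (h : A.IsLeftNormal) :
    A.multicategory.IsLeftRepresentable := fun Γ =>
  ⟨A.fold A.unit Γ, 𝟙 (A.fold A.unit Γ), h.isLeftUniversal _⟩

end SkewMonoidalCategory

/-! ### The functors `K` and `U_lr` are essentially surjective -/

namespace ShortMulticategory.Classifiers

theorem laxFunctor_id {M : ShortMulticategory.{v, u}} (χ : M.Classifiers) :
    χ.laxFunctor χ (Morphism.id M) = SkewMonoidalCategory.LaxFunctor.id _ := by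
  refine SkewMonoidalCategory.LaxFunctor.ext_of rfl (heq_of_eq ?_) (heq_of_eq ?_)
  · exact χ.hom_ext₀ ((χ.lift₀_spec _).trans (M.map₀_id _).symm)
  · funext a b
    exact χ.hom_ext₂ ((χ.lift₂_spec _).trans (M.map₂_id _).symm)

/-- The classifiers are allowed to vary. The functor `K` uses a prescribed choice, while the
comparison with `A` uses the tensor product of `A`, and this functoriality bridges the two. -/
theorem laxFunctor_comp {M N P : ShortMulticategory.{v, u}} (χ : M.Classifiers)
    (ψ : N.Classifiers) (ω : P.Classifiers) (F : Morphism M N) (G : Morphism N P) :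
    (χ.laxFunctor ψ F).comp (ψ.laxFunctor ω G) = χ.laxFunctor ω (F.comp G) := by
  refine SkewMonoidalCategory.LaxFunctor.ext_of rfl (heq_of_eq ?_) (heq_of_eq ?_)
  · exact (χ.lift₀_comp ψ F ω G).symm
  · funext a b
    exact (χ.lift₂_comp ψ F ω G a b).symm

/-- The skew monoidal category of a short multicategory does not depend on the choice of
classifiers. -/
noncomputable def skewMonoidalIso {M : ShortMulticategory.{v, u}} (χ ψ : M.Classifiers) :
    χ.skewMonoidal ≅ ψ.skewMonoidal where
  hom := χ.laxFunctor ψ (Morphism.id M)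
  inv := ψ.laxFunctor χ (Morphism.id M)
  hom_inv_id := (χ.laxFunctor_comp ψ χ _ _).trans χ.laxFunctor_id
  inv_hom_id := (ψ.laxFunctor_comp χ ψ _ _).trans ψ.laxFunctor_id

end ShortMulticategory.Classifiers

namespace SkewMonoidalCategory

variable {A : SkewMonoidalCategory.{v, u}}

theorem isIso_tensorHom {a a' b b' : A.C} (f : a ⟶ a') (g : b ⟶ b') [IsIso f] [IsIso g] :
    IsIso (A.tensorHom f g) :=
  ⟨A.tensorHom (inv f) (inv g), by rw [← A.tensor_comp, IsIso.hom_inv_id, IsIso.hom_inv_id,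
    A.tensor_id], by rw [← A.tensor_comp, IsIso.inv_hom_id, IsIso.inv_hom_id, A.tensor_id]⟩

/-! ### Structure maps of the multicategory of `A`, computed on its classifiers. -/

/-- The classifier of `[a, b]` in the multicategory of a skew monoidal category. -/
def binaryClassifier (a b : A.C) : A.fold A.unit [a, b] ⟶ A.tensorObj a b :=
  A.tensorHom (A.lam a) (𝟙 b)

theorem IsLeftNormal.isIso_binaryClassifier (h : A.IsLeftNormal) (a b : A.C) :
    IsIso (binaryClassifier a b) :=
  haveI := h a
  isIso_tensorHom _ _

/-- A map, as a unary multimap. -/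
def toUnary {a b : A.C} (f : a ⟶ b) : A.fold A.unit [a] ⟶ b :=
  A.lam a ≫ f

theorem sub_toUnary_left {Γ : List A.C} {b c : A.C} (g : b ⟶ c) (f : A.fold A.unit Γ ⟶ b) :
    sub [] [] (toUnary g) f = foldCast _ (by simp) ≫ f ≫ g :=
  sub_lam [] g f

theorem sub_toUnary (r : List A.C) {x a b c : A.C} (g : A.fold x (b :: r) ⟶ c) (p : a ⟶ b) :
    sub [] r g (toUnary p) = foldMap (A.tensorHom (𝟙 x) p) r ≫ g :=
  sub_lam_comp r g p

theorem binaryClassifier_nat {a a' b b' : A.C} (p : a ⟶ a') (q : b ⟶ b') :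
    sub (Γ := [b]) [a] [] (sub (Γ := [a]) [] [b'] (binaryClassifier a' b') (toUnary p))
        (toUnary q) =
      binaryClassifier a b ≫ A.tensorHom p q := by
  refine (sub_toUnary [] _ _).trans ?_
  refine (congrArg (_ ≫ ·) (sub_toUnary [b'] _ _)).trans ?_
  simp only [binaryClassifier, foldMap]
  rw [← A.tensor_comp, ← A.tensor_comp, ← A.tensor_comp, A.lam_nat]
  simp

theorem binaryClassifier_sub_left (a b c : A.C) :
    sub (Γ := [a, b]) [] [c] (binaryClassifier (A.tensorObj a b) c) (binaryClassifier a b) =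
      A.tensorHom (binaryClassifier a b) (𝟙 c) := by
  have h := sub_lam [c] (𝟙 (A.tensorObj (A.tensorObj a b) c)) (binaryClassifier a b)
  rw [Category.comp_id, Category.comp_id] at h
  exact h.trans (Category.id_comp _)

/-- `unshift a [b, c]` is `ρ_a` followed by two associators through `i`. Naturality of `α` moves
`λ_b` before the second associator; the triangle tensored with `c` then cancels `ρ`, the first
associator and `λ_b`. -/
theorem unshift_binaryClassifier (a b c : A.C) :
    unshift a [b, c] ≫ A.tensorHom (𝟙 a) (binaryClassifier b c) = A.α a b c := by
  have h := congrArg (A.tensorHom · (𝟙 c)) (A.triangle a b)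
  simp only [tensor_comp_id, A.tensor_id] at h
  simp only [unshift, shift, foldMap, Category.comp_id, Category.assoc, binaryClassifier]
  rw [← A.α_nat, reassoc_of% h]

/-- The leading `λ_a` is exchanged with the second factor and, by naturality, moved ahead of
`unshift`; the rest is `unshift_binaryClassifier`. With `binaryClassifier_sub_left` this says that
`α` of `A` satisfies the equation characterizing the associator of the classifiers. -/
theorem binaryClassifier_sub_right (a b c : A.C) :
    sub (Γ := [b, c]) [a] [] (binaryClassifier a (A.tensorObj b c)) (binaryClassifier b c) =
      A.tensorHom (binaryClassifier a b) (𝟙 c) ≫ A.α a b c := by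
  refine (Category.id_comp _).trans ((Category.assoc _ _ _).trans ?_)
  refine (congrArg (_ ≫ ·) (tensor_exchange _ _)).trans ?_
  have h := unshift_nat (A.lam a) [b, c]
  rw [← reassoc_of% h, unshift_binaryClassifier]
  rfl

theorem binaryClassifier_sub_unit_left (a : A.C) :
    sub (Γ := []) [] [a] (binaryClassifier A.unit a) (𝟙 A.unit) = 𝟙 (A.tensorObj A.unit a) := by
  have h := sub_lam (Γ := []) [a] (𝟙 (A.tensorObj A.unit a)) (𝟙 A.unit)
  rw [Category.comp_id, Category.comp_id] at h
  exact h.trans ((Category.id_comp _).trans (A.tensor_id _ _))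

theorem binaryClassifier_sub_unit_right (a : A.C) :
    sub (Γ := []) [a] [] (binaryClassifier a A.unit) (𝟙 A.unit) = toUnary (A.rho a) := by
  refine (Category.id_comp _).trans ((Category.assoc _ _ _).trans ?_)
  refine (congrArg (_ ≫ ·) ((congrArg (· ≫ _) (A.tensor_id _ _)).trans (Category.id_comp _))).trans ?_
  refine (Category.assoc _ _ _).trans ((congrArg (_ ≫ ·) (Category.id_comp _)).trans ?_)
  exact (A.rho_nat _).symm

/-- The classifiers in the multicategory of a left normal skew monoidal category given by its
tensor product and unit. -/
def IsLeftNormal.classifiers (h : A.IsLeftNormal) : A.multicategory.toShort.Classifiers where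
  unit := A.unit
  u := (𝟙 A.unit : A.fold A.unit [] ⟶ A.unit)
  u_univ :=
    have H := h.isLeftUniversal (Γ := []) (m := A.unit) (𝟙 A.unit)
    ⟨H.1, fun x d => H.2 [x] d, fun x y d => H.2 [x, y] d⟩
  tensor := A.tensorObj
  θ a b := binaryClassifier (A := A) a b
  θ_univ a b := by
    have := h.isIso_binaryClassifier a b
    have H := h.isLeftUniversal (Γ := [a, b]) (binaryClassifier (A := A) a b)
    refine ⟨fun d => ?_, fun x d => H.2 [x] d, fun x y d => H.2 [x, y] d⟩
    -- The short multicategory expresses postcomposition through the action with identities on the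
    -- inputs, the multicategory through substitution; the two functions are equal.
    refine Eq.mp (congrArg Function.Bijective ?_) (H.1 d)
    funext g
    exact (A.multicategory.act₂_post (a₁ := a) (a₂ := b) g _).symm

/-- The functor from `A` to the underlying category of its multicategory. -/
def toMulticategory (A : SkewMonoidalCategory.{v, u}) : A.C ⥤ A.multicategory.toShort.C where
  obj a := a
  map f := toUnary (A := A) f
  map_id a := Category.comp_id (A.lam a)
  map_comp f g := by
    refine Eq.symm ((sub_toUnary_left g (toUnary f)).trans ?_)
    exact (Category.id_comp _).trans (Category.assoc _ _ _)

theorem multicategory_post {Γ : List A.C} {b c : A.C} (g : b ⟶ c) (f : A.fold A.unit Γ ⟶ b) :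
    A.multicategory.post (Γ := Γ) (toUnary g) f = f ≫ g := by
  refine (castDom_eq_comp _ _).trans ?_
  refine (congrArg (_ ≫ ·) (sub_toUnary_left g f)).trans ?_
  exact (eqToHom_trans_assoc _ _ _).trans (Category.id_comp _)

/-! ### The isomorphism between `A` and the skew monoidal category of its multicategory. -/

namespace IsLeftNormal

variable (h : A.IsLeftNormal)

/-- Both sides are maps out of a classifier, so it suffices to compare them on it, where the
computation in `A` applies. The associator and `λ` are treated in the same way, and `ρ` directly. -/
theorem tensorHom_toMulticategory {a a' b b' : A.C} (p : a ⟶ a') (q : b ⟶ b') :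
    h.classifiers.tensorHom (A.toMulticategory.map p) (A.toMulticategory.map q) =
      A.toMulticategory.map (A.tensorHom p q) := by
  refine h.classifiers.hom_ext₂ ((h.classifiers.tensorHom_spec _ _).trans ?_)
  refine (A.multicategory.post_id (Γ := [a, b])
    (sub (Γ := [b]) [a] [] (sub (Γ := [a]) [] [b'] (binaryClassifier a' b') (toUnary p))
      (toUnary q))).trans ?_
  refine (binaryClassifier_nat p q).trans ?_
  refine (multicategory_post (Γ := [a, b]) _ _).symm.trans ?_
  exact (A.multicategory.act₂_post (a₁ := a) (a₂ := b) _ _).symm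

theorem assoc_toMulticategory (a b c : A.C) :
    h.classifiers.assoc a b c = A.toMulticategory.map (A.α a b c) := by
  refine h.classifiers.hom_ext₃ ((h.classifiers.assoc_spec _ _ _).trans ?_)
  refine (binaryClassifier_sub_right a b c).trans ?_
  refine ((congrArg (· ≫ _) (binaryClassifier_sub_left a b c)).symm).trans ?_
  refine (multicategory_post (Γ := [a, b, c]) _ _).symm.trans ?_
  exact (A.multicategory.act₃_post (a₁ := a) (a₂ := b) (a₃ := c) _ _).symm

theorem lam_toMulticategory (a : A.C) :
    h.classifiers.lam a = A.toMulticategory.map (A.lam a) := by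
  refine h.classifiers.hom_extη ((h.classifiers.lam_spec a).trans ?_)
  refine Eq.trans ?_ (congrArg (A.multicategory.post (Γ := [a]) (toUnary (A.lam a)))
    (binaryClassifier_sub_unit_left a)).symm
  exact ((multicategory_post (Γ := [a]) _ _).trans (Category.id_comp _)).symm

theorem rho_toMulticategory (a : A.C) :
    h.classifiers.rho a = A.toMulticategory.map (A.rho a) :=
  binaryClassifier_sub_unit_right a

/-- The map given by a unary multimap. -/
noncomputable def ofUnary {a b : A.C} (f : A.fold A.unit [a] ⟶ b) : a ⟶ b :=
  haveI := h a
  inv (A.lam a) ≫ f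

theorem ofUnary_toUnary {a b : A.C} (f : a ⟶ b) : h.ofUnary (toUnary f) = f :=
  haveI := h a
  IsIso.inv_hom_id_assoc _ _

theorem toUnary_ofUnary {a b : A.C} (f : A.fold A.unit [a] ⟶ b) : toUnary (h.ofUnary f) = f :=
  haveI := h a
  IsIso.hom_inv_id_assoc _ _

theorem ofUnary_lam (a : A.C) : h.ofUnary (A.lam a) = 𝟙 a :=
  haveI := h a
  IsIso.inv_hom_id _

theorem ofUnary_sub {a b c : A.C} (f : A.fold A.unit [a] ⟶ b) (g : A.fold A.unit [b] ⟶ c) :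
    h.ofUnary (sub (Γ := [a]) [] [] g f) = h.ofUnary f ≫ h.ofUnary g := by
  obtain ⟨g, rfl⟩ : ∃ g', toUnary g' = g := ⟨_, h.toUnary_ofUnary g⟩
  refine (congrArg h.ofUnary (sub_toUnary_left g f)).trans ?_
  rw [h.ofUnary_toUnary]
  simp [ofUnary]

/-- The inverse of the functor `A.toMulticategory`. -/
noncomputable def ofMulticategory : A.multicategory.toShort.C ⥤ A.C where
  obj a := a
  map f := h.ofUnary f
  map_id a := h.ofUnary_lam a
  map_comp f g := h.ofUnary_sub f g

/-- The identity functor as a lax monoidal functor from `A` to the skew monoidal category of its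
multicategory. -/
noncomputable def laxTo : LaxFunctor A h.classifiers.skewMonoidal where
  functor := A.toMulticategory
  -- Objects, tensor products and unit are literally those of `A`; only the hom sets change. Hence
  -- identities serve as `f₀` and `f₂`, and the laws say that the structure maps correspond.
  f₀ := 𝟙 h.classifiers.skewMonoidal.unit
  f₂ a b := 𝟙 (h.classifiers.skewMonoidal.tensorObj a b)
  f₂_nat p q := by
    refine (Category.comp_id _).trans (Eq.trans ?_ (Category.id_comp _).symm)
    exact h.tensorHom_toMulticategory p q
  map_α a b c := by
    refine (congrArg₂ (· ≫ ·) (tensor_id _ _ _) rfl).trans ?_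
    refine (Category.id_comp _).trans ((Category.id_comp _).trans ?_)
    refine Eq.trans ?_ (congrArg (_ ≫ ·) ((Category.comp_id _).trans (tensor_id _ _ _))).symm
    exact (h.assoc_toMulticategory a b c).symm.trans (Category.comp_id _).symm
  map_lam a := by
    refine (congrArg₂ (· ≫ ·) (tensor_id _ _ _) rfl).trans ?_
    refine (Category.id_comp _).trans ((Category.id_comp _).trans ?_)
    exact (h.lam_toMulticategory a).symm
  map_rho a := by
    refine (congrArg (_ ≫ ·) ((Category.comp_id _).trans (tensor_id _ _ _))).trans ?_
    exact (Category.comp_id _).trans (h.rho_toMulticategory a)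

theorem ofMulticategory_toMulticategory {a b : A.C} (f : a ⟶ b) :
    h.ofMulticategory.map (A.toMulticategory.map f) = f :=
  h.ofUnary_toUnary f

/-- The identity functor as a lax monoidal functor to `A` from the skew monoidal category of its
multicategory. -/
noncomputable def laxFrom : LaxFunctor h.classifiers.skewMonoidal A where
  functor := h.ofMulticategory
  f₀ := 𝟙 A.unit
  f₂ a b := 𝟙 (A.tensorObj a b)
  f₂_nat {a a' b b'} p q := by
    refine (Category.comp_id _).trans (Eq.trans ?_ (Category.id_comp _).symm)
    -- Unary multimaps are images of maps of `A` under the inverse bijection, so the statement for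
    -- `toMulticategory` transfers.
    have e := h.tensorHom_toMulticategory (h.ofMulticategory.map p) (h.ofMulticategory.map q)
    have e₁ : A.toMulticategory.map (h.ofMulticategory.map p) = p := h.toUnary_ofUnary p
    have e₂ : A.toMulticategory.map (h.ofMulticategory.map q) = q := h.toUnary_ofUnary q
    refine (h.ofMulticategory_toMulticategory _).symm.trans (congrArg h.ofMulticategory.map ?_)
    exact e.symm.trans (congrArg₂ h.classifiers.tensorHom e₁ e₂)
  map_α a b c := by
    refine (congrArg₂ (· ≫ ·) (tensor_id _ _ _) rfl).trans ?_
    refine (Category.id_comp _).trans ((Category.id_comp _).trans ?_)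
    refine Eq.trans ?_ (congrArg (_ ≫ ·) ((Category.comp_id _).trans (tensor_id _ _ _))).symm
    refine Eq.trans ?_ (Category.comp_id _).symm
    exact (congrArg h.ofMulticategory.map (h.assoc_toMulticategory a b c)).trans
      (h.ofMulticategory_toMulticategory _)
  map_lam a := by
    refine (congrArg₂ (· ≫ ·) (tensor_id _ _ _) rfl).trans ?_
    refine (Category.id_comp _).trans ((Category.id_comp _).trans ?_)
    exact (congrArg h.ofMulticategory.map (h.lam_toMulticategory a)).trans
      (h.ofMulticategory_toMulticategory _)
  map_rho a := by
    refine (congrArg (_ ≫ ·) ((Category.comp_id _).trans (tensor_id _ _ _))).trans ?_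
    refine (Category.comp_id _).trans (Eq.symm ?_)
    exact (congrArg h.ofMulticategory.map (h.rho_toMulticategory a)).trans
      (h.ofMulticategory_toMulticategory _)

/-- A left normal skew monoidal category is isomorphic to that of its multicategory. -/
noncomputable def iso : A ≅ h.classifiers.skewMonoidal where
  hom := h.laxTo
  inv := h.laxFrom
  hom_inv_id := by
    refine LaxFunctor.ext_of ?_ (heq_of_eq ?_) (heq_of_eq ?_)
    · exact CategoryTheory.Functor.ext (fun _ => rfl) fun a b f => (h.ofUnary_toUnary f).trans
        ((Category.id_comp _).trans (Category.comp_id _)).symm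
    · exact (Category.id_comp _).trans (h.ofMulticategory.map_id _)
    · funext a b
      exact (Category.id_comp _).trans (h.ofMulticategory.map_id _)
  inv_hom_id := by
    refine LaxFunctor.ext_of ?_ (heq_of_eq ?_) (heq_of_eq ?_)
    · exact CategoryTheory.Functor.ext (fun _ => rfl) fun a b f => (h.toUnary_ofUnary f).trans
        ((Category.id_comp _).trans (Category.comp_id _)).symm
    · exact (Category.id_comp _).trans (A.toMulticategory.map_id _)
    · funext a b
      exact (Category.id_comp _).trans (A.toMulticategory.map_id _)

end IsLeftNormal

end SkewMonoidalCategory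

/-! ### Assembly of the two equivalences. -/

section equivalence

variable (χ : ∀ M : LeftRepShortMulticategory.{v, u}, M.obj.Classifiers)

/-- Every left normal skew monoidal category is isomorphic to that of its multicategory. -/
noncomputable def functorUlrCompKIso (A : LeftNormalSkewMonoidalCategory.{v, u}) :
    (functorK χ).obj (functorUlr.obj ⟨A.obj.multicategory, A.property.isLeftRepresentable⟩) ≅ A :=
  ObjectProperty.isoMk _
    (((χ _).skewMonoidalIso A.property.classifiers).trans A.property.iso.symm)

instance functorK_essSurj : (functorK χ).EssSurj where
  mem_essImage A := ⟨_, ⟨functorUlrCompKIso χ A⟩⟩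

instance functorUlr_essSurj : functorUlr.{v, u}.EssSurj where
  mem_essImage M := by
    have χ : ∀ M : LeftRepShortMulticategory.{v, u}, M.obj.Classifiers :=
      fun M => M.property.nonempty_classifiers.some
    -- The preimage of `M` is the multicategory of `K M`. Its image under `U_lr` becomes isomorphic
    -- to `M` after applying `K`, and the fully faithful `K` lifts that isomorphism.
    exact ⟨_, ⟨(functorK χ).preimageIso (functorUlrCompKIso χ ((functorK χ).obj M))⟩⟩

end equivalence

theorem mainTheorem1
    (χ : ∀ M : LeftRepShortMulticategory.{v, u}, ShortMulticategory.Classifiers M.obj) :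
    (functorK χ).IsEquivalence ∧ functorUlr.{v, u}.IsEquivalence := by
  -- Faithfulness, fullness and essential surjectivity are all supplied by the instances.
  exact ⟨{}, {}⟩
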